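/- Let $G$ be a (finite-dimensional, real) Lie group with Lie algebra $\mathfrak g$, and let $(G,D)$ be an almost Dirac group with $D=L(\beta,U)$. That is: $U_x\subset T_x^*G_{\mathbb C}$ is a subspace and $\beta_x\in\wedge^2U_x^*$ for every $x\in G$; $D=L(\beta,U)=\{X+\xi \mid \xi\in U,\ X|_U=\iota_\xi\beta\}$ is a complex almost Dirac structure, i.e. a smooth maximal isotropic subbundle of $(TG\oplus T^*G)\otimes\mathbb C$ for the pairing $\langle X+\xi,Y+\eta\rangle=\eta(X)+\xi(Y)$; and the multiplication $\mu:(G\times G,D\oplus D)\to(G,D)$ is a Dirac map, i.e. for every point $p=(g,h)$ the map $f=d\mu_p$ from $V_1=T_p(G\times G)_{\mathbb C}$ to $V_2=T_{gh}G_{\mathbb C}$, with $L_1=(D\oplus D)_p$ and $L_2=D_{gh}$, satisfies $f(L_1\cap V_1)\subset L_2\cap V_2$ and $p_{V_1^*}^{-1}\bigl(f^*(p_{V_2^*}L_2)\bigr)\cap L_1\subset\{X+f^*\xi \mid fX+\xi\in L_2\}$, where $p_{V_i^*}:V_i\oplus V_i^*\to V_i^*$ is the projection. Let $\mathfrak k=\mathrm{Ann}(U_e)\subset\mathfrak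 g_{\mathbb C}$, trivialize $TG_{\mathbb C}\simeq G\times\mathfrak g_{\mathbb C}$ by left translation, and view $\beta$ as a map $G\to\wedge^2(\mathfrak g_{\mathbb C}/\mathfrak k)$. Let $\mathcal F$ be the sheaf of smooth complex functions on open subsets of $G$ that are annihilated by all vectors in $G\times\mathfrak k\subset TG_{\mathbb C}$, and let $\{f,g\}=\beta(df,dg)$ for $f,g\in\mathcal F$. Then the following are equivalent: 1. $(G,D)$ is a Dirac group, i.e. $D$ is integrable: the Courant bracket $[X+\xi,Y+\eta]=[X,Y]+\iota_Xd\eta+\tfrac12d(\iota_X\eta)-\iota_Yd\xi-\tfrac12d(\iota_Y\xi)$ of any two smooth local sections of $D$ is a section of $D$. 2. The bracket $\{\,,\}$ on $\mathcal F$ satisfies the Jacobi identity: for every open $V\subset G$ and $f,g,h\in\mathcal F(V)$, the iterated brackets are defined, i.e. $\{g,h\},\{h,f\},\{f,g\}\in\mathcal F(V)$, and $\{f,\{g,h\}\}+\{g,\{h,f\}\}+\{h,\{f,g\}\}=0$ on $V$. 3. $[\beta,\beta]=0$, i.e. the Schouten bracket $[\beta,\beta]:G\to\wedge^3(\mathfrak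 g_{\mathbb C}/\mathfrak k)$ is defined and vanishes. Here $[\beta,\beta]$ is defined when $d_g\beta(\mathfrak k)=0$ for all $g\in G$; it is then the image under $\wedge^3\mathfrak g_{\mathbb C}\to\wedge^3(\mathfrak g_{\mathbb C}/\mathfrak k)$ of the Schouten bracket $[\hat\beta,\hat\beta]$, where $\hat\beta:G\to\wedge^2\mathfrak g_{\mathbb C}$ is the lift of $\beta$ along a linear splitting of $\mathfrak g_{\mathbb C}\to\mathfrak g_{\mathbb C}/\mathfrak k$ (any splitting). Moreover, if 2 holds then $\{\,,\}$ is a Lie bracket on $\mathcal F$, i.e. it makes $\mathcal F$ a sheaf of complex Lie algebras. -/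

import Mathlib

open scoped Manifold ContDiff TensorProduct

noncomputable section

namespace DiracGroup

/-! ### Linear Dirac structures on a complex vector space -/

section Linear

variable {V W : Type*} [AddCommGroup V] [Module ℂ V] [AddCommGroup W] [Module ℂ W]

/-- The pairing `⟨X + ξ, Y + η⟩ = η(X) + ξ(Y)` on `V ⊕ V*`. -/
def pairing (p q : V × Module.Dual ℂ V) : ℂ := q.2 p.1 + p.2 q.1

/-- A subspace of `V ⊕ V*` is isotropic if the pairing vanishes on it. -/
def IsIsotropic (L : Submodule ℂ (V × Module.Dual ℂ V)) : Prop :=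
  ∀ p ∈ L, ∀ q ∈ L, pairing p q = 0

/-- A linear Dirac structure: a maximal isotropic subspace of `V ⊕ V*`. -/
def IsLinearDirac (L : Submodule ℂ (V × Module.Dual ℂ V)) : Prop :=
  Maximal IsIsotropic L

/-- The subspace `L(π, U) = {X + ξ | ξ ∈ U, X|_U = ι_ξ π}` of `V ⊕ V*`, for a subspace `U` of `V*`
and a bilinear form `π` on `U`. -/
def graphL (U : Submodule ℂ (Module.Dual ℂ V)) (π : U →ₗ[ℂ] U →ₗ[ℂ] ℂ) :
    Submodule ℂ (V × Module.Dual ℂ V) where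
  carrier := {p | ∃ h : p.2 ∈ U, ∀ η : U, (η : Module.Dual ℂ V) p.1 = π ⟨p.2, h⟩ η}
  add_mem' := by
    rintro p q ⟨hp, hp'⟩ ⟨hq, hq'⟩
    refine ⟨U.add_mem hp hq, fun η => ?_⟩
    have : (⟨(p + q).2, U.add_mem hp hq⟩ : U) = ⟨p.2, hp⟩ + ⟨q.2, hq⟩ := rfl
    rw [this, map_add, LinearMap.add_apply, ← hp', ← hq', Prod.fst_add, map_add]
  zero_mem' := by
    refine ⟨U.zero_mem, fun η => ?_⟩
    have : (⟨(0 : V × Module.Dual ℂ V).2, U.zero_mem⟩ : U) = 0 := rfl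
    rw [this, map_zero, LinearMap.zero_apply, Prod.fst_zero, map_zero]
  smul_mem' := by
    rintro c p ⟨hp, hp'⟩
    refine ⟨U.smul_mem c hp, fun η => ?_⟩
    have : (⟨(c • p).2, U.smul_mem c hp⟩ : U) = c • ⟨p.2, hp⟩ := rfl
    rw [this, map_smul, LinearMap.smul_apply, ← hp', Prod.smul_fst, map_smul]

/-- The pullback `f^⋆ L = {X + f^* ξ | f X + ξ ∈ L}`. -/
def linPullback (f : V →ₗ[ℂ] W) (L : Submodule ℂ (W × Module.Dual ℂ W)) :
    Set (V × Module.Dual ℂ V) :=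
  {p | ∃ ξ : Module.Dual ℂ W, p.2 = ξ ∘ₗ f ∧ (f p.1, ξ) ∈ L}

/-- A linear Dirac map `f : (V, L₁) → (W, L₂)`:
`f (L₁ ∩ V) ⊆ L₂ ∩ W` and `p_{V*}⁻¹ (f^* (p_{W*} L₂)) ∩ L₁ ⊆ f^⋆ L₂`. -/
def IsLinearDiracMap (f : V →ₗ[ℂ] W) (L₁ : Submodule ℂ (V × Module.Dual ℂ V))
    (L₂ : Submodule ℂ (W × Module.Dual ℂ W)) : Prop :=
  (∀ X : V, (X, (0 : Module.Dual ℂ V)) ∈ L₁ → (f X, (0 : Module.Dual ℂ W)) ∈ L₂) ∧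
  (∀ p ∈ L₁, (∃ q ∈ L₂, p.2 = q.2 ∘ₗ f) → p ∈ linPullback f L₂)

/-- The direct sum of subspaces of `V ⊕ V*` and `W ⊕ W*`, as a subspace of
`(V × W) ⊕ (V × W)*`. -/
def prodL (L₁ : Submodule ℂ (V × Module.Dual ℂ V)) (L₂ : Submodule ℂ (W × Module.Dual ℂ W)) :
    Submodule ℂ ((V × W) × Module.Dual ℂ (V × W)) where
  carrier := {p | (p.1.1, p.2 ∘ₗ LinearMap.inl ℂ V W) ∈ L₁ ∧
    (p.1.2, p.2 ∘ₗ LinearMap.inr ℂ V W) ∈ L₂}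
  add_mem' := by
    rintro p q ⟨hp, hp'⟩ ⟨hq, hq'⟩
    exact ⟨L₁.add_mem hp hq, L₂.add_mem hp' hq'⟩
  zero_mem' := ⟨L₁.zero_mem, L₂.zero_mem⟩
  smul_mem' := by
    rintro c p ⟨hp, hp'⟩
    exact ⟨L₁.smul_mem c hp, L₂.smul_mem c hp'⟩

/-- The value `(u ∧ v ∧ w)(α, β, γ)` of a decomposable trivector on three covectors. -/
def wedge3 (u v w : V) (α β γ : Module.Dual ℂ V) : ℂ :=
  Matrix.det (Matrix.of fun i j : Fin 3 => (![α, β, γ] i) (![u, v, w] j))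

end Linear

/-! ### Complexified tangent and cotangent bundles -/

variable (E : Type*) [NormedAddCommGroup E] [NormedSpace ℝ E]
  {G : Type*} [TopologicalSpace G] [ChartedSpace E G] [IsManifold 𝓘(ℝ, E) ∞ G]

/-- The complexified tangent space `T_x G ⊗ ℂ`. For `x = 1` in a Lie group this is `𝔤_ℂ`. -/
abbrev CT (x : G) : Type _ := ℂ ⊗[ℝ] TangentSpace 𝓘(ℝ, E) x

/-- The complexified cotangent space. -/
abbrev CTDual (x : G) : Type _ := Module.Dual ℂ (CT E x)

/-- The fibre of `(TG ⊕ T*G) ⊗ ℂ`. -/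
abbrev GenT (x : G) : Type _ := CT E x × CTDual E x

variable {E}

/-- The real part `A` of a complex tangent vector `A + iB`. -/
def reT {x : G} : CT E x →ₗ[ℝ] TangentSpace 𝓘(ℝ, E) x :=
  (TensorProduct.lid ℝ (TangentSpace 𝓘(ℝ, E) x)).toLinearMap ∘ₗ
    LinearMap.rTensor (TangentSpace 𝓘(ℝ, E) x) Complex.reLm

/-- The imaginary part `B` of a complex tangent vector `A + iB`. -/
def imT {x : G} : CT E x →ₗ[ℝ] TangentSpace 𝓘(ℝ, E) x :=
  (TensorProduct.lid ℝ (TangentSpace 𝓘(ℝ, E) x)).toLinearMap ∘ₗ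
    LinearMap.rTensor (TangentSpace 𝓘(ℝ, E) x) Complex.imLm

/-- The complex tangent vector `A + iB`. -/
def mkT {x : G} (A B : TangentSpace 𝓘(ℝ, E) x) : CT E x :=
  (1 : ℂ) ⊗ₜ[ℝ] A + Complex.I ⊗ₜ[ℝ] B

/-- A real vector field is smooth on `V`. -/
def SmoothRealField (V : Set G) (A : Π x : G, TangentSpace 𝓘(ℝ, E) x) : Prop :=
  ContMDiffOn 𝓘(ℝ, E) 𝓘(ℝ, E).tangent ∞ (fun x => (⟨x, A x⟩ : TangentBundle 𝓘(ℝ, E) G)) V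

/-- A complex vector field is smooth on `V` if its real and imaginary parts are. -/
def SmoothField (V : Set G) (X : Π x : G, CT E x) : Prop :=
  SmoothRealField V (fun x => reT (X x)) ∧ SmoothRealField V (fun x => imT (X x))

variable (E) in
/-- A complex function is smooth on `V`. -/
def SmoothFun (V : Set G) (f : G → ℂ) : Prop :=
  ContMDiffOn 𝓘(ℝ, E) 𝓘(ℝ, ℂ) ∞ f V

/-- A complex `1`-form is smooth on the open set `V` if its values on all locally defined smooth
vector fields are smooth. -/
def SmoothForm (V : Set G) (ξ : Π x : G, CTDual E x) : Prop :=
  ∀ W ⊆ V, IsOpen W → ∀ A : Π x : G, TangentSpace 𝓘(ℝ, E) x, SmoothRealField W A →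
    SmoothFun E W (fun x => ξ x ((1 : ℂ) ⊗ₜ[ℝ] A x))

/-- A section `X + ξ` of `(TG ⊕ T*G) ⊗ ℂ` is smooth on the open set `V`. -/
def SmoothSection (V : Set G) (s : Π x : G, GenT E x) : Prop :=
  SmoothField V (fun x => (s x).1) ∧ SmoothForm V (fun x => (s x).2)

variable (E) in
/-- The differential of a complex function, as a `ℂ`-linear form on the complexified tangent
space; `cderiv E f x Z` is the derivative of `f` along the complex tangent vector `Z`. -/
def cderiv (f : G → ℂ) (x : G) : CTDual E x :=
  LinearMap.liftBaseChange ℂ (mvfderiv 𝓘(ℝ, E) f x).toLinearMap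

/-- The `ℂ`-bilinear extension of the Lie bracket of vector fields. -/
def cbracket (X Y : Π x : G, CT E x) (x : G) : CT E x :=
  let br := VectorField.mlieBracket 𝓘(ℝ, E) (M := G)
  mkT (br (fun y => reT (X y)) (fun y => reT (Y y)) x
      - br (fun y => imT (X y)) (fun y => imT (Y y)) x)
    (br (fun y => reT (X y)) (fun y => imT (Y y)) x
      + br (fun y => imT (X y)) (fun y => reT (Y y)) x)

/-- A (complex) almost Dirac structure: a smooth subbundle of `(TG ⊕ T*G) ⊗ ℂ`, all of whose
fibres are maximal isotropic. -/
structure IsAlmostDirac (D : Π x : G, Submodule ℂ (GenT E x)) : Prop where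
  maximal_isotropic : ∀ x, IsLinearDirac (D x)
  /-- near each point there is a smooth frame -/
  subbundle : ∀ x₀ : G, ∃ V : Set G, IsOpen V ∧ x₀ ∈ V ∧ ∃ (n : ℕ) (s : Fin n → Π x : G, GenT E x),
    (∀ i, SmoothSection V (s i)) ∧
    ∀ x ∈ V, LinearIndependent ℂ (fun i => s i x) ∧ Submodule.span ℂ (Set.range fun i => s i x) = D x

/-! ### Lie groups -/

variable [Group G]

/-- The differential at `1` of left translation by `g`: `𝔤 → T_g G`. -/
def dLeft (g : G) : TangentSpace 𝓘(ℝ, E) (1 : G) →L[ℝ] TangentSpace 𝓘(ℝ, E) g :=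
  mfderiv 𝓘(ℝ, E) 𝓘(ℝ, E) (fun h : G => g * h) 1

/-- The differential at `g` of left translation by `g⁻¹`: `T_g G → 𝔤`. -/
def dLeftInv (g : G) : TangentSpace 𝓘(ℝ, E) g →L[ℝ] TangentSpace 𝓘(ℝ, E) (1 : G) :=
  mfderiv 𝓘(ℝ, E) 𝓘(ℝ, E) (fun h : G => g⁻¹ * h) g

/-- The complexification of `dLeft g`. -/
def leftT (g : G) : CT E (1 : G) →ₗ[ℂ] CT E g :=
  LinearMap.baseChange ℂ (dLeft g).toLinearMap

/-- The complexification of `dLeftInv g`. -/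
def leftTInv (g : G) : CT E g →ₗ[ℂ] CT E (1 : G) :=
  LinearMap.baseChange ℂ (dLeftInv g).toLinearMap

/-- The left-invariant complex vector field with value `z` at `1`. -/
def leftField (z : CT E (1 : G)) (g : G) : CT E g := leftT g z

/-- The left-invariant complex `1`-form with value `ξ` at `1`. -/
def leftForm (ξ : CTDual E (1 : G)) (g : G) : CTDual E g := ξ ∘ₗ leftTInv g

/-- The exterior derivative of a complex `1`-form,
`dη(Z, W) = Z(η(W)) - W(η(Z)) - η([Z, W])`, where the tangent vectors `Z`, `W` at `g` are
extended to left-invariant vector fields. -/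
def extD (η : Π x : G, CTDual E x) (g : G) (Z W : CT E g) : ℂ :=
  let Z' := leftField (leftTInv g Z)
  let W' := leftField (leftTInv g W)
  cderiv E (fun x => η x (W' x)) g Z - cderiv E (fun x => η x (Z' x)) g W - η g (cbracket Z' W' g)

/-- The `1`-form component
`ι_X dη + ½ d(ι_X η) - ι_Y dξ - ½ d(ι_Y ξ)` of the Courant bracket `[X + ξ, Y + η]`,
as a function on tangent vectors. The vector component is `[X, Y]`. -/
def courantForm (s t : Π x : G, GenT E x) (g : G) (W : CT E g) : ℂ :=
  extD (fun x => (t x).2) g (s g).1 W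
    + (1 / 2) * cderiv E (fun x => (t x).2 (s x).1) g W
    - extD (fun x => (s x).2) g (t g).1 W
    - (1 / 2) * cderiv E (fun x => (s x).2 (t x).1) g W

/-- Integrability: the Courant bracket of any two (local, smooth) sections of `D` is a section
of `D`. -/
def IsIntegrable (D : Π x : G, Submodule ℂ (GenT E x)) : Prop :=
  ∀ V : Set G, IsOpen V → ∀ s t : Π x : G, GenT E x,
    SmoothSection V s → SmoothSection V t → (∀ x ∈ V, s x ∈ D x) → (∀ x ∈ V, t x ∈ D x) →
    ∀ x ∈ V, ∃ p ∈ D x, p.1 = cbracket (fun y => (s y).1) (fun y => (t y).1) x ∧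
      ∀ W : CT E x, p.2 W = courantForm s t x W

/-- The differential of the multiplication `μ : G × G → G` at `(g, h)`, where
`T_{(g,h)}(G × G) = T_g G × T_h G`. -/
def dmulReal (g h : G) :
    TangentSpace 𝓘(ℝ, E) g × TangentSpace 𝓘(ℝ, E) h →L[ℝ] TangentSpace 𝓘(ℝ, E) (g * h) :=
  mfderiv (𝓘(ℝ, E).prod 𝓘(ℝ, E)) 𝓘(ℝ, E) (fun p : G × G => p.1 * p.2) (g, h)

/-- The complexification of `dmulReal g h`. -/
def dmul (g h : G) : CT E g × CT E h →ₗ[ℂ] CT E (g * h) :=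
  LinearMap.coprod
    (LinearMap.baseChange ℂ ((dmulReal g h).toLinearMap ∘ₗ LinearMap.inl ℝ _ _))
    (LinearMap.baseChange ℂ ((dmulReal g h).toLinearMap ∘ₗ LinearMap.inr ℝ _ _))

/-- `(G, D)` is an almost Dirac group: `D` is an almost Dirac structure on `G` and the
multiplication `(G × G, D ⊕ D) → (G, D)` is a Dirac map, i.e. its differential at each point is a
linear Dirac map. -/
def IsAlmostDiracGroup (D : Π x : G, Submodule ℂ (GenT E x)) : Prop :=
  IsAlmostDirac D ∧ ∀ g h : G, IsLinearDiracMap (dmul g h) (prodL (D g) (D h)) (D (g * h))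

/-- `(G, D)` is a Dirac group: an almost Dirac group with `D` integrable. -/
def IsDiracGroup (D : Π x : G, Submodule ℂ (GenT E x)) : Prop :=
  IsAlmostDiracGroup D ∧ IsIntegrable D

/-! ### The pair `(U, β)` -/

variable (U : Π x : G, Submodule ℂ (CTDual E x)) (β : Π x : G, U x →ₗ[ℂ] U x →ₗ[ℂ] ℂ)

/-- The family of subspaces `L(β, U)` of `(TG ⊕ T*G) ⊗ ℂ`. -/
def diracL (x : G) : Submodule ℂ (GenT E x) := graphL (U x) (β x)

/-- The annihilator `𝔨 = Ann(U_1)` in `𝔤_ℂ`. -/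
def annK : Submodule ℂ (CT E (1 : G)) := (U 1).dualCoannihilator

open Classical in
/-- `β_x(ξ, η)` for covectors `ξ`, `η` in `U_x` (and `0` outside the domain of `β_x`). -/
def evalβ (x : G) (ξ η : CTDual E x) : ℂ :=
  if h : ξ ∈ U x ∧ η ∈ U x then β x ⟨ξ, h.1⟩ ⟨η, h.2⟩ else 0

/-- `f` is a section over `V` of the sheaf `ℱ` of smooth complex functions annihilated by the
complex vectors in `G × 𝔨 ⊆ TG ⊗ ℂ` (the trivialization being by left translation). Sections over
`V` are represented by functions on `G`, of which only the values on `V` matter. -/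
def InSheaf (V : Set G) (f : G → ℂ) : Prop :=
  SmoothFun E V f ∧ ∀ x ∈ V, ∀ k ∈ annK U, cderiv E f x (leftField k x) = 0

/-- The bracket `{f, g} = β(df, dg)`. -/
def fbracket (f g : G → ℂ) (x : G) : ℂ := evalβ U β x (cderiv E f x) (cderiv E g x)

/-- The bracket on `ℱ` satisfies the Jacobi identity: over every open set, the iterated brackets
are defined, i.e. the inner brackets are sections of `ℱ`, and their cyclic sum is zero. -/
def SatisfiesJacobi : Prop :=
  ∀ V : Set G, IsOpen V → ∀ f g h : G → ℂ, InSheaf U V f → InSheaf U V g → InSheaf U V h →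
    (InSheaf U V (fbracket U β g h) ∧ InSheaf U V (fbracket U β h f) ∧
      InSheaf U V (fbracket U β f g)) ∧
    ∀ x ∈ V, fbracket U β f (fbracket U β g h) x + fbracket U β g (fbracket U β h f) x
      + fbracket U β h (fbracket U β f g) x = 0

/-- The bracket makes `ℱ` a sheaf of complex Lie algebras. -/
structure IsLieBracketOnSheaf : Prop where
  /-- the bracket of sections over `V` depends only on their values on `V` -/
  congr : ∀ V : Set G, IsOpen V → ∀ f f' g g' : G → ℂ, InSheaf U V f → InSheaf U V f' →
    InSheaf U V g → InSheaf U V g' → Set.EqOn f f' V → Set.EqOn g g' V →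
    Set.EqOn (fbracket U β f g) (fbracket U β f' g') V
  closed : ∀ V : Set G, IsOpen V → ∀ f g : G → ℂ, InSheaf U V f → InSheaf U V g →
    InSheaf U V (fbracket U β f g)
  add_left : ∀ V : Set G, IsOpen V → ∀ f f' g : G → ℂ, InSheaf U V f → InSheaf U V f' →
    InSheaf U V g → Set.EqOn (fbracket U β (f + f') g) (fbracket U β f g + fbracket U β f' g) V
  smul_left : ∀ V : Set G, IsOpen V → ∀ (c : ℂ) (f g : G → ℂ), InSheaf U V f → InSheaf U V g →
    Set.EqOn (fbracket U β (c • f) g) (c • fbracket U β f g) V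
  antisymm : ∀ V : Set G, IsOpen V → ∀ f g : G → ℂ, InSheaf U V f → InSheaf U V g →
    Set.EqOn (fbracket U β f g) (-fbracket U β g f) V
  jacobi : ∀ V : Set G, IsOpen V → ∀ f g h : G → ℂ, InSheaf U V f → InSheaf U V g →
    InSheaf U V h → Set.EqOn (fbracket U β f (fbracket U β g h))
      (fbracket U β (fbracket U β f g) h + fbracket U β g (fbracket U β f h)) V

/-! ### The Schouten bracket -/

/-- The Schouten bracket of decomposable bivector fields,
`[A ∧ B, C ∧ D] = [A,C] ∧ B ∧ D - [A,D] ∧ B ∧ C - [B,C] ∧ A ∧ D + [B,D] ∧ A ∧ C`,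
evaluated on three covectors. -/
def schoutenDecomposable (A B C D : Π x : G, CT E x) (x : G) (α₁ α₂ α₃ : CTDual E x) : ℂ :=
  wedge3 (cbracket A C x) (B x) (D x) α₁ α₂ α₃ - wedge3 (cbracket A D x) (B x) (C x) α₁ α₂ α₃
    - wedge3 (cbracket B C x) (A x) (D x) α₁ α₂ α₃ + wedge3 (cbracket B D x) (A x) (C x) α₁ α₂ α₃

/-- The Schouten bracket `[P, Q]` of maps `P, Q : G → ∧² 𝔤_ℂ` (given as alternating bilinear forms
on `𝔤_ℂ*`, and viewed as bivector fields by left translation), evaluated on three covectors.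
With left-invariant fields `E_i` and `P = ∑_{i,j} (½ P^{ij} E_i) ∧ E_j`, and likewise for `Q`, it
is the sum of the brackets of the decomposable terms. -/
def schouten {ι : Type*} [Fintype ι] (b : Module.Basis ι ℂ (CT E (1 : G)))
    (P Q : G → CTDual E (1 : G) → CTDual E (1 : G) → ℂ) (x : G) (α₁ α₂ α₃ : CTDual E x) : ℂ :=
  ∑ i, ∑ j, ∑ k, ∑ l,
    schoutenDecomposable
      (fun y => ((1 / 2 : ℂ) * P y (b.coord i) (b.coord j)) • leftField (b i) y)
      (leftField (b j))
      (fun y => ((1 / 2 : ℂ) * Q y (b.coord k) (b.coord l)) • leftField (b k) y)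
      (leftField (b l)) x α₁ α₂ α₃

/-- The lift `β̂ : G → ∧² 𝔤_ℂ` of `β : G → ∧² (𝔤_ℂ / 𝔨)` along a linear map
`σ : 𝔤_ℂ / 𝔨 → 𝔤_ℂ`: `β̂(ξ, η) = β(ξ ∘ σ ∘ π, η ∘ σ ∘ π)` where `π : 𝔤_ℂ → 𝔤_ℂ / 𝔨`. -/
def liftβ (σ : (CT E (1 : G) ⧸ annK U) →ₗ[ℂ] CT E (1 : G)) (x : G)
    (ξ η : CTDual E (1 : G)) : ℂ :=
  evalβ U β x (leftForm (ξ ∘ₗ σ ∘ₗ (annK U).mkQ) x) (leftForm (η ∘ₗ σ ∘ₗ (annK U).mkQ) x)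

/-- `d_g β (𝔨) = 0` for all `g`, where `β` is viewed as a map `G → ∧² (𝔤_ℂ / 𝔨)`: the condition
under which the Schouten bracket `[β, β]` is defined. -/
def DerivVanishesOnK : Prop :=
  ∀ g : G, ∀ ξ ∈ U 1, ∀ η ∈ U 1, ∀ k ∈ annK U,
    cderiv E (fun x => evalβ U β x (leftForm ξ x) (leftForm η x)) g (leftField k g) = 0

/-- `[β, β] = 0`: the Schouten bracket `[β, β] : G → ∧³ (𝔤_ℂ / 𝔨)` is defined, and it vanishes.
It is the image of `[β̂, β̂]` under `∧³ 𝔤_ℂ → ∧³ (𝔤_ℂ / 𝔨)`, i.e. the restriction of `[β̂, β̂]` to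
covectors in `U`, with `β̂` the lift of `β` along any splitting `σ` of `𝔤_ℂ → 𝔤_ℂ / 𝔨`. -/
def SchoutenVanishes : Prop :=
  DerivVanishesOnK U β ∧
  ∀ σ : (CT E (1 : G) ⧸ annK U) →ₗ[ℂ] CT E (1 : G), (annK U).mkQ ∘ₗ σ = LinearMap.id →
    ∀ (n : ℕ) (b : Module.Basis (Fin n) ℂ (CT E (1 : G))) (x : G),
      ∀ α₁ ∈ U x, ∀ α₂ ∈ U x, ∀ α₃ ∈ U x,
        schouten b (liftβ U β σ) (liftβ U β σ) x α₁ α₂ α₃ = 0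

end DiracGroup

end

set_option linter.unusedSectionVars false

/-! All three conditions are compared with one pointwise statement, `JacobiatorVanishes`. In the
left trivialisation an element of D_x is a pair (z, ξ) with ξ ∈ U_1 and η(z) = β_x(ξ, η) for all η ∈
U_1 (`IsLift`). For three such pairs the jacobiator J is the cyclic sum of z₁·β(ξ₂, ξ₃), with the
ξ's extended left-invariantly, plus the cyclic sum of ξ₃([z₁, z₂]). The requirement is J = 0 for all
triples at all points.

Multiplicativity enters through kernels: D_x ∩ T_xG is Ann(U_x), and dμ carries kernel vectors to
kernel vectors, so left and right translations preserve the family Ann(U_x). Left translations make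
U_x the translate of U_1, so β becomes a function on G with values in the forms on one fixed space.
Right translations, together with the vanishing bracket of left- and right-invariant fields, make 𝔨
an ideal of 𝔤_ℂ (`brC_mem_annK`).

Integrability: since D_x is its own orthogonal complement, a Courant bracket lies in D exactly when
it is orthogonal to D. Its pairing with a third element is J, because all derivatives of the
covector components cancel (`pairing_courant`), and every element of D_x extends to a section
(`exists_section`).

Jacobi identity: for f, g, h in ℱ the cyclic sum of iterated brackets is J on the differentials
(`fbracket_cyclic_sum`), second derivatives being symmetric up to a bracket of left-invariant
fields. The converse needs every ξ ∈ U_1 to be the differential of a local section of ℱ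
(`exists_inSheaf`). As 𝔨 is an ideal, f = ξ ∘ log works: the left-trivialised derivative of exp at X
is a power series in ad X, so it and its inverse preserve 𝔨, on which ξ vanishes. In the proof exp
is the time-one map of a flow, smooth in X by the inverse function theorem in C([0,1], E), and the
power series is replaced by the linear equation z' = Y + [z, X], whose solutions stay in 𝔨 when Y ∈
𝔨 (`IsLieFrame.exists_log`).

Schouten bracket: evaluated on ξ₁, ξ₂, ξ₃ it is 2J, with z_i the contraction of the lifted bivector
with ξ_i (`schouten_eq`). Other lifts differ by elements of 𝔨, and J does not see the change once
the derivatives of β along 𝔨 vanish (`DerivVanishesOnK.jacobiator_congr`). Conversely J = 0 on a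
triple containing (k, 0) with k ∈ 𝔨 says precisely that β is constant along k; this also keeps
brackets of sections of ℱ inside ℱ. -/

noncomputable section

namespace DiracGroup

/-! ### Smoothness of composition operators on spaces of continuous maps -/

section Nemytskii

variable {K : Type*} [TopologicalSpace K] [CompactSpace K]

/-- Pointwise application `C(K, E →L F) × C(K, E) → C(K, F)` as a bounded bilinear map. -/
def pointwiseApply (K : Type*) [TopologicalSpace K] [CompactSpace K]
    (E F : Type*) [NormedAddCommGroup E] [NormedSpace ℝ E] [NormedAddCommGroup F]
    [NormedSpace ℝ F] : C(K, E →L[ℝ] F) →L[ℝ] C(K, E) →L[ℝ] C(K, F) :=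
  LinearMap.mkContinuous₂
    (LinearMap.mk₂ ℝ (fun (a : C(K, E →L[ℝ] F)) (v : C(K, E)) =>
        (⟨fun t => a t (v t), by fun_prop⟩ : C(K, F)))
      (fun _ _ _ => by ext; simp) (fun _ _ _ => by ext; simp) (fun _ _ _ => by ext; simp)
      (fun _ _ _ => by ext; simp)) 1
    (fun a v => by
      rw [ContinuousMap.norm_le _ (by positivity)]
      intro t
      simp only [LinearMap.mk₂_apply, ContinuousMap.coe_mk, one_mul]
      exact ((a t).le_opNorm _).trans
        (mul_le_mul (a.norm_coe_le_norm t) (v.norm_coe_le_norm t) (norm_nonneg _)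
          (by positivity)))

@[simp] lemma pointwiseApply_apply {E F : Type*} [NormedAddCommGroup E] [NormedSpace ℝ E]
    [NormedAddCommGroup F] [NormedSpace ℝ F] (a : C(K, E →L[ℝ] F)) (v : C(K, E)) (t : K) :
    pointwiseApply K E F a v t = a t (v t) := rfl

/-- Postcomposition with `fderiv ℝ g` is continuous in the sup norm, so for small v the derivative
of g varies by at most ε along all segments from u(t) to u(t) + v(t) at once. The mean value
inequality then bounds the remainder uniformly in t. -/
lemma hasFDerivAt_comp_continuousMap {E F : Type*} [NormedAddCommGroup E] [NormedSpace ℝ E]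
    [NormedAddCommGroup F] [NormedSpace ℝ F] {g : E → F} (hg : ContDiff ℝ 1 g) (u : C(K, E)) :
    HasFDerivAt (fun u : C(K, E) => (ContinuousMap.mk g hg.continuous).comp u)
      (pointwiseApply K E F
        ((ContinuousMap.mk (fderiv ℝ g) (hg.continuous_fderiv one_ne_zero)).comp u)) u := by
  set N : C(K, E) → C(K, E →L[ℝ] F) := fun u =>
    (ContinuousMap.mk (fderiv ℝ g) (hg.continuous_fderiv one_ne_zero)).comp u with hN
  have hNc : Continuous N := ContinuousMap.continuous_postcomp _
  rw [hasFDerivAt_iff_isLittleO_nhds_zero, Asymptotics.isLittleO_iff]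
  intro ε hε
  obtain ⟨δ, hδ, hδ'⟩ := (Metric.continuousAt_iff (f := N) (a := u)).1 hNc.continuousAt ε hε
  filter_upwards [Metric.ball_mem_nhds (0 : C(K, E)) hδ] with v hv
  rw [ContinuousMap.norm_le _ (by positivity)]
  intro t
  have key : ∀ y ∈ segment ℝ (u t) (u t + v t),
      ‖fderiv ℝ g y - fderiv ℝ g (u t)‖ ≤ ε := by
    intro y hy
    rw [segment_eq_image'] at hy
    obtain ⟨s, hs, rfl⟩ := hy
    have h1 : dist (u + s • v) u < δ := by
      rw [dist_eq_norm, add_sub_cancel_left, norm_smul, Real.norm_of_nonneg hs.1]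
      have : ‖v‖ < δ := by simpa using hv
      nlinarith [norm_nonneg v, hs.1, hs.2]
    have h2 := (hδ' h1).le
    have h3 := (ContinuousMap.dist_apply_le_dist t).trans h2
    rw [dist_eq_norm] at h3
    simpa [hN] using h3
  have := (convex_segment (u t) (u t + v t)).norm_image_sub_le_of_norm_hasFDerivWithin_le'
    (f := g) (f' := fderiv ℝ g) (φ := fderiv ℝ g (u t)) (C := ε)
    (fun y _ => ((hg.differentiable one_ne_zero) y).hasFDerivAt.hasFDerivWithinAt) key
    (left_mem_segment ℝ _ _) (right_mem_segment ℝ _ _)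
  simp only [add_sub_cancel_left] at this
  refine (le_of_eq ?_).trans (this.trans
    (mul_le_mul_of_nonneg_left (v.norm_coe_le_norm t) hε.le))
  simp

universe u

/-- Induction on n: the derivative of u ↦ g ∘ u is the same kind of operator for `fderiv ℝ g`,
followed by the bounded linear map `pointwiseApply`. The target F becomes E →L[ℝ] F in the
induction, whence the common universe. -/
lemma contDiff_comp_continuousMap_nat (n : ℕ) : ∀ {E F : Type u} [NormedAddCommGroup E]
    [NormedSpace ℝ E] [NormedAddCommGroup F] [NormedSpace ℝ F] {g : E → F}
    (hg : ContDiff ℝ ∞ g),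
    ContDiff ℝ n (fun u : C(K, E) => (ContinuousMap.mk g hg.continuous).comp u) := by
  induction n with
  | zero =>
    intro E F _ _ _ _ g hg
    exact contDiff_zero.2 (ContinuousMap.continuous_postcomp _)
  | succ n ih =>
    intro E F _ _ _ _ g hg
    have hg1 : ContDiff ℝ 1 g := hg.of_le (by exact_mod_cast le_top)
    have hg' : ContDiff ℝ ∞ (fderiv ℝ g) := hg.fderiv_right (by simp)
    have h1 := ih hg'
    have h2 : ContDiff ℝ n (pointwiseApply K E F) := ContinuousLinearMap.contDiff _
    have h3 : ContDiff ℝ n (fun u : C(K, E) => pointwiseApply K E F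
        ((ContinuousMap.mk (fderiv ℝ g) hg'.continuous).comp u)) := h2.comp h1
    push_cast
    rw [contDiff_succ_iff_hasFDerivAt]
    exact ⟨_, h3,
      fun u => hasFDerivAt_comp_continuousMap hg1 u⟩

/-- Composition with a smooth map is a smooth operation on continuous maps on a compact space. -/
lemma contDiff_comp_continuousMap {E F : Type u} [NormedAddCommGroup E]
    [NormedSpace ℝ E] [NormedAddCommGroup F] [NormedSpace ℝ F] {g : E → F}
    (hg : ContDiff ℝ ∞ g) :
    ContDiff ℝ ∞ (fun u : C(K, E) => (ContinuousMap.mk g hg.continuous).comp u) :=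
  contDiff_infty.2 fun n => contDiff_comp_continuousMap_nat n hg

end Nemytskii

/-- The inverse function theorem for smooth maps, with a smooth local inverse. -/
lemma exists_smooth_local_inverse {E F : Type*} [NormedAddCommGroup E] [NormedSpace ℝ E]
    [CompleteSpace E] [NormedAddCommGroup F] [NormedSpace ℝ F]
    {f : E → F} {S : Set E} (hS : IsOpen S) (hf : ContDiffOn ℝ ∞ f S) {a : E} (ha : a ∈ S)
    (f' : E ≃L[ℝ] F) (hf' : HasFDerivAt f (f' : E →L[ℝ] F) a) :
    ∃ e : OpenPartialHomeomorph E F, a ∈ e.source ∧ e.source ⊆ S ∧ (∀ x, e x = f x) ∧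
      ContDiffOn ℝ ∞ e.symm e.target := by
  have hfa : ContDiffAt ℝ ∞ f a := hf.contDiffAt (hS.mem_nhds ha)
  set e₀ := hfa.toOpenPartialHomeomorph f hf' (by simp) with he₀
  -- The source is cut down to the points of S where the derivative is invertible, so that the
  -- inverse is smooth on the entire target.
  have hT : IsOpen (S ∩ fderiv ℝ f ⁻¹' (Set.range ((↑) : (E ≃L[ℝ] F) → E →L[ℝ] F))) :=
    (hf.continuousOn_fderiv_of_isOpen hS (by simp)).isOpen_inter_preimage hS
      (ContinuousLinearEquiv.isOpen)
  refine ⟨e₀.restrOpen _ hT, ?_, ?_, fun x => rfl, ?_⟩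
  · refine ⟨hfa.mem_toOpenPartialHomeomorph_source hf' (by simp), ha, ?_⟩
    rw [Set.mem_preimage, hf'.fderiv]
    exact ⟨f', rfl⟩
  · exact fun x hx => hx.2.1
  · intro y hy
    have hx := (e₀.restrOpen _ hT).map_target hy
    obtain ⟨-, hxS, ⟨g, hg⟩⟩ := hx
    refine (OpenPartialHomeomorph.contDiffAt_symm (f₀' := g) _ hy ?_ ?_).contDiffWithinAt
    · rw [hg]
      exact ((hf.contDiffAt (hS.mem_nhds hxS)).differentiableAt (by simp)).hasFDerivAt
    · exact hf.contDiffAt (hS.mem_nhds hxS)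

/-! ### The integral operator on curves -/

section Flow

/-- The integral operator `v ↦ ∫₀ᵗ v` on continuous curves. -/
def integralOp (E : Type*) [NormedAddCommGroup E] [NormedSpace ℝ E] [CompleteSpace E] :
    C(unitInterval, E) →L[ℝ] C(unitInterval, E) :=
  LinearMap.mkContinuous
    { toFun := fun v => ⟨fun t => ∫ s in (0 : ℝ)..t, Set.IccExtend zero_le_one v s, by
        have : Continuous fun t : ℝ => ∫ s in (0 : ℝ)..t, Set.IccExtend zero_le_one v s :=
          intervalIntegral.continuous_primitive
            (fun a b => (v.continuous.Icc_extend').intervalIntegrable a b) 0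
        exact this.comp continuous_subtype_val⟩
      map_add' := fun v w => by
        ext t
        simp only [ContinuousMap.coe_mk, ContinuousMap.add_apply]
        rw [← intervalIntegral.integral_add
          ((v.continuous.Icc_extend').intervalIntegrable _ _)
          ((w.continuous.Icc_extend').intervalIntegrable _ _)]
        rfl
      map_smul' := fun c v => by
        ext t
        simp only [ContinuousMap.coe_mk, ContinuousMap.smul_apply, RingHom.id_apply]
        rw [← intervalIntegral.integral_smul]
        rfl } 1
    (fun v => by
      rw [ContinuousMap.norm_le _ (by positivity)]
      intro t
      have := intervalIntegral.norm_integral_le_of_norm_le_const (a := (0 : ℝ)) (b := t)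
        (f := Set.IccExtend zero_le_one v) (C := ‖v‖) (fun s _ => v.norm_coe_le_norm _)
      refine this.trans ?_
      rw [one_mul, sub_zero, abs_of_nonneg t.2.1]
      exact mul_le_of_le_one_right (norm_nonneg _) t.2.2)

variable {E : Type*} [NormedAddCommGroup E] [NormedSpace ℝ E] [CompleteSpace E]

lemma integralOp_apply (v : C(unitInterval, E)) (t : unitInterval) :
    integralOp E v t = ∫ s in (0 : ℝ)..t, Set.IccExtend zero_le_one v s := rfl

lemma hasDerivWithinAt_integralOp (v : C(unitInterval, E)) {t : ℝ} (ht : t ∈ Set.Icc (0 : ℝ) 1) :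
    HasDerivWithinAt (Set.IccExtend zero_le_one (integralOp E v)) (v ⟨t, ht⟩)
      (Set.Icc (0 : ℝ) 1) t := by
  have hc : Continuous (Set.IccExtend zero_le_one v) := v.continuous.Icc_extend'
  have h := (intervalIntegral.integral_hasDerivAt_right (hc.intervalIntegrable 0 t)
    (hc.stronglyMeasurableAtFilter _ _) hc.continuousAt).hasDerivWithinAt (s := Set.Icc (0 : ℝ) 1)
  rw [Set.IccExtend_of_mem zero_le_one v ht] at h
  refine h.congr (fun s hs => ?_) ?_
  · rw [Set.IccExtend_of_mem zero_le_one _ hs]; rfl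
  · rw [Set.IccExtend_of_mem zero_le_one _ ht]; rfl

end Flow

/-! ### Smooth dependence of flows on the driving vector -/

section Flow

/-- Constant maps, as a bounded linear operator. -/
def constOp (K : Type*) [TopologicalSpace K] [CompactSpace K]
    (E : Type*) [NormedAddCommGroup E] [NormedSpace ℝ E] : E →L[ℝ] C(K, E) :=
  LinearMap.mkContinuous
    { toFun := fun x => ContinuousMap.const K x
      map_add' := fun _ _ => rfl
      map_smul' := fun _ _ => rfl } 1
    (fun x => by
      rw [ContinuousMap.norm_le _ (by positivity), one_mul]
      exact fun _ => le_rfl)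

@[simp] lemma constOp_apply {K : Type*} [TopologicalSpace K] [CompactSpace K]
    {E : Type*} [NormedAddCommGroup E] [NormedSpace ℝ E] (x : E) (t : K) :
    constOp K E x t = x := rfl

universe u

variable {E : Type u} [NormedAddCommGroup E] [NormedSpace ℝ E]

/-- The curve `t ↦ A(w(t)) X`. -/
def curveVel {A : E → E →L[ℝ] E} (hA : ContDiff ℝ ∞ A) (X : E) (w : C(unitInterval, E)) :
    C(unitInterval, E) :=
  pointwiseApply unitInterval E E ((ContinuousMap.mk A hA.continuous).comp w)
    (constOp unitInterval E X)

lemma curveVel_apply {A : E → E →L[ℝ] E} (hA : ContDiff ℝ ∞ A) (X : E) (w : C(unitInterval, E))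
    (t : unitInterval) : curveVel hA X w t = A (w t) X := rfl

/-- The derivative of `curveVel`. -/
lemma hasFDerivAt_curveVel {A : E → E →L[ℝ] E} (hA : ContDiff ℝ ∞ A) (X : E)
    (w : C(unitInterval, E)) :
    ∃ L : E × C(unitInterval, E) →L[ℝ] C(unitInterval, E),
      HasFDerivAt (fun p : E × C(unitInterval, E) => curveVel hA p.1 p.2) L (X, w) ∧
      ∀ Y v t, L (Y, v) t = fderiv ℝ A (w t) (v t) X + A (w t) Y := by
  set a := (ContinuousMap.mk A hA.continuous).comp w with ha
  set D := pointwiseApply unitInterval E (E →L[ℝ] E)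
    ((ContinuousMap.mk (fderiv ℝ A) (hA.continuous_fderiv (by simp))).comp w) with hD
  have h1 : HasFDerivAt (fun p : E × C(unitInterval, E) =>
      (ContinuousMap.mk A hA.continuous).comp p.2)
      (D.comp (ContinuousLinearMap.snd ℝ E C(unitInterval, E))) (X, w) :=
    HasFDerivAt.comp (X, w) (f := fun p : E × C(unitInterval, E) => p.2)
      (hasFDerivAt_comp_continuousMap (K := unitInterval) (g := A)
        (hA.of_le (by exact_mod_cast le_top)) w) hasFDerivAt_snd
  have h2 : HasFDerivAt (fun p : E × C(unitInterval, E) => constOp unitInterval E p.1)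
      ((constOp unitInterval E).comp (ContinuousLinearMap.fst ℝ E C(unitInterval, E))) (X, w) :=
    (constOp unitInterval E).hasFDerivAt.comp (X, w) hasFDerivAt_fst
  have h3 := (pointwiseApply unitInterval E E).hasFDerivAt_of_bilinear h1 h2
  refine ⟨_, h3, fun Y v t => ?_⟩
  rw [add_apply, ContinuousLinearMap.precompR_apply,
    ContinuousLinearMap.precompL_apply, add_comm]
  rfl

lemma contDiff_curveVel {A : E → E →L[ℝ] E} (hA : ContDiff ℝ ∞ A) :
    ContDiff ℝ ∞ (fun p : E × C(unitInterval, E) => curveVel hA p.1 p.2) := by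
  have h1 : ContDiff ℝ ∞ (fun p : E × C(unitInterval, E) =>
      (ContinuousMap.mk A hA.continuous).comp p.2) :=
    (contDiff_comp_continuousMap hA).comp contDiff_snd
  have h2 : ContDiff ℝ ∞ (fun p : E × C(unitInterval, E) => constOp unitInterval E p.1) :=
    (constOp unitInterval E).contDiff.comp contDiff_fst
  have h0 : ContDiff ℝ ∞ (pointwiseApply unitInterval E E) := ContinuousLinearMap.contDiff _
  have h3 : ContDiff ℝ ∞ (fun p : E × C(unitInterval, E) => pointwiseApply unitInterval E E
      ((ContinuousMap.mk A hA.continuous).comp p.2)) := h0.comp h1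
  exact h3.clm_apply h2

variable [CompleteSpace E]

/-- Solutions on `[0, 1]` of `u' = A(u) X`, `u(0) = p₀`, depend smoothly on small `X`. -/
lemma exists_smooth_flow {A : E → E →L[ℝ] E} (hA : ContDiff ℝ ∞ A) (p₀ : E) :
    ∃ (S : Set E) (u : E → C(unitInterval, E)), IsOpen S ∧ (0 : E) ∈ S ∧ ContDiffOn ℝ ∞ u S ∧
      u 0 = constOp unitInterval E p₀ ∧
      ∀ X ∈ S, u X = constOp unitInterval E p₀ + integralOp E (curveVel hA X (u X)) := by
  set c := constOp unitInterval E p₀ with hc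
  -- The curve u solves the integral equation for X exactly when Φ(X, u) = (X, 0). At X = 0 the
  -- velocity A(u)X vanishes for every u, so the u-derivative of Φ there is the identity. Small X on
  -- the fixed interval [0, 1] takes the place of a short time interval.
  set Φ : E × C(unitInterval, E) → E × C(unitInterval, E) :=
    fun p => (p.1, p.2 - c - integralOp E (curveVel hA p.1 p.2)) with hΦ
  have hΦs : ContDiff ℝ ∞ Φ := by
    refine contDiff_fst.prodMk ((contDiff_snd.sub contDiff_const).sub ?_)
    exact (integralOp E).contDiff.comp (contDiff_curveVel hA)
  obtain ⟨L, hL, hL'⟩ := hasFDerivAt_curveVel hA 0 c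
  have hLv : ∀ v, L (0, v) = 0 := by
    intro v; ext t; rw [hL']; simp
  have hΦ' : HasFDerivAt Φ ((ContinuousLinearMap.fst ℝ E C(unitInterval, E)).prod
      (ContinuousLinearMap.snd ℝ E C(unitInterval, E) - (integralOp E).comp L)) (0, c) := by
    refine hasFDerivAt_fst.prodMk ((hasFDerivAt_snd.sub_const c).sub ?_)
    exact (integralOp E).hasFDerivAt.comp (0, c) hL
  -- The derivative of Φ at (0, c) is (Y, v) ↦ (Y, v + N Y), which is triangular with identity
  -- diagonal, hence invertible.
  set N : E →L[ℝ] C(unitInterval, E) :=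
    -((integralOp E).comp (L.comp (ContinuousLinearMap.inl ℝ E C(unitInterval, E)))) with hN
  set e := (ContinuousLinearEquiv.refl ℝ E).skewProd
    (ContinuousLinearEquiv.refl ℝ C(unitInterval, E)) N with he
  have hee : (e : E × C(unitInterval, E) →L[ℝ] E × C(unitInterval, E)) =
      (ContinuousLinearMap.fst ℝ E C(unitInterval, E)).prod
      (ContinuousLinearMap.snd ℝ E C(unitInterval, E) - (integralOp E).comp L) := by
    refine ContinuousLinearMap.ext fun ⟨Y, v⟩ => ?_
    have : L (Y, v) = L (Y, 0) := by
      have h := L.map_add (Y, 0) (0, v)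
      rw [hLv, add_zero] at h
      simpa using h
    simp [he, hN, this, sub_eq_add_neg]
  rw [← hee] at hΦ'
  obtain ⟨ψ, hψ0, -, hψ, hψs⟩ := exists_smooth_local_inverse isOpen_univ hΦs.contDiffOn
    (Set.mem_univ (0, c)) e hΦ'
  have hΦ0 : Φ (0, c) = (0, 0) := by
    have : curveVel hA 0 c = 0 := by ext t; simp [curveVel_apply]
    simp [hΦ, this]
  refine ⟨(fun X : E => ((X, 0) : E × C(unitInterval, E))) ⁻¹' ψ.target,
    fun X => (ψ.symm (X, 0)).2, ?_, ?_, ?_, ?_, ?_⟩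
  · exact ψ.open_target.preimage (by fun_prop)
  · have := ψ.map_source hψ0
    rwa [hψ, hΦ0] at this
  · have : ContDiffOn ℝ ∞ (fun X : E => ψ.symm (X, 0))
        ((fun X : E => ((X, 0) : E × C(unitInterval, E))) ⁻¹' ψ.target) :=
      hψs.comp (by fun_prop) (fun _ h => h)
    exact contDiff_snd.comp_contDiffOn this
  · have := ψ.left_inv hψ0
    rw [hψ, hΦ0] at this
    simp only [this]
  · intro X hX
    have h := ψ.right_inv hX
    rw [hψ] at h
    have h1 := congrArg Prod.fst h
    have h2 := congrArg Prod.snd h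
    simp only [hΦ] at h1 h2
    rw [h1, sub_sub, sub_eq_zero] at h2
    exact h2

/-- The variational equation of the flow. -/
lemma flow_fderiv {A : E → E →L[ℝ] E} (hA : ContDiff ℝ ∞ A) {p₀ : E} {S : Set E} (hS : IsOpen S)
    {u : E → C(unitInterval, E)} (hu : ContDiffOn ℝ ∞ u S)
    (hu' : ∀ X ∈ S, u X = constOp unitInterval E p₀ + integralOp E (curveVel hA X (u X)))
    {X : E} (hX : X ∈ S) (Y : E) :
    ∃ w : C(unitInterval, E), fderiv ℝ u X Y = integralOp E w ∧
      ∀ t, w t = fderiv ℝ A (u X t) (fderiv ℝ u X Y t) X + A (u X t) Y := by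
  have hd : HasFDerivAt u (fderiv ℝ u X) X :=
    ((hu.contDiffAt (hS.mem_nhds hX)).differentiableAt (by simp)).hasFDerivAt
  obtain ⟨L, hL, hL'⟩ := hasFDerivAt_curveVel hA X (u X)
  -- Differentiate the integral equation in X; uniqueness of derivatives gives the linearised
  -- equation.
  have h2 : HasFDerivAt u ((integralOp E).comp (L.comp
      ((ContinuousLinearMap.id ℝ E).prod (fderiv ℝ u X)))) X := by
    have h3 : HasFDerivAt (fun X => constOp unitInterval E p₀ +
        integralOp E (curveVel hA X (u X))) ((integralOp E).comp (L.comp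
      ((ContinuousLinearMap.id ℝ E).prod (fderiv ℝ u X)))) X := by
      refine HasFDerivAt.const_add _ ?_
      refine (integralOp E).hasFDerivAt.comp X ?_
      exact hL.comp X (f := fun X => (X, u X)) ((hasFDerivAt_id X).prodMk hd)
    refine h3.congr_of_eventuallyEq ?_
    filter_upwards [hS.mem_nhds hX] with X hX using hu' X hX
  refine ⟨L (Y, fderiv ℝ u X Y), ?_, fun t => hL' _ _ _⟩
  conv_lhs => rw [hd.unique h2]
  rfl

end Flow

/-! ### Logarithmic coordinates for a frame with constant structure functions -/

section LocalExp

universe u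

variable {E : Type u} [NormedAddCommGroup E] [NormedSpace ℝ E] [FiniteDimensional ℝ E]

/-- Cutting off a function that is smooth near a point. -/
lemma exists_smooth_cutoff {F : Type*} [NormedAddCommGroup F] [NormedSpace ℝ F] {L : E → F}
    {Ω : Set E} (hΩ : IsOpen Ω) (hL : ContDiffOn ℝ ∞ L Ω) {p₀ : E} (hp : p₀ ∈ Ω) :
    ∃ (A : E → F) (r : ℝ), 0 < r ∧ ContDiff ℝ ∞ A ∧ Metric.ball p₀ r ⊆ Ω ∧
      ∀ x ∈ Metric.ball p₀ r, A x = L x := by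
  obtain ⟨R, hR, hRΩ⟩ := Metric.isOpen_iff.1 hΩ p₀ hp
  -- The bump is 1 up to radius R / 3 and vanishes beyond R / 2, strictly inside the ball of radius
  -- R where L is smooth.
  let f : ContDiffBump p₀ := ⟨R / 3, R / 2, by positivity, by linarith⟩
  refine ⟨fun x => f x • L x, R / 3, by positivity, ?_,
    (Metric.ball_subset_ball (by linarith)).trans hRΩ, fun x hx => ?_⟩
  · rw [contDiff_iff_contDiffAt]
    intro x
    by_cases hx : x ∈ Metric.ball p₀ R
    · exact f.contDiffAt.smul (hL.contDiffAt (hΩ.mem_nhds (hRΩ hx)))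
    · have h0 : (fun x => f x • L x) =ᶠ[nhds x] fun _ => 0 := by
        have hx' : x ∈ (Metric.closedBall p₀ (R / 2))ᶜ := by
          simp only [Metric.mem_ball, not_lt] at hx
          simp only [Set.mem_compl_iff, Metric.mem_closedBall, not_le]
          linarith
        filter_upwards [Metric.isClosed_closedBall.isOpen_compl.mem_nhds hx'] with y hy
        have : f y = 0 := by
          apply f.zero_of_le_dist
          simp only [Set.mem_compl_iff, Metric.mem_closedBall, not_le] at hy
          exact hy.le
        simp [this]
      exact contDiffAt_const.congr_of_eventuallyEq h0
  · have : f x = 1 := f.one_of_mem_closedBall (Metric.ball_subset_closedBall hx)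
    simp [this]

/-- A frame on an open set `Ω` of `E`, i.e. a smooth field `L` of invertible endomorphisms, with
constant structure functions `B`. -/
structure IsLieFrame (Ω : Set E) (L : E → E →L[ℝ] E) (B : E → E → E) : Prop where
  isOpen : IsOpen Ω
  contDiffOn : ContDiffOn ℝ ∞ L Ω
  isInvertible : ∀ p ∈ Ω, (L p).IsInvertible
  structure_eq : ∀ p ∈ Ω, ∀ v w, fderiv ℝ L p (L p v) w - fderiv ℝ L p (L p w) v = L p (B v w)

variable {Ω : Set E} {L : E → E →L[ℝ] E} {B : E → E → E}

lemma IsLieFrame.contDiffAt_inverse (h : IsLieFrame Ω L B) {p : E} (hp : p ∈ Ω) :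
    ContDiffAt ℝ ∞ (fun p => (L p).inverse) p := by
  obtain ⟨e, he⟩ := h.isInvertible p hp
  have h1 : ContDiffAt ℝ ∞ ContinuousLinearMap.inverse (L p) := he ▸ contDiffAt_map_inverse e
  exact h1.comp p (h.contDiffOn.contDiffAt (h.isOpen.mem_nhds hp))

lemma IsLieFrame.fderiv_inverse (h : IsLieFrame Ω L B) {p : E} (hp : p ∈ Ω) (x y : E) :
    fderiv ℝ (fun p => (L p).inverse) p x (L p y) = - (L p).inverse (fderiv ℝ L p x y) := by
  have h1 := ((h.contDiffAt_inverse hp).differentiableAt (by simp)).hasFDerivAt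
  have h2 := ((h.contDiffOn.contDiffAt (h.isOpen.mem_nhds hp)).differentiableAt
    (by simp)).hasFDerivAt
  have h3 := h1.clm_apply (h2.clm_apply (hasFDerivAt_const y p))
  have h4 : HasFDerivAt (fun p => (L p).inverse (L p y)) (0 : E →L[ℝ] E) p := by
    refine (hasFDerivAt_const y p).congr_of_eventuallyEq ?_
    filter_upwards [h.isOpen.mem_nhds hp] with q hq
    obtain ⟨e, he⟩ := h.isInvertible q hq
    simp [← he]
  have h5 := DFunLike.congr_fun (h3.unique h4) x
  simp only [add_apply, ContinuousLinearMap.comp_apply,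
    ContinuousLinearMap.flip_apply, zero_apply, map_zero, zero_add] at h5
  exact eq_neg_of_add_eq_zero_right h5

/-- In the frame `L`, the derivative of the time-one map of the flow of `L X` with respect to `X`
in direction `Y` is the value at `1` of a solution of `z' = Y + B(z, X)`, `z(0) = 0`. -/
lemma IsLieFrame.exists_variation (h : IsLieFrame Ω L B) {A : E → E →L[ℝ] E}
    (hA : ContDiff ℝ ∞ A) {p₀ : E} {r : ℝ} (hr : Metric.ball p₀ r ⊆ Ω)
    (hAL : ∀ x ∈ Metric.ball p₀ r, A x = L x) {S : Set E} (hS : IsOpen S)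
    {u : E → C(unitInterval, E)} (hu : ContDiffOn ℝ ∞ u S)
    (hu' : ∀ X ∈ S, u X = constOp unitInterval E p₀ + integralOp E (curveVel hA X (u X)))
    {X : E} (hX : X ∈ S) (hXr : ∀ t, u X t ∈ Metric.ball p₀ r) (Y : E) :
    ∃ z : ℝ → E, z 0 = 0 ∧ z 1 = (L (u X 1)).inverse (fderiv ℝ u X Y 1) ∧
      ∀ t ∈ Set.Icc (0 : ℝ) 1, HasDerivWithinAt z (Y + B (z t) X) (Set.Icc 0 1) t := by
  obtain ⟨w, hw, hw'⟩ := flow_fderiv hA hS hu hu' hX Y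
  set v := fderiv ℝ u X Y with hv
  set ux : ℝ → E := Set.IccExtend zero_le_one (u X) with hux
  set vx : ℝ → E := Set.IccExtend zero_le_one v with hvx
  have hux' : ∀ t (ht : t ∈ Set.Icc (0 : ℝ) 1), ux t = u X ⟨t, ht⟩ := fun t ht =>
    Set.IccExtend_of_mem zero_le_one _ ht
  have hvx' : ∀ t (ht : t ∈ Set.Icc (0 : ℝ) 1), vx t = v ⟨t, ht⟩ := fun t ht =>
    Set.IccExtend_of_mem zero_le_one _ ht
  have hderivu : ∀ t ∈ Set.Icc (0 : ℝ) 1, HasDerivWithinAt ux (L (ux t) X) (Set.Icc 0 1) t := by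
    intro t ht
    have h1 := (hasDerivWithinAt_integralOp (curveVel hA X (u X)) ht).const_add p₀
    rw [curveVel_apply, hAL _ (hXr _), ← hux' t ht] at h1
    refine h1.congr (fun s hs => ?_) ?_
    · rw [hux' s hs, Set.IccExtend_of_mem zero_le_one _ hs]
      exact DFunLike.congr_fun (hu' X hX) ⟨s, hs⟩
    · rw [hux' t ht, Set.IccExtend_of_mem zero_le_one _ ht]
      exact DFunLike.congr_fun (hu' X hX) ⟨t, ht⟩
  have hderivv : ∀ t ∈ Set.Icc (0 : ℝ) 1, HasDerivWithinAt vx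
      (fderiv ℝ L (ux t) (vx t) X + L (ux t) Y) (Set.Icc 0 1) t := by
    intro t ht
    have h1 := hasDerivWithinAt_integralOp w ht
    have h2 : fderiv ℝ A (u X ⟨t, ht⟩) = fderiv ℝ L (u X ⟨t, ht⟩) := by
      apply Filter.EventuallyEq.fderiv_eq
      filter_upwards [Metric.isOpen_ball.mem_nhds (hXr ⟨t, ht⟩)] with x hx using hAL x hx
    rw [hw', ← hw, hAL _ (hXr _), h2, ← hux' t ht, ← hvx' t ht] at h1
    exact h1
  have h00 : ((0 : ℝ) ∈ Set.Icc (0 : ℝ) 1) := ⟨le_rfl, zero_le_one⟩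
  have h11 : ((1 : ℝ) ∈ Set.Icc (0 : ℝ) 1) := ⟨zero_le_one, le_rfl⟩
  refine ⟨fun t => (L (ux t)).inverse (vx t), ?_, ?_, fun t ht => ?_⟩
  · have : vx 0 = 0 := by
      rw [hvx' 0 h00, hw, integralOp_apply]
      simp
    simp [this]
  · simp only [hux' 1 h11, hvx' 1 h11]
    rfl
  · have hpt : ux t ∈ Ω := by rw [hux' t ht]; exact hr (hXr _)
    have hM := ((h.contDiffAt_inverse hpt).differentiableAt (by simp)).hasFDerivAt
    have h3 := (hM.comp_hasDerivWithinAt t (hderivu t ht)).clm_apply (hderivv t ht)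
    -- With v = L z, the product rule gives z' = Y + L⁻¹(DL(L z) X − DL(L X) z), and the structure
    -- equation turns the difference into L B(z, X).
    refine h3.congr_deriv ?_
    obtain ⟨e, he⟩ := h.isInvertible _ hpt
    set z := (L (ux t)).inverse (vx t) with hz
    have hvz : vx t = L (ux t) z := by rw [hz, ← he]; simp
    have hs := h.structure_eq _ hpt z X
    have hinv : ∀ y, (L (ux t)).inverse (L (ux t) y) = y := fun y => by rw [← he]; simp
    simp only [Function.comp_apply]
    rw [← hz, hvz, h.fderiv_inverse hpt, map_add, hinv]
    have := congrArg (L (ux t)).inverse hs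
    rw [map_sub, hinv] at this
    rw [← this]
    abel

/-- A linear equation `z' = Y + B(z, X)` preserves an invariant subspace. -/
lemma variation_mem_of_invariant {F : Type*} [NormedAddCommGroup F] [NormedSpace ℝ F]
    [FiniteDimensional ℝ F] (K : Submodule ℝ F) (N : F →L[ℝ] F) (hN : ∀ y ∈ K, N y ∈ K)
    {Y : F} (hY : Y ∈ K) {z : ℝ → F} (hz0 : z 0 = 0)
    (hz : ∀ t ∈ Set.Icc (0 : ℝ) 1, HasDerivWithinAt z (Y + N (z t)) (Set.Icc 0 1) t) :
    z 1 ∈ K := by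
  -- P is a projection with kernel K. As N preserves K, P N = P N P, so P z solves the homogeneous
  -- linear equation y' = P N y with y(0) = 0, and a Grönwall estimate forces P z = 0.
  obtain ⟨K', hK'⟩ := K.exists_isCompl
  set P : F →L[ℝ] F := LinearMap.toContinuousLinearMap
    (K'.subtype ∘ₗ K'.projectionOnto K hK'.symm) with hP
  have hPK : ∀ y, P y = 0 ↔ y ∈ K := by
    intro y
    simp [hP]
  have hPP : ∀ y, y - P y ∈ K := by
    intro y
    rw [← hPK, map_sub, sub_eq_zero]
    exact congrArg K'.subtype (Submodule.projectionOnto_apply_left hK'.symm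
      (K'.projectionOnto K hK'.symm y)).symm
  have hPN : ∀ y, P (N y) = P (N (P y)) := by
    intro y
    rw [← sub_eq_zero, ← map_sub, ← map_sub, hPK]
    exact hN _ (hPP y)
  have hderiv : ∀ t ∈ Set.Icc (0 : ℝ) 1,
      HasDerivWithinAt (fun t => P (z t)) (P (N (P (z t)))) (Set.Icc 0 1) t := by
    intro t ht
    have := P.hasFDerivAt.comp_hasDerivWithinAt t (hz t ht)
    refine this.congr_deriv ?_
    rw [map_add, (hPK Y).2 hY, zero_add, hPN]
  rw [← hPK]
  refine eq_zero_of_abs_deriv_le_mul_abs_self_of_eq_zero_right (f := fun t => P (z t))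
    (f' := fun t => P (N (P (z t)))) (K := ‖P.comp N‖) (a := 0) (b := 1)
    (fun t ht => (hderiv t ht).continuousWithinAt) (fun t ht => ?_) (by simp [hz0])
    (fun t _ => (P.comp N).le_opNorm _) 1 ⟨zero_le_one, le_rfl⟩
  exact (hderiv t ⟨ht.1, ht.2.le⟩).mono_of_mem_nhdsWithin (Icc_mem_nhdsGE_of_mem ht)

/-- Logarithmic coordinates: near `p₀` there is a smooth chart `log` with `D log(p₀) = id` whose
derivative, read in the frame `L`, preserves every subspace of `E × E` that is invariant under the
structure functions. -/
theorem IsLieFrame.exists_log (h : IsLieFrame Ω L B) {p₀ : E} (hp₀ : p₀ ∈ Ω)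
    (hL₀ : L p₀ = ContinuousLinearMap.id ℝ E) (K : Submodule ℝ (E × E))
    (N : E → E × E →L[ℝ] E × E) (hN : ∀ X Y, N X Y = (B Y.1 X, B Y.2 X))
    (hK : ∀ X, ∀ Y ∈ K, N X Y ∈ K) :
    ∃ (V : Set E) (log : E → E), IsOpen V ∧ p₀ ∈ V ∧ V ⊆ Ω ∧ ContDiffOn ℝ ∞ log V ∧
      fderiv ℝ log p₀ = ContinuousLinearMap.id ℝ E ∧
      ∀ p ∈ V, ∀ Y ∈ K, (fderiv ℝ log p (L p Y.1), fderiv ℝ log p (L p Y.2)) ∈ K := by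
  obtain ⟨A, r, hr0, hA, hrΩ, hAL⟩ := exists_smooth_cutoff h.isOpen h.contDiffOn hp₀
  obtain ⟨S, u, hS, h0S, hu, hu0, hu'⟩ := exists_smooth_flow hA p₀
  set ev : C(unitInterval, E) →L[ℝ] E := ContinuousMap.evalCLM ℝ (1 : unitInterval) with hev
  set ex : E → E := fun X => ev (u X) with hex
  -- For X in S' the whole curve stays in the ball where the cut-off field A agrees with L.
  set S' : Set E := S ∩ u ⁻¹' Metric.ball (u 0) r with hS'
  have hS'o : IsOpen S' := hu.continuousOn.isOpen_inter_preimage hS Metric.isOpen_ball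
  have h0S' : (0 : E) ∈ S' := ⟨h0S, Metric.mem_ball_self hr0⟩
  have hball : ∀ X ∈ S', ∀ t, u X t ∈ Metric.ball p₀ r := by
    intro X hX t
    have h1 : dist (u X) (u 0) < r := hX.2
    have h2 := (ContinuousMap.dist_apply_le_dist (f := u X) (g := u 0) t).trans_lt h1
    rwa [hu0, constOp_apply] at h2
  have hexs : ContDiffOn ℝ ∞ ex S' := ev.contDiff.comp_contDiffOn (hu.mono Set.inter_subset_left)
  have hexd : ∀ X ∈ S', HasFDerivAt ex (ev.comp (fderiv ℝ u X)) X := fun X hX =>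
    ev.hasFDerivAt.comp X
      ((hu.contDiffAt (hS.mem_nhds hX.1)).differentiableAt (by simp)).hasFDerivAt
  -- At X = 0 the curve is constantly p₀ and the variational equation reads v' = L(p₀) Y = Y, so
  -- v(1) = Y.
  have hex0 : ev.comp (fderiv ℝ u 0) = ContinuousLinearEquiv.refl ℝ E := by
    refine ContinuousLinearMap.ext fun Y => ?_
    obtain ⟨w, hw, hw'⟩ := flow_fderiv hA hS hu hu' h0S Y
    have hwc : w = constOp unitInterval E Y := by
      ext t
      rw [hw', hu0]
      simp [hAL p₀ (Metric.mem_ball_self hr0), hL₀]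
    have h1 : (1 : ℝ) ∈ Set.Icc (0 : ℝ) 1 := ⟨zero_le_one, le_rfl⟩
    change (fderiv ℝ u 0 Y) 1 = Y
    rw [hw, hwc, integralOp_apply]
    have : ∀ s : ℝ, Set.IccExtend zero_le_one (constOp unitInterval E Y) s = Y := fun s => rfl
    simp [this]
  obtain ⟨e, he0, heS, hee, hes⟩ := exists_smooth_local_inverse hS'o hexs h0S'
    (ContinuousLinearEquiv.refl ℝ E) (hex0 ▸ hexd 0 h0S')
  have hep₀ : e 0 = p₀ := by
    rw [hee]
    change (u 0) 1 = p₀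
    rw [hu0]; rfl
  have hcomp : ∀ p ∈ e.target, ∀ Y,
      fderiv ℝ e.symm p (ev (fderiv ℝ u (e.symm p) Y)) = Y := by
    intro p hp Y
    have h1 : HasFDerivAt e.symm (fderiv ℝ e.symm p) (ex (e.symm p)) := by
      rw [← hee, e.right_inv hp]
      exact ((hes.contDiffAt (e.open_target.mem_nhds hp)).differentiableAt (by simp)).hasFDerivAt
    have h2 := h1.comp (e.symm p) (hexd _ (heS (e.map_target hp)))
    have h3 : HasFDerivAt (e.symm ∘ ex) (ContinuousLinearMap.id ℝ E) (e.symm p) := by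
      refine (hasFDerivAt_id _).congr_of_eventuallyEq ?_
      filter_upwards [e.open_source.mem_nhds (e.map_target hp)] with X hX
      rw [Function.comp_apply, ← hee, e.left_inv hX, id]
    exact DFunLike.congr_fun (h2.unique h3) Y
  have hVΩ : ∀ p ∈ e.target, ev (u (e.symm p)) = p := by
    intro p hp
    have := e.right_inv hp
    rwa [hee] at this
  have hp₀V : p₀ ∈ e.target := hep₀ ▸ e.map_source he0
  refine ⟨e.target, e.symm, e.open_target, hp₀V, fun p hp => ?_, hes, ?_, fun p hp => ?_⟩
  · rw [← hVΩ p hp]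
    exact hrΩ (hball _ (heS (e.map_target hp)) 1)
  · refine ContinuousLinearMap.ext fun Y => ?_
    have h1 := hcomp p₀ hp₀V Y
    have h2 : e.symm p₀ = 0 := by rw [← hep₀, e.left_inv he0]
    rw [h2] at h1
    have h3 := DFunLike.congr_fun hex0 Y
    simp only [ContinuousLinearMap.comp_apply, ContinuousLinearEquiv.coe_coe,
      ContinuousLinearEquiv.refl_apply] at h3
    rw [h3] at h1
    simpa using h1
  · set X := e.symm p with hX
    have hXS : X ∈ S' := heS (e.map_target hp)
    have hpΩ : p ∈ Ω := by
      rw [← hVΩ p hp]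
      exact hrΩ (hball _ hXS 1)
    have hup : u X 1 = p := hVΩ p hp
    -- T is the derivative of the time-one map at X, read in the frame L. By the variational
    -- equation T × T preserves K.
    set T : E →ₗ[ℝ] E := ((L p).inverse.comp (ev.comp (fderiv ℝ u X))).toLinearMap with hT
    have hTL : ∀ Y, L p (T Y) = ev (fderiv ℝ u X Y) := fun Y =>
      (h.isInvertible p hpΩ).self_apply_inverse _
    have hTK : ∀ Y ∈ K, T.prodMap T Y ∈ K := by
      intro Y hY
      obtain ⟨z₁, h10, h11, h1⟩ := h.exists_variation hA hrΩ hAL hS hu hu' hXS.1 (hball X hXS) Y.1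
      obtain ⟨z₂, h20, h21, h2⟩ := h.exists_variation hA hrΩ hAL hS hu hu' hXS.1 (hball X hXS) Y.2
      have := variation_mem_of_invariant K (N X) (hK X) hY (z := fun t => (z₁ t, z₂ t))
        (by simp [h10, h20]) (fun t ht => by
          refine ((h1 t ht).prodMk (h2 t ht)).congr_deriv ?_
          rw [hN]; rfl)
      rw [h11, h21, hup] at this
      exact this
    have hinj : Function.Injective (T.prodMap T) := by
      have hTi : Function.Injective T := by
        intro Y Z hYZ
        have h1 := congrArg (L p) hYZ
        rw [hTL, hTL] at h1
        rw [← hcomp p hp Y, ← hcomp p hp Z]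
        exact congrArg _ h1
      exact Prod.map_injective.2 ⟨hTi, hTi⟩
    -- An injective endomorphism of the finite-dimensional K is onto, so the inverse of T × T
    -- preserves K too; the inverse of T is the derivative of log composed with the frame.
    have hsurj := LinearMap.surjective_of_injective
      (f := (T.prodMap T).restrict hTK) (fun a b hab => by
        have := congrArg Subtype.val hab
        exact Subtype.ext (hinj this))
    intro Y hY
    obtain ⟨Z, hZ⟩ := hsurj ⟨Y, hY⟩
    have hZ' : T.prodMap T Z.1 = Y := congrArg Subtype.val hZ
    have hZ1 : T Z.1.1 = Y.1 := congrArg Prod.fst hZ'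
    have hZ2 : T Z.1.2 = Y.2 := congrArg Prod.snd hZ'
    rw [← hZ1, ← hZ2, hTL, hTL, hcomp p hp, hcomp p hp]
    exact Z.2

end LocalExp

/-! ### Left trivialisation of the tangent bundle and its smoothness -/

section LeftTrivialization

variable {E : Type*} [NormedAddCommGroup E] [NormedSpace ℝ E]
  {G : Type*} [TopologicalSpace G] [ChartedSpace E G] [Group G] [LieGroup 𝓘(ℝ, E) ∞ G]

lemma mdifferentiableAt_mul_left (g h : G) :
    MDifferentiableAt 𝓘(ℝ, E) 𝓘(ℝ, E) (fun x : G => g * x) h :=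
  (contMDiff_mul_left (n := ∞)).contMDiffAt.mdifferentiableAt (by simp)

lemma mdifferentiableAt_mul_right (g h : G) :
    MDifferentiableAt 𝓘(ℝ, E) 𝓘(ℝ, E) (fun x : G => x * g) h :=
  (contMDiff_mul_right (n := ∞)).contMDiffAt.mdifferentiableAt (by simp)

lemma dLeftInv_dLeft (g : G) (v : TangentSpace 𝓘(ℝ, E) (1 : G)) :
    dLeftInv g (dLeft g v) = v := by
  have h1 : HasMFDerivAt 𝓘(ℝ, E) 𝓘(ℝ, E) (fun x : G => g * x) 1 (dLeft g) :=
    (mdifferentiableAt_mul_left g 1).hasMFDerivAt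
  have h2 : HasMFDerivAt 𝓘(ℝ, E) 𝓘(ℝ, E) (fun x : G => g⁻¹ * x) (g * 1) (dLeftInv g) := by
    rw [mul_one]
    exact (mdifferentiableAt_mul_left g⁻¹ g).hasMFDerivAt
  have h3 := h2.comp (1 : G) h1
  have h4 : (fun x : G => g⁻¹ * x) ∘ (fun x : G => g * x) = id := by
    ext x; simp
  rw [h4] at h3
  exact DFunLike.congr_fun (hasMFDerivAt_unique h3 (hasMFDerivAt_id 1)) v

lemma dLeft_dLeftInv (g : G) (v : TangentSpace 𝓘(ℝ, E) g) :
    dLeft g (dLeftInv g v) = v := by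
  have h1 : HasMFDerivAt 𝓘(ℝ, E) 𝓘(ℝ, E) (fun x : G => g * x) (g⁻¹ * g) (dLeft g) := by
    rw [inv_mul_cancel]
    exact (mdifferentiableAt_mul_left g 1).hasMFDerivAt
  have h2 : HasMFDerivAt 𝓘(ℝ, E) 𝓘(ℝ, E) (fun x : G => g⁻¹ * x) g (dLeftInv g) :=
    (mdifferentiableAt_mul_left g⁻¹ g).hasMFDerivAt
  have h3 := h1.comp g h2
  have h4 : (fun x : G => g * x) ∘ (fun x : G => g⁻¹ * x) = id := by
    ext x; simp
  rw [h4] at h3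
  exact DFunLike.congr_fun (hasMFDerivAt_unique h3 (hasMFDerivAt_id g)) v

@[simp] lemma leftTInv_leftT (g : G) (z : CT E (1 : G)) : leftTInv g (leftT g z) = z := by
  unfold leftTInv leftT
  rw [← LinearMap.comp_apply, ← LinearMap.baseChange_comp]
  have : (dLeftInv g).toLinearMap ∘ₗ (dLeft g).toLinearMap =
      (LinearMap.id : TangentSpace 𝓘(ℝ, E) (1 : G) →ₗ[ℝ] TangentSpace 𝓘(ℝ, E) (1 : G)) :=
    LinearMap.ext fun v => dLeftInv_dLeft g v
  rw [this, LinearMap.baseChange_id]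
  rfl

@[simp] lemma leftT_leftTInv (g : G) (z : CT E g) : leftT g (leftTInv g z) = z := by
  unfold leftTInv leftT
  rw [← LinearMap.comp_apply, ← LinearMap.baseChange_comp]
  have : (dLeft g).toLinearMap ∘ₗ (dLeftInv g).toLinearMap =
      (LinearMap.id : TangentSpace 𝓘(ℝ, E) g →ₗ[ℝ] TangentSpace 𝓘(ℝ, E) g) :=
    LinearMap.ext fun v => dLeft_dLeftInv g v
  rw [this, LinearMap.baseChange_id]
  rfl

lemma mfderiv_mul_inr (g h : G) (w : TangentSpace 𝓘(ℝ, E) h) :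
    mfderiv (𝓘(ℝ, E).prod 𝓘(ℝ, E)) 𝓘(ℝ, E) (fun p : G × G => p.1 * p.2) (g, h)
      ((0 : TangentSpace 𝓘(ℝ, E) g), w) =
    mfderiv 𝓘(ℝ, E) 𝓘(ℝ, E) (fun x : G => g * x) h w := by
  have hm : ContMDiff (𝓘(ℝ, E).prod 𝓘(ℝ, E)) 𝓘(ℝ, E) ∞ (fun p : G × G => p.1 * p.2) :=
    contMDiff_mul 𝓘(ℝ, E) ∞
  exact (mfderiv_prod_eq_add_apply (hm.mdifferentiableAt (by simp))).trans
    ((congrArg₂ (· + ·) (map_zero _) rfl).trans (zero_add _))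

lemma mfderiv_mul_inl (g h : G) (w : TangentSpace 𝓘(ℝ, E) g) :
    mfderiv (𝓘(ℝ, E).prod 𝓘(ℝ, E)) 𝓘(ℝ, E) (fun p : G × G => p.1 * p.2) (g, h)
      (w, (0 : TangentSpace 𝓘(ℝ, E) h)) =
    mfderiv 𝓘(ℝ, E) 𝓘(ℝ, E) (fun x : G => x * h) g w := by
  have hm : ContMDiff (𝓘(ℝ, E).prod 𝓘(ℝ, E)) 𝓘(ℝ, E) ∞ (fun p : G × G => p.1 * p.2) :=
    contMDiff_mul 𝓘(ℝ, E) ∞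
  exact (mfderiv_prod_eq_add_apply (hm.mdifferentiableAt (by simp))).trans
    ((congrArg₂ (· + ·) rfl (map_zero _)).trans (add_zero _))

/-- Base points such as g * 1 and g agree only propositionally, so the vectors are compared in the
common model space E. -/
lemma tangentBundle_mk_eq {x y : G} (h : x = y) (v w : E) (hvw : v = w) :
    (⟨x, (v : TangentSpace 𝓘(ℝ, E) x)⟩ : TangentBundle 𝓘(ℝ, E) G) =
      ⟨y, (w : TangentSpace 𝓘(ℝ, E) y)⟩ := by
  subst h hvw; rfl

/-- Left-invariant vector fields are smooth. -/
lemma contMDiff_dLeft (v : TangentSpace 𝓘(ℝ, E) (1 : G)) :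
    ContMDiff 𝓘(ℝ, E) 𝓘(ℝ, E).tangent ∞
      (fun g : G => (⟨g, dLeft g v⟩ : TangentBundle 𝓘(ℝ, E) G)) := by
  have hm : ContMDiff (𝓘(ℝ, E).prod 𝓘(ℝ, E)) 𝓘(ℝ, E) ∞ (fun p : G × G => p.1 * p.2) :=
    contMDiff_mul 𝓘(ℝ, E) ∞
  -- The left-invariant field is the tangent map of the multiplication applied to the smooth family
  -- (0_g, v) over (g, 1).
  have S₁ : ContMDiff 𝓘(ℝ, E) (𝓘(ℝ, E).tangent.prod 𝓘(ℝ, E).tangent) ∞ (fun g : G =>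
      ((⟨g, 0⟩, ⟨1, v⟩) : TangentBundle 𝓘(ℝ, E) G × TangentBundle 𝓘(ℝ, E) G)) :=
    (Bundle.contMDiff_zeroSection ℝ (TangentSpace 𝓘(ℝ, E) : G → Type _)).prodMk contMDiff_const
  have S₂ : ContMDiff (𝓘(ℝ, E).tangent.prod 𝓘(ℝ, E).tangent) (𝓘(ℝ, E).prod 𝓘(ℝ, E)).tangent ∞
      (equivTangentBundleProd 𝓘(ℝ, E) G 𝓘(ℝ, E) G).symm := contMDiff_equivTangentBundleProd_symm
  have S₃ : ContMDiff (𝓘(ℝ, E).prod 𝓘(ℝ, E)).tangent 𝓘(ℝ, E).tangent ∞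
      (tangentMap (𝓘(ℝ, E).prod 𝓘(ℝ, E)) 𝓘(ℝ, E) (fun p : G × G => p.1 * p.2)) :=
    hm.contMDiff_tangentMap (by simp)
  refine ((S₃.comp S₂).comp S₁).congr fun g => ?_
  exact tangentBundle_mk_eq (mul_one g).symm _ _ (mfderiv_mul_inr g 1 v).symm

/-- The left trivialisation of the tangent bundle. -/
def leftTriv (p : TangentBundle 𝓘(ℝ, E) G) : E := dLeftInv p.1 p.2

/-- The left trivialisation of the tangent bundle is smooth. -/
lemma contMDiff_leftTriv :
    ContMDiff 𝓘(ℝ, E).tangent 𝓘(ℝ, E) ∞ (leftTriv : TangentBundle 𝓘(ℝ, E) G → E) := by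
  have hm : ContMDiff (𝓘(ℝ, E).prod 𝓘(ℝ, E)) 𝓘(ℝ, E) ∞ (fun p : G × G => p.1 * p.2) :=
    contMDiff_mul 𝓘(ℝ, E) ∞
  -- Translation of p back to 1 is the tangent map of the multiplication applied to the zero vector
  -- at the inverse base point, paired with p.
  have S₁ : ContMDiff 𝓘(ℝ, E).tangent (𝓘(ℝ, E).tangent.prod 𝓘(ℝ, E).tangent) ∞
      (fun p : TangentBundle 𝓘(ℝ, E) G =>
        ((⟨p.1⁻¹, 0⟩, p) : TangentBundle 𝓘(ℝ, E) G × TangentBundle 𝓘(ℝ, E) G)) :=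
    (((Bundle.contMDiff_zeroSection ℝ (TangentSpace 𝓘(ℝ, E) : G → Type _)).comp
      (contMDiff_inv 𝓘(ℝ, E) ∞)).comp
        (Bundle.contMDiff_proj (TangentSpace 𝓘(ℝ, E) : G → Type _))).prodMk contMDiff_id
  have S₂ : ContMDiff (𝓘(ℝ, E).tangent.prod 𝓘(ℝ, E).tangent) (𝓘(ℝ, E).prod 𝓘(ℝ, E)).tangent ∞
      (equivTangentBundleProd 𝓘(ℝ, E) G 𝓘(ℝ, E) G).symm := contMDiff_equivTangentBundleProd_symm
  have S₃ : ContMDiff (𝓘(ℝ, E).prod 𝓘(ℝ, E)).tangent 𝓘(ℝ, E).tangent ∞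
      (tangentMap (𝓘(ℝ, E).prod 𝓘(ℝ, E)) 𝓘(ℝ, E) (fun p : G × G => p.1 * p.2)) :=
    hm.contMDiff_tangentMap (by simp)
  have S₄ : ContMDiff 𝓘(ℝ, E).tangent 𝓘(ℝ, E).tangent ∞ (fun p : TangentBundle 𝓘(ℝ, E) G =>
      (⟨1, dLeftInv p.1 p.2⟩ : TangentBundle 𝓘(ℝ, E) G)) :=
    ((S₃.comp S₂).comp S₁).congr fun p =>
      tangentBundle_mk_eq (inv_mul_cancel p.1).symm _ _ (mfderiv_mul_inr p.1⁻¹ p.1 p.2).symm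
  intro p
  have := (Bundle.contMDiffAt_totalSpace.1 (S₄ p)).2
  -- On the fibre over 1 the trivialisation centred at 1 is the identity of E, so smoothness into
  -- the bundle over the constant base point 1 becomes smoothness into E.
  have key : ∀ w : TangentSpace 𝓘(ℝ, E) (1 : G), (show E from w) =
      (trivializationAt E (TangentSpace 𝓘(ℝ, E)) (1 : G)
        (⟨1, w⟩ : TangentBundle 𝓘(ℝ, E) G)).2 := fun w =>
    ((tangentBundleCore 𝓘(ℝ, E) G).coordChange_self (achart E (1 : G)) 1
      (mem_chart_source E 1) w).symm
  exact this.congr_of_eventuallyEq (Filter.Eventually.of_forall fun p => key _)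

variable [FiniteDimensional ℝ E]

lemma contMDiff_linearMap_leftTriv (ℓ : TangentSpace 𝓘(ℝ, E) (1 : G) →ₗ[ℝ] ℂ) :
    ContMDiff 𝓘(ℝ, E).tangent 𝓘(ℝ, ℂ) ∞
      (fun p : TangentBundle 𝓘(ℝ, E) G => ℓ (dLeftInv p.1 p.2)) := by
  have h1 : ContMDiff 𝓘(ℝ, E) 𝓘(ℝ, ℂ) ∞ (fun v : E => (show E →ₗ[ℝ] ℂ from ℓ) v) :=
    (LinearMap.toContinuousLinearMap (show E →ₗ[ℝ] ℂ from ℓ)).contDiff.contMDiff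
  exact h1.comp contMDiff_leftTriv

lemma SmoothRealField.smoothFun_comp_dLeftInv {V : Set G}
    {A : Π x : G, TangentSpace 𝓘(ℝ, E) x} (hA : SmoothRealField V A)
    (ℓ : TangentSpace 𝓘(ℝ, E) (1 : G) →ₗ[ℝ] ℂ) :
    SmoothFun E V (fun g : G => ℓ (dLeftInv g (A g))) :=
  (contMDiff_linearMap_leftTriv ℓ).comp_contMDiffOn hA

lemma mdifferentiableAt_comp_dLeftInv {x : G}
    {A : Π x : G, TangentSpace 𝓘(ℝ, E) x}
    (hA : MDifferentiableAt 𝓘(ℝ, E) 𝓘(ℝ, E).tangent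
      (fun y => (⟨y, A y⟩ : TangentBundle 𝓘(ℝ, E) G)) x)
    (ℓ : TangentSpace 𝓘(ℝ, E) (1 : G) →ₗ[ℝ] ℂ) :
    MDifferentiableAt 𝓘(ℝ, E) 𝓘(ℝ, ℂ) (fun g : G => ℓ (dLeftInv g (A g))) x :=
  MDifferentiableAt.comp (I' := 𝓘(ℝ, E).tangent) x
    (g := fun p : TangentBundle 𝓘(ℝ, E) G => ℓ (dLeftInv p.1 p.2))
    (f := fun y => (⟨y, A y⟩ : TangentBundle 𝓘(ℝ, E) G))
    (((contMDiff_linearMap_leftTriv ℓ) _).mdifferentiableAt (by simp)) hA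

end LeftTrivialization

/-! ### Lie brackets of vector fields and derivatives of functions -/

lemma le_infty (n : ℕ) : (n : WithTop ℕ∞) ≤ ∞ := by
  exact_mod_cast (le_top : (n : ℕ∞) ≤ ⊤)

section Chart

open VectorField

variable {E : Type*} [NormedAddCommGroup E] [NormedSpace ℝ E]
  {M : Type*} [TopologicalSpace M] [ChartedSpace E M] [IsManifold 𝓘(ℝ, E) ∞ M]
  {W : Type*} [NormedAddCommGroup W] [NormedSpace ℝ W]

/-- The derivative of the chart at `x`, applied to a tangent vector at `y`. -/
def dChart (x y : M) (v : TangentSpace 𝓘(ℝ, E) y) : E :=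
  mfderiv 𝓘(ℝ, E) 𝓘(ℝ, E) (extChartAt 𝓘(ℝ, E) x) y v

/-- A vector field, read in the chart at `x`. -/
def fieldInChart (x : M) (A : Π x : M, TangentSpace 𝓘(ℝ, E) x) (q : E) : E :=
  mpullbackWithin 𝓘(ℝ, E) 𝓘(ℝ, E) (extChartAt 𝓘(ℝ, E) x).symm A (Set.range 𝓘(ℝ, E)) q

lemma mvfderiv_comp_extChartAt {x y : M} (hy : y ∈ (extChartAt 𝓘(ℝ, E) x).source) {g : E → W}
    (hg : DifferentiableAt ℝ g (extChartAt 𝓘(ℝ, E) x y)) (v : TangentSpace 𝓘(ℝ, E) y) :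
    mvfderiv 𝓘(ℝ, E) (fun y => g (extChartAt 𝓘(ℝ, E) x y)) y v =
      fderiv ℝ g (extChartAt 𝓘(ℝ, E) x y) (dChart x y v) := by
  have h1 : HasMFDerivAt 𝓘(ℝ, E) 𝓘(ℝ, W) g (extChartAt 𝓘(ℝ, E) x y)
      (fderiv ℝ g (extChartAt 𝓘(ℝ, E) x y)) := hg.hasFDerivAt.hasMFDerivAt
  have h2 := (mdifferentiableAt_extChartAt (I := 𝓘(ℝ, E)) (by simpa using hy)).hasMFDerivAt
  have h3 := (h1.comp y h2).mfderiv
  exact DFunLike.congr_fun h3 v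

lemma fieldInChart_apply (x : M) (A : Π x : M, TangentSpace 𝓘(ℝ, E) x) {q : E}
    (hq : q ∈ (extChartAt 𝓘(ℝ, E) x).target) :
    fieldInChart x A q = dChart x _ (A ((extChartAt 𝓘(ℝ, E) x).symm q)) := by
  have hi := isInvertible_mfderivWithin_extChartAt_symm (I := 𝓘(ℝ, E)) hq
  refine (hi.inverse_apply_eq).2 ?_
  exact (DFunLike.congr_fun (mfderivWithin_extChartAt_symm_comp_mfderiv_extChartAt
    (I := 𝓘(ℝ, E)) hq) (A ((extChartAt 𝓘(ℝ, E) x).symm q))).symm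

lemma fieldInChart_self (x : M) (A : Π x : M, TangentSpace 𝓘(ℝ, E) x) :
    fieldInChart x A (extChartAt 𝓘(ℝ, E) x x) = dChart x x (A x) := by
  rw [fieldInChart_apply x A (mem_extChartAt_target x)]
  have : ∀ y, y = x → dChart x y (A y) = dChart x x (A x) := by rintro _ rfl; rfl
  exact this _ (extChartAt_to_inv x)

lemma contDiffAt_comp_extChartAt_symm {n : WithTop ℕ∞} (hn : n ≤ ∞) {F : M → W} {x : M}
    (hF : ContMDiffAt 𝓘(ℝ, E) 𝓘(ℝ, W) n F x) :
    ContDiffAt ℝ n (F ∘ (extChartAt 𝓘(ℝ, E) x).symm) (extChartAt 𝓘(ℝ, E) x x) := by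
  have h1 : ContMDiffAt 𝓘(ℝ, E) 𝓘(ℝ, E) n (extChartAt 𝓘(ℝ, E) x).symm
      (extChartAt 𝓘(ℝ, E) x x) :=
    ((contMDiffOn_extChartAt_symm (n := ∞) x).contMDiffAt
      ((isOpen_extChartAt_target x).mem_nhds (mem_extChartAt_target x))).of_le hn
  exact (ContMDiffAt.comp_of_eq hF h1 (extChartAt_to_inv x)).contDiffAt

lemma eventually_extChartAt_symm_target (x : M) :
    ∀ᶠ q in nhds (extChartAt 𝓘(ℝ, E) x x), q ∈ (extChartAt 𝓘(ℝ, E) x).target :=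
  (isOpen_extChartAt_target x).mem_nhds (mem_extChartAt_target x)

lemma mvfderiv_eq_fderiv_inChart {F : M → W} {x : M}
    (hF : ContMDiffAt 𝓘(ℝ, E) 𝓘(ℝ, W) 1 F x) :
    ∀ᶠ q in nhds (extChartAt 𝓘(ℝ, E) x x), ∀ A : Π x : M, TangentSpace 𝓘(ℝ, E) x,
      mvfderiv 𝓘(ℝ, E) F ((extChartAt 𝓘(ℝ, E) x).symm q) (A ((extChartAt 𝓘(ℝ, E) x).symm q)) =
        fderiv ℝ (F ∘ (extChartAt 𝓘(ℝ, E) x).symm) q (fieldInChart x A q) := by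
  have hF' : ContDiffAt ℝ 1 (F ∘ (extChartAt 𝓘(ℝ, E) x).symm) (extChartAt 𝓘(ℝ, E) x x) :=
    contDiffAt_comp_extChartAt_symm (by exact_mod_cast le_top) hF
  filter_upwards [eventually_extChartAt_symm_target x, hF'.eventually (by simp)] with q hq hq' A
  set φ := extChartAt 𝓘(ℝ, E) x with hφ
  have hys : φ.symm q ∈ φ.source := φ.map_target hq
  have hFe : F =ᶠ[nhds (φ.symm q)] fun y => (F ∘ φ.symm) (φ y) := by
    filter_upwards [(isOpen_extChartAt_source x).mem_nhds hys] with y hy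
    simp only [Function.comp_apply]
    rw [φ.left_inv hy]
  have hd : DifferentiableAt ℝ (F ∘ φ.symm) (φ (φ.symm q)) := by
    rw [φ.right_inv hq]; exact hq'.differentiableAt one_ne_zero
  have h1 : mvfderiv 𝓘(ℝ, E) F (φ.symm q) =
      mvfderiv 𝓘(ℝ, E) (fun y => (F ∘ φ.symm) (φ y)) (φ.symm q) := hFe.mfderiv_eq
  rw [h1, mvfderiv_comp_extChartAt hys hd, fieldInChart_apply x A hq, φ.right_inv hq]

lemma mvfderiv_eq_fderiv_inChart_self {F : M → W} {x : M}
    (hF : DifferentiableAt ℝ (F ∘ (extChartAt 𝓘(ℝ, E) x).symm) (extChartAt 𝓘(ℝ, E) x x))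
    (v : TangentSpace 𝓘(ℝ, E) x) :
    mvfderiv 𝓘(ℝ, E) F x v =
      fderiv ℝ (F ∘ (extChartAt 𝓘(ℝ, E) x).symm) (extChartAt 𝓘(ℝ, E) x x) (dChart x x v) := by
  set φ := extChartAt 𝓘(ℝ, E) x with hφ
  have hFe : F =ᶠ[nhds x] fun y => (F ∘ φ.symm) (φ y) := by
    filter_upwards [(isOpen_extChartAt_source (I := 𝓘(ℝ, E)) x).mem_nhds
      (mem_extChartAt_source x)] with y hy
    simp only [Function.comp_apply]
    rw [φ.left_inv hy]
  have h1 : mvfderiv 𝓘(ℝ, E) F x =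
      mvfderiv 𝓘(ℝ, E) (fun y => (F ∘ φ.symm) (φ y)) x := hFe.mfderiv_eq
  rw [h1, mvfderiv_comp_extChartAt (mem_extChartAt_source x) hF]

variable [FiniteDimensional ℝ E]

lemma differentiableAt_fieldInChart {x : M} {A : Π x : M, TangentSpace 𝓘(ℝ, E) x}
    (hA : MDifferentiableAt 𝓘(ℝ, E) 𝓘(ℝ, E).tangent
      (fun y => (⟨y, A y⟩ : TangentBundle 𝓘(ℝ, E) M)) x) :
    DifferentiableAt ℝ (fieldInChart x A) (extChartAt 𝓘(ℝ, E) x x) := by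
  have : IsManifold 𝓘(ℝ, E) 2 M := IsManifold.of_le (n := ∞) (le_infty 2)
  have h := (mdifferentiableWithinAt_univ.2 hA).differentiableWithinAt_mpullbackWithin_vectorField
  have h2 : DifferentiableWithinAt ℝ (fieldInChart x A)
      ((extChartAt 𝓘(ℝ, E) x).symm ⁻¹' Set.univ ∩ Set.range 𝓘(ℝ, E))
      (extChartAt 𝓘(ℝ, E) x x) := h
  rw [Set.preimage_univ, Set.univ_inter, ModelWithCorners.range_eq_univ] at h2
  exact h2.differentiableAt Filter.univ_mem

lemma dChart_mlieBracket {x : M} (A B : Π x : M, TangentSpace 𝓘(ℝ, E) x) :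
    dChart x x (mlieBracket 𝓘(ℝ, E) A B x) =
      fderiv ℝ (fieldInChart x B) (extChartAt 𝓘(ℝ, E) x x) (dChart x x (A x)) -
      fderiv ℝ (fieldInChart x A) (extChartAt 𝓘(ℝ, E) x x) (dChart x x (B x)) := by
  have h1 := mlieBracketWithin_apply (I := 𝓘(ℝ, E)) (V := A) (W := B) (s := Set.univ) (x₀ := x)
  have h2 : dChart x x (mlieBracket 𝓘(ℝ, E) A B x) =
      lieBracketWithin ℝ (fieldInChart x A) (fieldInChart x B)
        ((extChartAt 𝓘(ℝ, E) x).symm ⁻¹' Set.univ ∩ Set.range 𝓘(ℝ, E))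
        (extChartAt 𝓘(ℝ, E) x x) := by
    unfold dChart mlieBracket
    rw [h1]
    exact (isInvertible_mfderiv_extChartAt (mem_extChartAt_source x)).self_apply_inverse _
  rw [h2, Set.preimage_univ, Set.univ_inter, ModelWithCorners.range_eq_univ,
    lieBracketWithin_univ, lieBracket, fieldInChart_self, fieldInChart_self]

/-- The Lie bracket of vector fields is the commutator of derivations. -/
lemma mvfderiv_mlieBracket {F : M → W} {x : M} (hF : ContMDiffAt 𝓘(ℝ, E) 𝓘(ℝ, W) ∞ F x)
    {A B : Π x : M, TangentSpace 𝓘(ℝ, E) x}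
    (hA : MDifferentiableAt 𝓘(ℝ, E) 𝓘(ℝ, E).tangent
      (fun y => (⟨y, A y⟩ : TangentBundle 𝓘(ℝ, E) M)) x)
    (hB : MDifferentiableAt 𝓘(ℝ, E) 𝓘(ℝ, E).tangent
      (fun y => (⟨y, B y⟩ : TangentBundle 𝓘(ℝ, E) M)) x) :
    mvfderiv 𝓘(ℝ, E) F x (mlieBracket 𝓘(ℝ, E) A B x) =
      mvfderiv 𝓘(ℝ, E) (fun y => mvfderiv 𝓘(ℝ, E) F y (B y)) x (A x) -
      mvfderiv 𝓘(ℝ, E) (fun y => mvfderiv 𝓘(ℝ, E) F y (A y)) x (B x) := by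
  have hF' : ContDiffAt ℝ ∞ (F ∘ (extChartAt 𝓘(ℝ, E) x).symm) (extChartAt 𝓘(ℝ, E) x x) :=
    contDiffAt_comp_extChartAt_symm le_rfl hF
  have hev := mvfderiv_eq_fderiv_inChart (hF.of_le (by exact_mod_cast le_top))
  set φ := extChartAt 𝓘(ℝ, E) x with hφ
  set f := F ∘ φ.symm with hf
  have hf2 : DifferentiableAt ℝ (fderiv ℝ f) (φ x) :=
    (hF'.fderiv_right (m := 1) (le_infty 2)).differentiableAt one_ne_zero
  -- In the chart an iterated derivative is a second derivative of f plus a first derivative along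
  -- the derivative of the field. In the commutator the former cancel by symmetry and the latter
  -- form the coordinate expression of the bracket.
  have key : ∀ C : Π x : M, TangentSpace 𝓘(ℝ, E) x, MDifferentiableAt 𝓘(ℝ, E) 𝓘(ℝ, E).tangent
      (fun y => (⟨y, C y⟩ : TangentBundle 𝓘(ℝ, E) M)) x → ∀ v : TangentSpace 𝓘(ℝ, E) x,
      mvfderiv 𝓘(ℝ, E) (fun y => mvfderiv 𝓘(ℝ, E) F y (C y)) x v =
        fderiv ℝ (fderiv ℝ f) (φ x) (dChart x x v) (dChart x x (C x)) +
        fderiv ℝ f (φ x) (fderiv ℝ (fieldInChart x C) (φ x) (dChart x x v)) := by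
    intro C hC v
    have h1 : (fun y => mvfderiv 𝓘(ℝ, E) F y (C y)) ∘ φ.symm =ᶠ[nhds (φ x)]
        fun q => fderiv ℝ f q (fieldInChart x C q) := by
      filter_upwards [hev] with q hq using hq C
    have h2 := hf2.hasFDerivAt.clm_apply (differentiableAt_fieldInChart hC).hasFDerivAt
    have h3 := h2.congr_of_eventuallyEq h1
    rw [mvfderiv_eq_fderiv_inChart_self h3.differentiableAt, h3.fderiv]
    simp only [add_apply, ContinuousLinearMap.comp_apply, ContinuousLinearMap.flip_apply]
    rw [fieldInChart_self, add_comm]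
  have hsymm : IsSymmSndFDerivAt ℝ f (φ x) := hF'.isSymmSndFDerivAt (by simpa using le_infty 2)
  rw [key A hA, key B hB, mvfderiv_eq_fderiv_inChart_self (hF'.differentiableAt (by simp)),
    dChart_mlieBracket, map_sub, hsymm.eq]
  abel

end Chart

/-! ### The bracket of 𝔤, and of real vector fields in the left trivialisation -/

section Bracket

open VectorField

variable {E : Type*} [NormedAddCommGroup E] [NormedSpace ℝ E] [FiniteDimensional ℝ E]
  {G : Type*} [TopologicalSpace G] [ChartedSpace E G] [Group G] [LieGroup 𝓘(ℝ, E) ∞ G]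

/-- The Lie bracket on `𝔤 = T_1 G`. -/
def lieBr (v w : TangentSpace 𝓘(ℝ, E) (1 : G)) : TangentSpace 𝓘(ℝ, E) (1 : G) :=
  mlieBracket 𝓘(ℝ, E) (fun g : G => dLeft g v) (fun g => dLeft g w) 1

lemma mdifferentiableAt_dLeft (v : TangentSpace 𝓘(ℝ, E) (1 : G)) (x : G) :
    MDifferentiableAt 𝓘(ℝ, E) 𝓘(ℝ, E).tangent
      (fun g : G => (⟨g, dLeft g v⟩ : TangentBundle 𝓘(ℝ, E) G)) x :=
  (contMDiff_dLeft v x).mdifferentiableAt (by simp)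

lemma mlieBracket_dLeft (v w : TangentSpace 𝓘(ℝ, E) (1 : G)) (x : G) :
    mlieBracket 𝓘(ℝ, E) (fun g : G => dLeft g v) (fun g => dLeft g w) x =
      dLeft x (lieBr v w) := by
  have : LieGroup 𝓘(ℝ, E) (minSmoothness ℝ 3) G := by
    refine LieGroup.of_le (n := ∞) ?_
    simpa using le_infty 3
  exact (congrFun (mulInvariantVector_mlieBracket (I := 𝓘(ℝ, E)) v w) x).symm

lemma isManifold_two : IsManifold 𝓘(ℝ, E) 2 G := IsManifold.of_le (n := ∞) (le_infty 2)

lemma lieBr_add_left (u v w : TangentSpace 𝓘(ℝ, E) (1 : G)) :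
    lieBr (u + v) w = lieBr u w + lieBr v w := by
  have := isManifold_two (E := E) (G := G)
  have h : (fun g : G => dLeft g (u + v)) =
      (fun g : G => dLeft g u) + (fun g : G => dLeft g v) := by
    ext g; exact map_add _ _ _
  unfold lieBr
  rw [h, mlieBracket_add_left (mdifferentiableAt_dLeft u 1) (mdifferentiableAt_dLeft v 1)]

lemma lieBr_smul_left (c : ℝ) (v w : TangentSpace 𝓘(ℝ, E) (1 : G)) :
    lieBr (c • v) w = c • lieBr v w := by
  have := isManifold_two (E := E) (G := G)
  have h : (fun g : G => dLeft g (c • v)) = c • (fun g : G => dLeft g v) := by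
    ext g; exact map_smul _ _ _
  unfold lieBr
  rw [h, mlieBracket_const_smul_left (mdifferentiableAt_dLeft v 1)]

lemma lieBr_swap (v w : TangentSpace 𝓘(ℝ, E) (1 : G)) : lieBr v w = - lieBr w v :=
  mlieBracket_swap_apply

lemma lieBr_add_right (u v w : TangentSpace 𝓘(ℝ, E) (1 : G)) :
    lieBr w (u + v) = lieBr w u + lieBr w v := by
  rw [lieBr_swap, lieBr_add_left, neg_add, ← lieBr_swap, ← lieBr_swap]

lemma lieBr_smul_right (c : ℝ) (v w : TangentSpace 𝓘(ℝ, E) (1 : G)) :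
    lieBr w (c • v) = c • lieBr w v := by
  rw [lieBr_swap, lieBr_smul_left, ← smul_neg, ← lieBr_swap]

/-- The Lie bracket on `𝔤` as a bilinear map. -/
def lieBrₗ : TangentSpace 𝓘(ℝ, E) (1 : G) →ₗ[ℝ] TangentSpace 𝓘(ℝ, E) (1 : G) →ₗ[ℝ]
    TangentSpace 𝓘(ℝ, E) (1 : G) :=
  LinearMap.mk₂ ℝ lieBr (fun u v w => lieBr_add_left u v w) (fun c v w => lieBr_smul_left c v w)
    (fun u v w => lieBr_add_right v w u) (fun c v w => lieBr_smul_right c w v)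

/-- The Lie bracket of vector fields in the left trivialisation. -/
lemma linearMap_dLeftInv_mlieBracket (ℓ : TangentSpace 𝓘(ℝ, E) (1 : G) →ₗ[ℝ] ℂ) {x : G}
    {A B : Π x : G, TangentSpace 𝓘(ℝ, E) x}
    (hA : MDifferentiableAt 𝓘(ℝ, E) 𝓘(ℝ, E).tangent
      (fun y => (⟨y, A y⟩ : TangentBundle 𝓘(ℝ, E) G)) x)
    (hB : MDifferentiableAt 𝓘(ℝ, E) 𝓘(ℝ, E).tangent
      (fun y => (⟨y, B y⟩ : TangentBundle 𝓘(ℝ, E) G)) x) :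
    ℓ (dLeftInv x (mlieBracket 𝓘(ℝ, E) A B x)) =
      mvfderiv 𝓘(ℝ, E) (fun y => ℓ (dLeftInv y (B y))) x (A x) -
      mvfderiv 𝓘(ℝ, E) (fun y => ℓ (dLeftInv y (A y))) x (B x) +
      ℓ (lieBr (dLeftInv x (A x)) (dLeftInv x (B x))) := by
  have := isManifold_two (E := E) (G := G)
  have : IsManifold 𝓘(ℝ, E) 1 G := IsManifold.of_le (n := ∞) (by exact_mod_cast le_infty 1)
  -- Φ collects the bracket and the two derivative terms. It is linear over functions in both
  -- fields, so it depends only on their values at x and may be computed on left-invariant fields,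
  -- where the derivative terms differentiate constants.
  set Φ : (Π x : G, TangentSpace 𝓘(ℝ, E) x) → (Π x : G, TangentSpace 𝓘(ℝ, E) x) → ℂ :=
    fun A B => ℓ (dLeftInv x (mlieBracket 𝓘(ℝ, E) A B x)) -
      mvfderiv 𝓘(ℝ, E) (fun y => ℓ (dLeftInv y (B y))) x (A x) +
      mvfderiv 𝓘(ℝ, E) (fun y => ℓ (dLeftInv y (A y))) x (B x) with hΦ
  have hswap : ∀ A B, Φ A B = - Φ B A := by
    intro A B
    simp only [hΦ]
    rw [mlieBracket_swap_apply, map_neg, map_neg]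
    ring
  have hten : ∀ B, MDifferentiableAt 𝓘(ℝ, E) 𝓘(ℝ, E).tangent
      (fun y => (⟨y, B y⟩ : TangentBundle 𝓘(ℝ, E) G)) x →
      TensorialAt 𝓘(ℝ, E) E (Φ · B) x := by
    intro B hB
    refine ⟨?_, ?_⟩
    · intro f A hf hA
      have h1 : (fun y => ℓ (dLeftInv y ((f • A) y))) =
          f • fun y => ℓ (dLeftInv y (A y)) := by
        ext y; simp
      simp only [hΦ]
      rw [h1, mvfderiv_smul hf (mdifferentiableAt_comp_dLeftInv hA ℓ),
        mlieBracket_smul_left hf hA]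
      simp
      ring
    · intro A A' hA hA'
      have h1 : (fun y => ℓ (dLeftInv y ((A + A') y))) =
          (fun y => ℓ (dLeftInv y (A y))) + fun y => ℓ (dLeftInv y (A' y)) := by
        ext y; simp
      simp only [hΦ]
      rw [h1, mvfderiv_add (mdifferentiableAt_comp_dLeftInv hA ℓ)
        (mdifferentiableAt_comp_dLeftInv hA' ℓ), mlieBracket_add_left hA hA']
      simp only [map_add, add_apply, Pi.add_apply]
      ring
  have hten' : ∀ A, MDifferentiableAt 𝓘(ℝ, E) 𝓘(ℝ, E).tangent
      (fun y => (⟨y, A y⟩ : TangentBundle 𝓘(ℝ, E) G)) x →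
      TensorialAt 𝓘(ℝ, E) E (Φ A ·) x := by
    intro A hA
    refine ⟨fun {f B} hf hB => ?_, fun {B B'} hB hB' => ?_⟩
    · rw [hswap, (hten A hA).smul hf hB, hswap A B, smul_neg]
    · rw [hswap, (hten A hA).add hB hB', hswap A B, hswap A B', neg_add]
  have key : Φ A B = Φ (fun g => dLeft g (dLeftInv x (A x))) (fun g => dLeft g (dLeftInv x (B x))) :=
    TensorialAt.pointwise₂ hten hten' hA (mdifferentiableAt_dLeft _ x) hB
      (mdifferentiableAt_dLeft _ x) (dLeft_dLeftInv x _).symm (dLeft_dLeftInv x _).symm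
  simp only [hΦ, mlieBracket_dLeft, dLeftInv_dLeft, mvfderiv_const] at key
  simp only [zero_apply, sub_zero, add_zero] at key
  rw [← key]
  ring

end Bracket

/-! ### Complex tangent vectors and differentials of complex functions -/

section Complexification

variable {E : Type*} [NormedAddCommGroup E] [NormedSpace ℝ E]
  {G : Type*} [TopologicalSpace G] [ChartedSpace E G]

lemma ct_hom_ext {x : G} {Q : Type*} [AddCommGroup Q] [Module ℂ Q] {φ ψ : CT E x →ₗ[ℂ] Q}
    (h : ∀ v : TangentSpace 𝓘(ℝ, E) x, φ ((1 : ℂ) ⊗ₜ[ℝ] v) = ψ ((1 : ℂ) ⊗ₜ[ℝ] v)) : φ = ψ := by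
  refine LinearMap.ext fun z => ?_
  induction z using TensorProduct.induction_on with
  | zero => simp
  | tmul a v =>
    have : a ⊗ₜ[ℝ] v = a • ((1 : ℂ) ⊗ₜ[ℝ] v) := by
      rw [TensorProduct.smul_tmul', smul_eq_mul, mul_one]
    rw [this, map_smul, map_smul, h]
  | add a b ha hb => rw [map_add, map_add, ha, hb]

lemma mkT_eq {x : G} (A B : TangentSpace 𝓘(ℝ, E) x) :
    mkT A B = (1 : ℂ) ⊗ₜ[ℝ] A + Complex.I • ((1 : ℂ) ⊗ₜ[ℝ] B) := by
  rw [mkT, TensorProduct.smul_tmul', smul_eq_mul, mul_one]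

lemma mkT_reT_imT {x : G} (z : CT E x) : mkT (reT z) (imT z) = z := by
  induction z using TensorProduct.induction_on with
  | zero => simp [mkT]
  | tmul a v =>
    simp only [reT, imT, mkT, LinearMap.comp_apply, LinearMap.rTensor_tmul,
      LinearEquiv.coe_coe, TensorProduct.lid_tmul, Complex.reLm_coe, Complex.imLm_coe]
    rw [← TensorProduct.smul_tmul, ← TensorProduct.smul_tmul, ← TensorProduct.add_tmul]
    congr 1
    apply Complex.ext <;> simp
  | add a b ha hb =>
    conv_rhs => rw [← ha, ← hb]
    simp only [map_add, mkT, TensorProduct.tmul_add]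
    abel

lemma reT_mkT {x : G} (A B : TangentSpace 𝓘(ℝ, E) x) : reT (mkT A B) = A := by
  simp [reT, mkT]

lemma imT_mkT {x : G} (A B : TangentSpace 𝓘(ℝ, E) x) : imT (mkT A B) = B := by
  simp [imT, mkT]

lemma apply_mkT {x : G} (φ : CTDual E x) (A B : TangentSpace 𝓘(ℝ, E) x) :
    φ (mkT A B) = φ ((1 : ℂ) ⊗ₜ[ℝ] A) + Complex.I * φ ((1 : ℂ) ⊗ₜ[ℝ] B) := by
  rw [mkT_eq, map_add, map_smul, smul_eq_mul]

/-- Restriction of a complex covector to real tangent vectors. -/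
def restrictReal {x : G} (φ : CTDual E x) : TangentSpace 𝓘(ℝ, E) x →ₗ[ℝ] ℂ :=
  φ.restrictScalars ℝ ∘ₗ TensorProduct.mk ℝ ℂ (TangentSpace 𝓘(ℝ, E) x) 1

@[simp] lemma restrictReal_apply {x : G} (φ : CTDual E x) (v : TangentSpace 𝓘(ℝ, E) x) :
    restrictReal φ v = φ ((1 : ℂ) ⊗ₜ[ℝ] v) := rfl

section Deriv

lemma cderiv_tmul (F : G → ℂ) (x : G) (v : TangentSpace 𝓘(ℝ, E) x) :
    cderiv E F x ((1 : ℂ) ⊗ₜ[ℝ] v) = mvfderiv 𝓘(ℝ, E) F x v := by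
  simp [cderiv]

lemma cderiv_mkT (F : G → ℂ) (x : G) (A B : TangentSpace 𝓘(ℝ, E) x) :
    cderiv E F x (mkT A B) = mvfderiv 𝓘(ℝ, E) F x A + Complex.I * mvfderiv 𝓘(ℝ, E) F x B := by
  rw [apply_mkT, cderiv_tmul, cderiv_tmul]

variable {F H : G → ℂ} {x : G}

lemma cderiv_eq_of_hasMFDerivAt {F' : TangentSpace 𝓘(ℝ, E) x →L[ℝ] ℂ}
    (h : HasMFDerivAt 𝓘(ℝ, E) 𝓘(ℝ, ℂ) F x F') (v : TangentSpace 𝓘(ℝ, E) x) :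
    cderiv E F x ((1 : ℂ) ⊗ₜ[ℝ] v) = F' v := by
  rw [cderiv_tmul]
  exact DFunLike.congr_fun h.mfderiv v

lemma hasMFDerivAt_mvfderiv (hF : MDifferentiableAt 𝓘(ℝ, E) 𝓘(ℝ, ℂ) F x) :
    HasMFDerivAt 𝓘(ℝ, E) 𝓘(ℝ, ℂ) F x (mvfderiv 𝓘(ℝ, E) F x) := hF.hasMFDerivAt

lemma cderiv_congr (h : F =ᶠ[nhds x] H) : cderiv E F x = cderiv E H x := by
  refine ct_hom_ext fun v => ?_
  rw [cderiv_tmul, cderiv_tmul]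
  exact DFunLike.congr_fun (h.mfderiv_eq (I := 𝓘(ℝ, E)) (I' := 𝓘(ℝ, ℂ))) v

lemma cderiv_const (c : ℂ) : cderiv E (fun _ : G => c) x = 0 := by
  refine ct_hom_ext fun v => ?_
  rw [cderiv_tmul, mvfderiv_const]
  rfl

lemma cderiv_add (hF : MDifferentiableAt 𝓘(ℝ, E) 𝓘(ℝ, ℂ) F x)
    (hH : MDifferentiableAt 𝓘(ℝ, E) 𝓘(ℝ, ℂ) H x) :
    cderiv E (fun y => F y + H y) x = cderiv E F x + cderiv E H x := by
  refine ct_hom_ext fun v => ?_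
  rw [LinearMap.add_apply, cderiv_tmul F, cderiv_tmul H]
  exact cderiv_eq_of_hasMFDerivAt
    ((hasMFDerivAt_mvfderiv hF).add (hasMFDerivAt_mvfderiv hH)) v

lemma cderiv_mul (hF : MDifferentiableAt 𝓘(ℝ, E) 𝓘(ℝ, ℂ) F x)
    (hH : MDifferentiableAt 𝓘(ℝ, E) 𝓘(ℝ, ℂ) H x) :
    cderiv E (fun y => F y * H y) x = H x • cderiv E F x + F x • cderiv E H x := by
  refine ct_hom_ext fun v => ?_
  rw [LinearMap.add_apply, LinearMap.smul_apply, LinearMap.smul_apply, cderiv_tmul F,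
    cderiv_tmul H]
  refine (cderiv_eq_of_hasMFDerivAt
    ((hasMFDerivAt_mvfderiv hF).mul (hasMFDerivAt_mvfderiv hH)) v).trans ?_
  exact add_comm _ _

lemma cderiv_const_mul (c : ℂ) (hF : MDifferentiableAt 𝓘(ℝ, E) 𝓘(ℝ, ℂ) F x) :
    cderiv E (fun y => c * F y) x = c • cderiv E F x := by
  rw [cderiv_mul mdifferentiableAt_const hF, cderiv_const, smul_zero, zero_add]

lemma cderiv_neg (hF : MDifferentiableAt 𝓘(ℝ, E) 𝓘(ℝ, ℂ) F x) :
    cderiv E (fun y => - F y) x = - cderiv E F x := by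
  have := cderiv_const_mul (-1) hF
  simpa using this

lemma mdifferentiableAt_add (hF : MDifferentiableAt 𝓘(ℝ, E) 𝓘(ℝ, ℂ) F x)
    (hH : MDifferentiableAt 𝓘(ℝ, E) 𝓘(ℝ, ℂ) H x) :
    MDifferentiableAt 𝓘(ℝ, E) 𝓘(ℝ, ℂ) (fun y => F y + H y) x := hF.add hH

lemma mdifferentiableAt_mul (hF : MDifferentiableAt 𝓘(ℝ, E) 𝓘(ℝ, ℂ) F x)
    (hH : MDifferentiableAt 𝓘(ℝ, E) 𝓘(ℝ, ℂ) H x) :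
    MDifferentiableAt 𝓘(ℝ, E) 𝓘(ℝ, ℂ) (fun y => F y * H y) x :=
  ((hasMFDerivAt_mvfderiv hF).mul (hasMFDerivAt_mvfderiv hH)).mdifferentiableAt

lemma mdifferentiableAt_sum {ι : Type*} {s : Finset ι} {F : ι → G → ℂ}
    (hF : ∀ i ∈ s, MDifferentiableAt 𝓘(ℝ, E) 𝓘(ℝ, ℂ) (F i) x) :
    MDifferentiableAt 𝓘(ℝ, E) 𝓘(ℝ, ℂ) (fun y => ∑ i ∈ s, F i y) x := by
  classical
  induction s using Finset.induction_on with
  | empty => simpa using mdifferentiableAt_const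
  | insert a s ha ih =>
    simp only [Finset.mem_insert, forall_eq_or_imp] at hF
    simp only [Finset.sum_insert ha]
    exact mdifferentiableAt_add hF.1 (ih hF.2)

lemma cderiv_sum {ι : Type*} {s : Finset ι} {F : ι → G → ℂ}
    (hF : ∀ i ∈ s, MDifferentiableAt 𝓘(ℝ, E) 𝓘(ℝ, ℂ) (F i) x) :
    cderiv E (fun y => ∑ i ∈ s, F i y) x = ∑ i ∈ s, cderiv E (F i) x := by
  classical
  induction s using Finset.induction_on with
  | empty => simpa using cderiv_const 0
  | insert a s ha ih =>
    simp only [Finset.mem_insert, forall_eq_or_imp] at hF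
    simp only [Finset.sum_insert ha]
    rw [cderiv_add hF.1 (mdifferentiableAt_sum hF.2), ih hF.2]

end Deriv

end Complexification

/-! ### The complexified bracket in the left trivialisation -/

section ComplexBracket

open VectorField

variable {E : Type*} [NormedAddCommGroup E] [NormedSpace ℝ E] [FiniteDimensional ℝ E]
  {G : Type*} [TopologicalSpace G] [ChartedSpace E G] [Group G] [LieGroup 𝓘(ℝ, E) ∞ G]

/-- The complex bilinear extension of the Lie bracket to `𝔤_ℂ`. -/
def brC : CT E (1 : G) →ₗ[ℂ] CT E (1 : G) →ₗ[ℂ] CT E (1 : G) :=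
  LinearMap.liftBaseChange ℂ (LinearMap.baseChangeHom ℝ ℂ _ _ ∘ₗ lieBrₗ)

lemma brC_tmul (v w : TangentSpace 𝓘(ℝ, E) (1 : G)) :
    brC ((1 : ℂ) ⊗ₜ[ℝ] v) ((1 : ℂ) ⊗ₜ[ℝ] w) = (1 : ℂ) ⊗ₜ[ℝ] lieBr v w := by
  simp [brC, lieBrₗ]

lemma brC_swap (z w : CT E (1 : G)) : brC z w = - brC w z := by
  have : (brC : CT E (1 : G) →ₗ[ℂ] CT E (1 : G) →ₗ[ℂ] CT E (1 : G)) = - brC.flip := by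
    refine ct_hom_ext fun v => ct_hom_ext fun w => ?_
    rw [LinearMap.neg_apply, LinearMap.neg_apply, LinearMap.flip_apply, brC_tmul, brC_tmul,
      lieBr_swap, TensorProduct.tmul_neg]
  exact DFunLike.congr_fun (DFunLike.congr_fun this z) w

lemma leftT_tmul (x : G) (v : TangentSpace 𝓘(ℝ, E) (1 : G)) :
    leftT x ((1 : ℂ) ⊗ₜ[ℝ] v) = (1 : ℂ) ⊗ₜ[ℝ] dLeft x v := by
  simp [leftT]

lemma leftTInv_tmul (x : G) (v : TangentSpace 𝓘(ℝ, E) x) :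
    leftTInv x ((1 : ℂ) ⊗ₜ[ℝ] v) = (1 : ℂ) ⊗ₜ[ℝ] dLeftInv x v := by
  simp [leftTInv]

lemma leftT_mkT (x : G) (A B : TangentSpace 𝓘(ℝ, E) (1 : G)) :
    leftT x (mkT A B) = mkT (dLeft x A) (dLeft x B) := by
  rw [mkT_eq, mkT_eq, map_add, map_smul, leftT_tmul, leftT_tmul]

lemma leftTInv_mkT (x : G) (A B : TangentSpace 𝓘(ℝ, E) x) :
    leftTInv x (mkT A B) = mkT (dLeftInv x A) (dLeftInv x B) := by
  rw [mkT_eq, mkT_eq, map_add, map_smul, leftTInv_tmul, leftTInv_tmul]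

lemma reT_leftT (x : G) (z : CT E (1 : G)) : reT (leftT x z) = dLeft x (reT z) := by
  conv_lhs => rw [← mkT_reT_imT z, leftT_mkT, reT_mkT]

lemma imT_leftT (x : G) (z : CT E (1 : G)) : imT (leftT x z) = dLeft x (imT z) := by
  conv_lhs => rw [← mkT_reT_imT z, leftT_mkT, imT_mkT]

/-- The real and imaginary parts of a complex vector field are differentiable at `x`. -/
def FieldDiffAt (X : Π x : G, CT E x) (x : G) : Prop :=
  MDifferentiableAt 𝓘(ℝ, E) 𝓘(ℝ, E).tangent
    (fun y => (⟨y, reT (X y)⟩ : TangentBundle 𝓘(ℝ, E) G)) x ∧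
  MDifferentiableAt 𝓘(ℝ, E) 𝓘(ℝ, E).tangent
    (fun y => (⟨y, imT (X y)⟩ : TangentBundle 𝓘(ℝ, E) G)) x

lemma fieldDiffAt_leftField (z : CT E (1 : G)) (x : G) : FieldDiffAt (leftField z) x := by
  refine ⟨?_, ?_⟩
  · simpa only [leftField, reT_leftT] using mdifferentiableAt_dLeft (reT z) x
  · simpa only [leftField, imT_leftT] using mdifferentiableAt_dLeft (imT z) x

lemma apply_leftTInv (ζ : CTDual E (1 : G)) {x : G} (z : CT E x) :
    ζ (leftTInv x z) = restrictReal ζ (dLeftInv x (reT z)) +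
      Complex.I * restrictReal ζ (dLeftInv x (imT z)) := by
  conv_lhs => rw [← mkT_reT_imT z, leftTInv_mkT, apply_mkT]
  rfl

/-- The Lie bracket of complex vector fields in the left trivialisation. -/
lemma apply_leftTInv_cbracket (ζ : CTDual E (1 : G)) {x : G} {X Y : Π x : G, CT E x}
    (hX : FieldDiffAt X x) (hY : FieldDiffAt Y x) :
    ζ (leftTInv x (cbracket X Y x)) =
      cderiv E (fun y => ζ (leftTInv y (Y y))) x (X x) -
      cderiv E (fun y => ζ (leftTInv y (X y))) x (Y x) +
      ζ (brC (leftTInv x (X x)) (leftTInv x (Y x))) := by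
  have hd : ∀ {Z : Π x : G, CT E x} (hZ : FieldDiffAt Z x) (V : CT E x),
      cderiv E (fun y => ζ (leftTInv y (Z y))) x V =
        mvfderiv 𝓘(ℝ, E) (fun y => restrictReal ζ (dLeftInv y (reT (Z y)))) x (reT V) +
        Complex.I * mvfderiv 𝓘(ℝ, E) (fun y => restrictReal ζ (dLeftInv y (reT (Z y)))) x (imT V) +
        Complex.I *
        (mvfderiv 𝓘(ℝ, E) (fun y => restrictReal ζ (dLeftInv y (imT (Z y)))) x (reT V) +
        Complex.I *
          mvfderiv 𝓘(ℝ, E) (fun y => restrictReal ζ (dLeftInv y (imT (Z y)))) x (imT V)) := by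
    intro Z hZ V
    simp only [apply_leftTInv]
    have h1 := mdifferentiableAt_comp_dLeftInv hZ.1 (restrictReal ζ)
    have h2 := mdifferentiableAt_comp_dLeftInv hZ.2 (restrictReal ζ)
    rw [cderiv_add h1 (mdifferentiableAt_mul mdifferentiableAt_const h2), cderiv_const_mul _ h2]
    conv_lhs => rw [← mkT_reT_imT V]
    rw [LinearMap.add_apply, LinearMap.smul_apply, cderiv_mkT, cderiv_mkT, smul_eq_mul]
  have hbr : ζ (brC (leftTInv x (X x)) (leftTInv x (Y x))) =
      restrictReal ζ (lieBr (dLeftInv x (reT (X x))) (dLeftInv x (reT (Y x)))) +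
      Complex.I * restrictReal ζ (lieBr (dLeftInv x (reT (X x))) (dLeftInv x (imT (Y x)))) +
      Complex.I * restrictReal ζ (lieBr (dLeftInv x (imT (X x))) (dLeftInv x (reT (Y x)))) -
      restrictReal ζ (lieBr (dLeftInv x (imT (X x))) (dLeftInv x (imT (Y x)))) := by
    conv_lhs => rw [← mkT_reT_imT (X x), ← mkT_reT_imT (Y x), leftTInv_mkT, leftTInv_mkT,
      mkT_eq, mkT_eq]
    simp only [map_add, map_smul, LinearMap.add_apply, LinearMap.smul_apply, brC_tmul,
      restrictReal_apply, smul_eq_mul]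
    linear_combination (ζ ((1 : ℂ) ⊗ₜ[ℝ] lieBr (dLeftInv x (imT (X x)))
      (dLeftInv x (imT (Y x))))) * Complex.I_mul_I
  rw [hbr, hd hX, hd hY]
  unfold cbracket
  rw [leftTInv_mkT, apply_mkT, ← restrictReal_apply, ← restrictReal_apply]
  simp only [map_sub, map_add]
  rw [linearMap_dLeftInv_mlieBracket _ hX.1 hY.1, linearMap_dLeftInv_mlieBracket _ hX.2 hY.2,
    linearMap_dLeftInv_mlieBracket _ hX.1 hY.2, linearMap_dLeftInv_mlieBracket _ hX.2 hY.1]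
  ring_nf
  simp only [Complex.I_sq]
  ring

lemma cbracket_leftField (z w : CT E (1 : G)) (x : G) :
    cbracket (leftField z) (leftField w) x = leftT x (brC z w) := by
  rw [← leftT_leftTInv x (cbracket (leftField z) (leftField w) x)]
  congr 1
  refine (Module.forall_dual_apply_eq_zero_iff ℂ _).1 ?_ |> sub_eq_zero.1
  intro ζ
  rw [map_sub, apply_leftTInv_cbracket ζ (fieldDiffAt_leftField z x) (fieldDiffAt_leftField w x)]
  simp [leftField, cderiv_const]

end ComplexBracket

/-! ### Algebra and derivatives of smooth complex functions -/

section SmoothFunctions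

variable {E : Type*} [NormedAddCommGroup E] [NormedSpace ℝ E]
  {G : Type*} [TopologicalSpace G] [ChartedSpace E G] {V : Set G} {F H : G → ℂ}

lemma smoothFun_const (c : ℂ) : SmoothFun E V (fun _ : G => c) := contMDiffOn_const

lemma SmoothFun.add (hF : SmoothFun E V F) (hH : SmoothFun E V H) :
    SmoothFun E V (fun y => F y + H y) := ContMDiffOn.add hF hH

lemma SmoothFun.mul (hF : SmoothFun E V F) (hH : SmoothFun E V H) :
    SmoothFun E V (fun y => F y * H y) := by
  have h : ContDiff ℝ ∞ (fun p : ℂ × ℂ => p.1 * p.2) := contDiff_fst.mul contDiff_snd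
  exact h.contMDiff.comp_contMDiffOn (ContMDiffOn.prodMk_space hF hH)

lemma SmoothFun.const_mul (c : ℂ) (hF : SmoothFun E V F) : SmoothFun E V (fun y => c * F y) :=
  (smoothFun_const c).mul hF

lemma SmoothFun.neg (hF : SmoothFun E V F) : SmoothFun E V (fun y => - F y) := by
  simpa using hF.const_mul (-1)

lemma SmoothFun.sum {ι : Type*} {s : Finset ι} {F : ι → G → ℂ}
    (hF : ∀ i ∈ s, SmoothFun E V (F i)) : SmoothFun E V (fun y => ∑ i ∈ s, F i y) := by
  classical
  induction s using Finset.induction_on with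
  | empty => simpa using smoothFun_const 0
  | insert a s ha ih =>
    simp only [Finset.mem_insert, forall_eq_or_imp] at hF
    simp only [Finset.sum_insert ha]
    exact hF.1.add (ih hF.2)

lemma SmoothFun.congr (hF : SmoothFun E V F) (h : ∀ x ∈ V, H x = F x) : SmoothFun E V H :=
  ContMDiffOn.congr hF h

lemma SmoothFun.mono {V' : Set G} (hF : SmoothFun E V F) (h : V' ⊆ V) : SmoothFun E V' F :=
  ContMDiffOn.mono hF h

lemma SmoothFun.contMDiffAt (hV : IsOpen V) (hF : SmoothFun E V F) {x : G} (hx : x ∈ V) :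
    ContMDiffAt 𝓘(ℝ, E) 𝓘(ℝ, ℂ) ∞ F x :=
  ContMDiffOn.contMDiffAt hF (hV.mem_nhds hx)

lemma SmoothFun.mdifferentiableAt (hV : IsOpen V) (hF : SmoothFun E V F) {x : G} (hx : x ∈ V) :
    MDifferentiableAt 𝓘(ℝ, E) 𝓘(ℝ, ℂ) F x :=
  (hF.contMDiffAt hV hx).mdifferentiableAt (by simp)

variable [IsManifold 𝓘(ℝ, E) ∞ G]

lemma contMDiffOn_mvfderiv_apply {W : Type*} [NormedAddCommGroup W] [NormedSpace ℝ W] {F : G → W}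
    (hV : IsOpen V) (hF : ContMDiffOn 𝓘(ℝ, E) 𝓘(ℝ, W) ∞ F V)
    {A : Π x : G, TangentSpace 𝓘(ℝ, E) x} (hA : SmoothRealField V A) :
    ContMDiffOn 𝓘(ℝ, E) 𝓘(ℝ, W) ∞ (fun y => mvfderiv 𝓘(ℝ, E) F y (A y)) V := by
  have : IsManifold 𝓘(ℝ, E) 1 G := IsManifold.of_le (n := ∞) (by exact_mod_cast le_infty 1)
  have h1 := ContMDiffOn.contMDiffOn_tangentMapWithin (m := ∞) hF (by simp)
    hV.uniqueMDiffOn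
  have h2 := h1.comp hA (fun x hx => hx)
  have h3 := (contMDiff_snd_tangentBundle_modelSpace (n := ∞) W 𝓘(ℝ, W)).comp_contMDiffOn h2
  refine ContMDiffOn.congr h3 fun y hy => ?_
  have h4 : mfderivWithin 𝓘(ℝ, E) 𝓘(ℝ, W) F V y = mfderiv 𝓘(ℝ, E) 𝓘(ℝ, W) F y :=
    mfderivWithin_of_isOpen hV hy
  exact (DFunLike.congr_fun h4 (A y)).symm

lemma SmoothFun.mvfderiv_apply (hV : IsOpen V) (hF : SmoothFun E V F)
    {A : Π x : G, TangentSpace 𝓘(ℝ, E) x} (hA : SmoothRealField V A) :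
    SmoothFun E V (fun y => mvfderiv 𝓘(ℝ, E) F y (A y)) := contMDiffOn_mvfderiv_apply hV hF hA

lemma SmoothFun.cderiv_apply (hV : IsOpen V) (hF : SmoothFun E V F)
    {X : Π x : G, CT E x} (hX : SmoothField V X) :
    SmoothFun E V (fun y => cderiv E F y (X y)) := by
  have h := (hF.mvfderiv_apply hV hX.1).add ((hF.mvfderiv_apply hV hX.2).const_mul Complex.I)
  refine h.congr fun y _ => ?_
  conv_lhs => rw [← mkT_reT_imT (X y), cderiv_mkT]

end SmoothFunctions

/-! ### Commutators of left-invariant derivations -/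

section Commutator

variable {E : Type*} [NormedAddCommGroup E] [NormedSpace ℝ E] [FiniteDimensional ℝ E]
  {G : Type*} [TopologicalSpace G] [ChartedSpace E G] [Group G] [LieGroup 𝓘(ℝ, E) ∞ G]
  {V : Set G} {F : G → ℂ}

lemma smoothField_leftField (z : CT E (1 : G)) : SmoothField V (leftField z) := by
  refine ⟨?_, ?_⟩
  · simp only [leftField, reT_leftT]
    exact (contMDiff_dLeft (reT z)).contMDiffOn
  · simp only [leftField, imT_leftT]
    exact (contMDiff_dLeft (imT z)).contMDiffOn

/-- The commutator of left-invariant vector fields, as derivations. -/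
lemma cderiv_cderiv_leftField_sub (hV : IsOpen V) (hF : SmoothFun E V F) {x : G} (hx : x ∈ V)
    (z w : CT E (1 : G)) :
    cderiv E (fun y => cderiv E F y (leftField w y)) x (leftField z x) -
      cderiv E (fun y => cderiv E F y (leftField z y)) x (leftField w x) =
      cderiv E F x (leftField (brC z w) x) := by
  have hs : ∀ w : CT E (1 : G),
      MDifferentiableAt 𝓘(ℝ, E) 𝓘(ℝ, ℂ) (fun y => cderiv E F y (leftField w y)) x := fun w =>
    (hF.cderiv_apply hV (smoothField_leftField w)).mdifferentiableAt hV hx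
  have hadd : ∀ w w', cderiv E (fun y => cderiv E F y (leftField (w + w') y)) x =
      cderiv E (fun y => cderiv E F y (leftField w y)) x +
      cderiv E (fun y => cderiv E F y (leftField w' y)) x := fun w w' => by
    rw [← cderiv_add (hs w) (hs w')]
    simp [leftField]
  have hsmul : ∀ (c : ℂ) w, cderiv E (fun y => cderiv E F y (leftField (c • w) y)) x =
      c • cderiv E (fun y => cderiv E F y (leftField w y)) x := fun c w => by
    rw [← cderiv_const_mul c (hs w)]
    simp [leftField]
  -- Both sides are ℂ-bilinear in (z, w), so real vectors suffice, where the identity is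
  -- `mvfderiv_mlieBracket`.
  set Ψ : CT E (1 : G) →ₗ[ℂ] CT E (1 : G) →ₗ[ℂ] ℂ :=
    LinearMap.mk₂ ℂ (fun z w => cderiv E (fun y => cderiv E F y (leftField w y)) x (leftField z x))
      (by simp [leftField]) (by simp [leftField])
      (fun z w w' => by rw [hadd]; rfl) (fun c z w => by rw [hsmul]; rfl) with hΨ
  have key : Ψ - Ψ.flip = brC.compr₂ (cderiv E F x ∘ₗ leftT x) := by
    refine ct_hom_ext fun v => ct_hom_ext fun w => ?_
    have := mvfderiv_mlieBracket (hF.contMDiffAt hV hx) (mdifferentiableAt_dLeft v x)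
      (mdifferentiableAt_dLeft w x)
    rw [mlieBracket_dLeft] at this
    simp only [LinearMap.sub_apply, LinearMap.flip_apply, hΨ, LinearMap.mk₂_apply,
      LinearMap.compr₂_apply, LinearMap.comp_apply, brC_tmul, leftField, leftT_tmul, cderiv_tmul]
    exact this.symm
  exact DFunLike.congr_fun (DFunLike.congr_fun key z) w

end Commutator

/-! ### Right-invariant fields and their bracket with left-invariant ones -/

section RightInvariant

open VectorField

variable {E : Type*} [NormedAddCommGroup E] [NormedSpace ℝ E]
  {G : Type*} [TopologicalSpace G] [ChartedSpace E G] [Group G] [LieGroup 𝓘(ℝ, E) ∞ G]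

/-- The differential at `1` of right translation by `g`. -/
def dRight (g : G) : TangentSpace 𝓘(ℝ, E) (1 : G) →L[ℝ] TangentSpace 𝓘(ℝ, E) g :=
  mfderiv 𝓘(ℝ, E) 𝓘(ℝ, E) (fun h : G => h * g) 1

/-- Right-invariant vector fields are smooth. -/
lemma contMDiff_dRight (v : TangentSpace 𝓘(ℝ, E) (1 : G)) :
    ContMDiff 𝓘(ℝ, E) 𝓘(ℝ, E).tangent ∞
      (fun g : G => (⟨g, dRight g v⟩ : TangentBundle 𝓘(ℝ, E) G)) := by
  have hm : ContMDiff (𝓘(ℝ, E).prod 𝓘(ℝ, E)) 𝓘(ℝ, E) ∞ (fun p : G × G => p.1 * p.2) :=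
    contMDiff_mul 𝓘(ℝ, E) ∞
  have S₁ : ContMDiff 𝓘(ℝ, E) (𝓘(ℝ, E).tangent.prod 𝓘(ℝ, E).tangent) ∞ (fun g : G =>
      ((⟨1, v⟩, ⟨g, 0⟩) : TangentBundle 𝓘(ℝ, E) G × TangentBundle 𝓘(ℝ, E) G)) :=
    contMDiff_const.prodMk (Bundle.contMDiff_zeroSection ℝ (TangentSpace 𝓘(ℝ, E) : G → Type _))
  have S₂ : ContMDiff (𝓘(ℝ, E).tangent.prod 𝓘(ℝ, E).tangent) (𝓘(ℝ, E).prod 𝓘(ℝ, E)).tangent ∞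
      (equivTangentBundleProd 𝓘(ℝ, E) G 𝓘(ℝ, E) G).symm := contMDiff_equivTangentBundleProd_symm
  have S₃ : ContMDiff (𝓘(ℝ, E).prod 𝓘(ℝ, E)).tangent 𝓘(ℝ, E).tangent ∞
      (tangentMap (𝓘(ℝ, E).prod 𝓘(ℝ, E)) 𝓘(ℝ, E) (fun p : G × G => p.1 * p.2)) :=
    hm.contMDiff_tangentMap (by simp)
  refine ((S₃.comp S₂).comp S₁).congr fun g => ?_
  exact tangentBundle_mk_eq (one_mul g).symm _ _ (mfderiv_mul_inl 1 g v).symm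

/-- The multiplication, read in the chart at `1`. -/
def mulInChart (G : Type*) [TopologicalSpace G] [ChartedSpace E G] [Group G] (p : E × E) : E :=
  extChartAt 𝓘(ℝ, E) (1 : G) ((extChartAt 𝓘(ℝ, E) (1 : G)).symm p.1 *
    (extChartAt 𝓘(ℝ, E) (1 : G)).symm p.2)

lemma contDiffAt_mulInChart :
    ContDiffAt ℝ ∞ (mulInChart (E := E) G)
      (extChartAt 𝓘(ℝ, E) (1 : G) 1, extChartAt 𝓘(ℝ, E) (1 : G) 1) := by
  set φ := extChartAt 𝓘(ℝ, E) (1 : G) with hφ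
  have h1 : ContMDiffAt 𝓘(ℝ, E) 𝓘(ℝ, E) ∞ φ.symm (φ 1) :=
    (contMDiffOn_extChartAt_symm (n := ∞) (1 : G)).contMDiffAt
      ((isOpen_extChartAt_target (1 : G)).mem_nhds (mem_extChartAt_target (1 : G)))
  have hf : ContMDiffAt 𝓘(ℝ, E × E) 𝓘(ℝ, E) ∞ (fun p : E × E => φ.symm p.1) (φ 1, φ 1) :=
    ContMDiffAt.comp (I' := 𝓘(ℝ, E)) (φ 1, φ 1) h1 contDiff_fst.contMDiff.contMDiffAt
  have hs : ContMDiffAt 𝓘(ℝ, E × E) 𝓘(ℝ, E) ∞ (fun p : E × E => φ.symm p.2) (φ 1, φ 1) :=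
    ContMDiffAt.comp (I' := 𝓘(ℝ, E)) (φ 1, φ 1) h1 contDiff_snd.contMDiff.contMDiffAt
  have hmul := hf.mul hs
  have h2 : ContMDiffAt 𝓘(ℝ, E) 𝓘(ℝ, E) ∞ φ (1 : G) := contMDiffAt_extChartAt
  refine (ContMDiffAt.comp_of_eq (I' := 𝓘(ℝ, E)) h2 hmul ?_).contDiffAt
  have h3 : φ.symm (φ 1) = 1 := extChartAt_to_inv (1 : G)
  simp [h3]

lemma dChart_eq_fderiv {g : G} {f : G → G} (hf : MDifferentiableAt 𝓘(ℝ, E) 𝓘(ℝ, E) f 1)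
    (hg : f 1 = g) (hgs : g ∈ (extChartAt 𝓘(ℝ, E) (1 : G)).source)
    (hd : DifferentiableAt ℝ (fun r => extChartAt 𝓘(ℝ, E) (1 : G)
      (f ((extChartAt 𝓘(ℝ, E) (1 : G)).symm r))) (extChartAt 𝓘(ℝ, E) (1 : G) 1))
    (v : TangentSpace 𝓘(ℝ, E) (1 : G)) :
    dChart 1 g (mfderiv 𝓘(ℝ, E) 𝓘(ℝ, E) f 1 v) =
      fderiv ℝ (fun r => extChartAt 𝓘(ℝ, E) (1 : G) (f ((extChartAt 𝓘(ℝ, E) (1 : G)).symm r)))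
        (extChartAt 𝓘(ℝ, E) (1 : G) 1) (dChart 1 1 v) := by
  subst hg
  refine Eq.trans ?_
    (mvfderiv_eq_fderiv_inChart_self (F := fun y => extChartAt 𝓘(ℝ, E) (1 : G) (f y)) hd v)
  have h1 := (mdifferentiableAt_extChartAt (I := 𝓘(ℝ, E)) (by simpa using hgs)).hasMFDerivAt
  have := (HasMFDerivAt.comp (1 : G) h1 hf.hasMFDerivAt).mfderiv
  exact (DFunLike.congr_fun this v).symm

lemma hasFDerivAt_mulInChart_right {q : E}
    (hq : ContDiffAt ℝ 1 (mulInChart (E := E) G) (q, extChartAt 𝓘(ℝ, E) (1 : G) 1)) :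
    HasFDerivAt (fun r => mulInChart G (q, r))
      ((fderiv ℝ (mulInChart G) (q, extChartAt 𝓘(ℝ, E) (1 : G) 1)).comp
        (ContinuousLinearMap.inr ℝ E E)) (extChartAt 𝓘(ℝ, E) (1 : G) 1) :=
  HasFDerivAt.comp _ (hq.differentiableAt one_ne_zero).hasFDerivAt (hasFDerivAt_prodMk_right q _)

lemma hasFDerivAt_mulInChart_left {q : E}
    (hq : ContDiffAt ℝ 1 (mulInChart (E := E) G) (extChartAt 𝓘(ℝ, E) (1 : G) 1, q)) :
    HasFDerivAt (fun r => mulInChart G (r, q))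
      ((fderiv ℝ (mulInChart G) (extChartAt 𝓘(ℝ, E) (1 : G) 1, q)).comp
        (ContinuousLinearMap.inl ℝ E E)) (extChartAt 𝓘(ℝ, E) (1 : G) 1) :=
  HasFDerivAt.comp (f := fun r => (r, q)) _ (hq.differentiableAt one_ne_zero).hasFDerivAt
    (hasFDerivAt_prodMk_left _ q)

lemma fieldInChart_dLeft (v : TangentSpace 𝓘(ℝ, E) (1 : G)) :
    ∀ᶠ q in nhds (extChartAt 𝓘(ℝ, E) (1 : G) 1),
      fieldInChart 1 (fun g : G => dLeft g v) q =
        fderiv ℝ (mulInChart G) (q, extChartAt 𝓘(ℝ, E) (1 : G) 1) (0, dChart (1 : G) 1 v) := by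
  have hc : Filter.Tendsto (fun q : E => (q, extChartAt 𝓘(ℝ, E) (1 : G) 1))
      (nhds (extChartAt 𝓘(ℝ, E) (1 : G) 1))
      (nhds (extChartAt 𝓘(ℝ, E) (1 : G) 1, extChartAt 𝓘(ℝ, E) (1 : G) 1)) :=
    (Continuous.prodMk_left _).tendsto _
  have h1 := ((contDiffAt_mulInChart (E := E) (G := G)).of_le (le_infty 1)).eventually (by simp)
  filter_upwards [eventually_extChartAt_symm_target (E := E) (1 : G), hc.eventually h1] with q hq hq'
  rw [fieldInChart_apply _ _ hq]
  have h2 := hasFDerivAt_mulInChart_right hq'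
  exact (dChart_eq_fderiv (mdifferentiableAt_mul_left _ 1) (mul_one _)
    ((extChartAt 𝓘(ℝ, E) (1 : G)).map_target hq) h2.differentiableAt v).trans
      (DFunLike.congr_fun h2.fderiv _)

lemma fieldInChart_dRight (v : TangentSpace 𝓘(ℝ, E) (1 : G)) :
    ∀ᶠ q in nhds (extChartAt 𝓘(ℝ, E) (1 : G) 1),
      fieldInChart 1 (fun g : G => dRight g v) q =
        fderiv ℝ (mulInChart G) (extChartAt 𝓘(ℝ, E) (1 : G) 1, q) (dChart (1 : G) 1 v, 0) := by
  have hc : Filter.Tendsto (fun q : E => (extChartAt 𝓘(ℝ, E) (1 : G) 1, q))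
      (nhds (extChartAt 𝓘(ℝ, E) (1 : G) 1))
      (nhds (extChartAt 𝓘(ℝ, E) (1 : G) 1, extChartAt 𝓘(ℝ, E) (1 : G) 1)) :=
    (Continuous.prodMk_right _).tendsto _
  have h1 := ((contDiffAt_mulInChart (E := E) (G := G)).of_le (le_infty 1)).eventually (by simp)
  filter_upwards [eventually_extChartAt_symm_target (E := E) (1 : G), hc.eventually h1] with q hq hq'
  rw [fieldInChart_apply _ _ hq]
  have h2 := hasFDerivAt_mulInChart_left hq'
  exact (dChart_eq_fderiv (mdifferentiableAt_mul_right _ 1) (one_mul _)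
    ((extChartAt 𝓘(ℝ, E) (1 : G)).map_target hq) h2.differentiableAt v).trans
      (DFunLike.congr_fun h2.fderiv _)

lemma dLeft_one (v : TangentSpace 𝓘(ℝ, E) (1 : G)) : dLeft (1 : G) v = v := by
  have : (fun h : G => 1 * h) = id := by ext; simp
  unfold dLeft
  rw [this]
  exact DFunLike.congr_fun (mfderiv_id (I := 𝓘(ℝ, E)) (x := (1 : G))) v

lemma dRight_one (v : TangentSpace 𝓘(ℝ, E) (1 : G)) : dRight (1 : G) v = v := by
  have : (fun h : G => h * 1) = id := by ext; simp
  unfold dRight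
  rw [this]
  exact DFunLike.congr_fun (mfderiv_id (I := 𝓘(ℝ, E)) (x := (1 : G))) v

variable [FiniteDimensional ℝ E]

lemma dChart_injective (x : G) : Function.Injective (dChart (E := E) x x) :=
  ((isInvertible_mfderiv_extChartAt (mem_extChartAt_source x)).injective)

/-- Left- and right-invariant vector fields commute. -/
lemma mlieBracket_dLeft_dRight (v w : TangentSpace 𝓘(ℝ, E) (1 : G)) :
    mlieBracket 𝓘(ℝ, E) (fun g : G => dLeft g v) (fun g => dRight g w) 1 = 0 := by
  apply dChart_injective (1 : G)
  rw [dChart_mlieBracket]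
  have h2 : DifferentiableAt ℝ (fderiv ℝ (mulInChart (E := E) G))
      (extChartAt 𝓘(ℝ, E) (1 : G) 1, extChartAt 𝓘(ℝ, E) (1 : G) 1) :=
    (contDiffAt_mulInChart.fderiv_right (m := 1) (le_infty 2)).differentiableAt one_ne_zero
  have hl := ((h2.hasFDerivAt.comp (f := fun q => (q, extChartAt 𝓘(ℝ, E) (1 : G) 1)) _
    (hasFDerivAt_prodMk_left _ _)).clm_apply
      (hasFDerivAt_const ((0 : E), dChart (1 : G) 1 v) _)).congr_of_eventuallyEq
        (fieldInChart_dLeft v)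
  have hr := ((h2.hasFDerivAt.comp (f := fun q => (extChartAt 𝓘(ℝ, E) (1 : G) 1, q)) _
    (hasFDerivAt_prodMk_right _ _)).clm_apply
      (hasFDerivAt_const (dChart (1 : G) 1 w, (0 : E)) _)).congr_of_eventuallyEq
        (fieldInChart_dRight w)
  -- Both terms of the bracket are the mixed second derivative of the multiplication at the
  -- identity, on v in the second factor and w in the first, taken in opposite orders.
  have hsymm := (contDiffAt_mulInChart (E := E) (G := G)).isSymmSndFDerivAt
    (by simpa using le_infty 2)
  rw [hl.fderiv, hr.fderiv, dLeft_one, dRight_one]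
  have h0 : dChart (1 : G) 1 (0 : TangentSpace 𝓘(ℝ, E) (1 : G)) = 0 := map_zero _
  rw [h0]
  simp
  exact sub_eq_zero.2 (hsymm.eq _ _)

end RightInvariant

/-! ### Kernel vectors of the Dirac structure -/

section GraphLinear

variable {V : Type*} [AddCommGroup V] [Module ℂ V]
  {U : Submodule ℂ (Module.Dual ℂ V)} {π : U →ₗ[ℂ] U →ₗ[ℂ] ℂ}

lemma vector_mem_graphL {X : V} :
    (X, (0 : Module.Dual ℂ V)) ∈ graphL U π ↔ X ∈ U.dualCoannihilator := by
  rw [Submodule.mem_dualCoannihilator]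
  constructor
  · rintro ⟨h, h'⟩ η hη
    rw [show η X = _ from h' ⟨η, hη⟩]
    have : (⟨0, h⟩ : U) = 0 := rfl
    rw [this, map_zero, LinearMap.zero_apply]
  · intro h
    refine ⟨U.zero_mem, fun η => ?_⟩
    have : (⟨0, U.zero_mem⟩ : U) = 0 := rfl
    rw [this, map_zero, LinearMap.zero_apply]
    exact h η η.2

end GraphLinear

/-! ### Translation invariance of Ann(U); 𝔨 is an ideal -/

section Invariance

open VectorField

variable {E : Type*} [NormedAddCommGroup E] [NormedSpace ℝ E]
  {G : Type*} [TopologicalSpace G] [ChartedSpace E G] [Group G] [LieGroup 𝓘(ℝ, E) ∞ G]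
  {U : Π x : G, Submodule ℂ (CTDual E x)} {β : Π x : G, U x →ₗ[ℂ] U x →ₗ[ℂ] ℂ}

/-- The first Dirac-map condition, read through D ∩ T = Ann(U). Setting one of the two vectors to
zero yields invariance under left or right translations. -/
lemma dmul_mem_dualCoannihilator (hD : IsAlmostDiracGroup (diracL U β)) {g h : G}
    {X : CT E g} {Y : CT E h} (hX : X ∈ (U g).dualCoannihilator)
    (hY : Y ∈ (U h).dualCoannihilator) : dmul g h (X, Y) ∈ (U (g * h)).dualCoannihilator := by
  rw [← vector_mem_graphL (π := β (g * h))]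
  refine (hD.2 g h).1 (X, Y) ⟨?_, ?_⟩
  · exact (vector_mem_graphL (π := β g)).2 hX
  · exact (vector_mem_graphL (π := β h)).2 hY

/-- The separate target y with g * h = y allows use at x * 1 = x and x⁻¹ * x = 1, where the tangent
spaces are only propositionally the same; this is also why f is compared with the derivative inside
E. -/
lemma baseChange_mul_left_mem (hD : IsAlmostDiracGroup (diracL U β)) {g h y : G} (hy : g * h = y)
    (f : TangentSpace 𝓘(ℝ, E) h →L[ℝ] TangentSpace 𝓘(ℝ, E) y)
    (hf : ∀ v, (show E from f v) = mfderiv 𝓘(ℝ, E) 𝓘(ℝ, E) (fun x : G => g * x) h v)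
    {Y : CT E h} (hY : Y ∈ (U h).dualCoannihilator) :
    LinearMap.baseChange ℂ f.toLinearMap Y ∈ (U y).dualCoannihilator := by
  subst hy
  have h1 := dmul_mem_dualCoannihilator hD (Submodule.zero_mem (U g).dualCoannihilator) hY
  have h2 : (dmulReal g h).toLinearMap ∘ₗ LinearMap.inr ℝ _ _ = f.toLinearMap :=
    LinearMap.ext fun v => (mfderiv_mul_inr g h v).trans (hf v).symm
  simpa [dmul, h2] using h1

lemma baseChange_mul_right_mem (hD : IsAlmostDiracGroup (diracL U β)) {g h y : G} (hy : g * h = y)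
    (f : TangentSpace 𝓘(ℝ, E) g →L[ℝ] TangentSpace 𝓘(ℝ, E) y)
    (hf : ∀ v, (show E from f v) = mfderiv 𝓘(ℝ, E) 𝓘(ℝ, E) (fun x : G => x * h) g v)
    {X : CT E g} (hX : X ∈ (U g).dualCoannihilator) :
    LinearMap.baseChange ℂ f.toLinearMap X ∈ (U y).dualCoannihilator := by
  subst hy
  have h1 := dmul_mem_dualCoannihilator hD hX (Submodule.zero_mem (U h).dualCoannihilator)
  have h2 : (dmulReal g h).toLinearMap ∘ₗ LinearMap.inl ℝ _ _ = f.toLinearMap :=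
    LinearMap.ext fun v => (mfderiv_mul_inl g h v).trans (hf v).symm
  simpa [dmul, h2] using h1

lemma leftT_mem (hD : IsAlmostDiracGroup (diracL U β)) (x : G) {k : CT E (1 : G)}
    (hk : k ∈ annK U) : leftT x k ∈ (U x).dualCoannihilator :=
  baseChange_mul_left_mem hD (mul_one x) (dLeft x) (fun _ => rfl) hk

lemma leftTInv_mem (hD : IsAlmostDiracGroup (diracL U β)) (x : G) {X : CT E x}
    (hX : X ∈ (U x).dualCoannihilator) : leftTInv x X ∈ annK U :=
  baseChange_mul_left_mem hD (inv_mul_cancel x) (dLeftInv x) (fun _ => rfl) hX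

/-- The right-invariant complex vector field with value `z` at `1`. -/
def rightField (z : CT E (1 : G)) (g : G) : CT E g := LinearMap.baseChange ℂ (dRight g).toLinearMap z

lemma rightField_mem (hD : IsAlmostDiracGroup (diracL U β)) (x : G) {k : CT E (1 : G)}
    (hk : k ∈ annK U) : rightField k x ∈ (U x).dualCoannihilator :=
  baseChange_mul_right_mem hD (one_mul x) (dRight x) (fun _ => rfl) hk

lemma rightField_mkT (A B : TangentSpace 𝓘(ℝ, E) (1 : G)) (x : G) :
    rightField (mkT A B) x = mkT (dRight x A) (dRight x B) := by
  rw [mkT_eq, mkT_eq, rightField, map_add, map_smul]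
  simp

lemma reT_rightField (z : CT E (1 : G)) (x : G) : reT (rightField z x) = dRight x (reT z) := by
  conv_lhs => rw [← mkT_reT_imT z, rightField_mkT, reT_mkT]

lemma imT_rightField (z : CT E (1 : G)) (x : G) : imT (rightField z x) = dRight x (imT z) := by
  conv_lhs => rw [← mkT_reT_imT z, rightField_mkT, imT_mkT]

lemma rightField_one (z : CT E (1 : G)) : rightField z 1 = z := by
  conv_lhs => rw [← mkT_reT_imT z, rightField_mkT, dRight_one, dRight_one, mkT_reT_imT]

variable [FiniteDimensional ℝ E]

lemma leftField_one (z : CT E (1 : G)) : leftField z 1 = z := by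
  conv_lhs => rw [← mkT_reT_imT z, leftField, leftT_mkT, dLeft_one, dLeft_one, mkT_reT_imT]

lemma leftTInv_one (z : CT E (1 : G)) : leftTInv 1 z = z := by
  conv_lhs => rw [← leftField_one z, leftField, leftTInv_leftT]

/-- In finite dimension U_x is the annihilator of Ann(U_x), so left invariance of the annihilators
passes to U itself. -/
lemma mem_iff_comp_leftT (hD : IsAlmostDiracGroup (diracL U β)) {x : G} {ξ : CTDual E x} :
    ξ ∈ U x ↔ ξ ∘ₗ leftT x ∈ U 1 := by
  have : ∀ y : G, (U y).dualCoannihilator.dualAnnihilator = U y := fun y => by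
    have : FiniteDimensional ℝ (TangentSpace 𝓘(ℝ, E) y) := inferInstanceAs (FiniteDimensional ℝ E)
    exact Subspace.dualCoannihilator_dualAnnihilator_eq
  rw [← this x, ← this 1, Submodule.mem_dualAnnihilator, Submodule.mem_dualAnnihilator]
  constructor
  · intro h k hk
    exact h _ (leftT_mem hD x hk)
  · intro h X hX
    have := h _ (leftTInv_mem hD x hX)
    simpa using this

lemma leftForm_mem_iff (hD : IsAlmostDiracGroup (diracL U β)) {x : G} {ξ : CTDual E (1 : G)} :
    leftForm ξ x ∈ U x ↔ ξ ∈ U 1 := by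
  rw [mem_iff_comp_leftT hD]
  have : leftForm ξ x ∘ₗ leftT x = ξ := by
    ext z; simp [leftForm]
  rw [this]

/-- `𝔨` is an ideal of `𝔤_ℂ`. -/
lemma brC_mem_annK (hD : IsAlmostDiracGroup (diracL U β)) (z : CT E (1 : G)) {k : CT E (1 : G)}
    (hk : k ∈ annK U) : brC z k ∈ annK U := by
  rw [annK, Submodule.mem_dualCoannihilator]
  intro ζ hζ
  have hR : FieldDiffAt (rightField k) (1 : G) := by
    refine ⟨?_, ?_⟩
    · simp only [reT_rightField]
      exact (contMDiff_dRight (reT k) 1).mdifferentiableAt (by simp)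
    · simp only [imT_rightField]
      exact (contMDiff_dRight (imT k) 1).mdifferentiableAt (by simp)
  -- The left-invariant field of z and the right-invariant field of k have zero bracket at 1. The
  -- right-invariant field stays in Ann(U), so its ζ-coordinate vanishes identically, while that of
  -- the left-invariant field is constant. The bracket formula leaves only ζ([z, k]) = 0.
  have h := apply_leftTInv_cbracket ζ (fieldDiffAt_leftField z 1) hR
  have h0 : cbracket (leftField z) (rightField k) (1 : G) = 0 := by
    simp only [cbracket, leftField, reT_leftT, imT_leftT, reT_rightField, imT_rightField,
      mlieBracket_dLeft_dRight]
    simp [mkT]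
  have h1 : (fun y => ζ (leftTInv y (rightField k y))) = fun _ => 0 := by
    ext y
    exact (Submodule.mem_dualCoannihilator _).1 (leftTInv_mem hD y (rightField_mem hD y hk)) ζ hζ
  rw [h0, h1, cderiv_const] at h
  simp only [leftField, leftTInv_leftT, cderiv_const, map_zero, LinearMap.zero_apply, sub_zero,
    zero_add] at h
  rw [rightField_one, leftTInv_one] at h
  exact h.symm

end Invariance

/-! ### Dual families for spaces of covectors -/

section FiniteDimension

variable {E : Type*} [NormedAddCommGroup E] [NormedSpace ℝ E] [FiniteDimensional ℝ E]
  {G : Type*} [TopologicalSpace G] [ChartedSpace E G]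

instance finiteDimensional_tangentSpace (x : G) : FiniteDimensional ℝ (TangentSpace 𝓘(ℝ, E) x) :=
  inferInstanceAs (FiniteDimensional ℝ E)

/-- Functionals on a space of covectors are evaluations at vectors. -/
lemma exists_eq_eval {x : G} (U : Submodule ℂ (CTDual E x)) (f : U →ₗ[ℂ] ℂ) :
    ∃ z : CT E x, ∀ ξ : U, f ξ = (ξ : CTDual E x) z := by
  obtain ⟨g, hg⟩ := LinearMap.exists_extend f
  obtain ⟨z, hz⟩ := (Module.evalEquiv ℂ (CT E x)).surjective g
  refine ⟨z, fun ξ => ?_⟩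
  rw [← hg, ← hz]
  rfl

/-- A basis of a space of covectors, with a dual family of vectors. -/
lemma exists_dual_family {x : G} (U : Submodule ℂ (CTDual E x)) :
    ∃ (r : ℕ) (u : Fin r → CTDual E x) (w : Fin r → CT E x), (∀ a, u a ∈ U) ∧
      (∀ a b, u a (w b) = if a = b then 1 else 0) ∧
      ∀ ξ ∈ U, ξ = ∑ a, ξ (w a) • u a := by
  have b := Module.finBasis ℂ U
  choose w hw using fun a => exists_eq_eval U (b.coord a)
  refine ⟨_, fun a => b a, w, fun a => (b a).2, fun a c => ?_, fun ξ hξ => ?_⟩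
  · rw [← hw c (b a), Module.Basis.coord_apply, b.repr_self, Finsupp.single_apply]
  · have h := congrArg Subtype.val (b.sum_repr ⟨ξ, hξ⟩)
    rw [Submodule.coe_sum] at h
    refine h.symm.trans (Finset.sum_congr rfl fun a _ => ?_)
    have := hw a ⟨ξ, hξ⟩
    rw [Module.Basis.coord_apply] at this
    rw [Submodule.coe_smul, this]

end FiniteDimension

/-! ### Evaluating β on covectors -/

section Eval

variable {E : Type*} [NormedAddCommGroup E] [NormedSpace ℝ E]
  {G : Type*} [TopologicalSpace G] [ChartedSpace E G] [IsManifold 𝓘(ℝ, E) ∞ G]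
  {U : Π x : G, Submodule ℂ (CTDual E x)} {β : Π x : G, U x →ₗ[ℂ] U x →ₗ[ℂ] ℂ} {x : G}

lemma evalβ_eq {ξ η : CTDual E x} (hξ : ξ ∈ U x) (hη : η ∈ U x) :
    evalβ U β x ξ η = β x ⟨ξ, hξ⟩ ⟨η, hη⟩ := dif_pos ⟨hξ, hη⟩

lemma evalβ_add_left {ξ ξ' η : CTDual E x} (hξ : ξ ∈ U x) (hξ' : ξ' ∈ U x) (hη : η ∈ U x) :
    evalβ U β x (ξ + ξ') η = evalβ U β x ξ η + evalβ U β x ξ' η := by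
  rw [evalβ_eq hξ hη, evalβ_eq hξ' hη, evalβ_eq ((U x).add_mem hξ hξ') hη, ← LinearMap.add_apply,
    ← map_add]
  rfl

lemma evalβ_smul_left (c : ℂ) {ξ η : CTDual E x} (hξ : ξ ∈ U x) (hη : η ∈ U x) :
    evalβ U β x (c • ξ) η = c * evalβ U β x ξ η := by
  rw [evalβ_eq hξ hη, evalβ_eq ((U x).smul_mem c hξ) hη, ← smul_eq_mul, ← LinearMap.smul_apply,
    ← map_smul]
  rfl

/-- The identity extends to all covectors because the condition under which the default value 0 is
used is symmetric in ξ and η. -/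
lemma evalβ_swap (hβ : ∀ x, (β x).IsAlt) (ξ η : CTDual E x) :
    evalβ U β x ξ η = - evalβ U β x η ξ := by
  by_cases h : ξ ∈ U x ∧ η ∈ U x
  · rw [evalβ_eq h.1 h.2, evalβ_eq h.2 h.1, (hβ x).neg]
  · rw [evalβ, evalβ, dif_neg h, dif_neg (fun h' => h ⟨h'.2, h'.1⟩), neg_zero]

lemma evalβ_zero_left (η : CTDual E x) : evalβ U β x 0 η = 0 := by
  by_cases h : η ∈ U x
  · have := evalβ_smul_left (U := U) (β := β) 0 (U x).zero_mem h
    simpa using this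
  · exact dif_neg fun h' => h h'.2

lemma evalβ_sum_left {ι : Type*} (s : Finset ι) (c : ι → ℂ) {ξ : ι → CTDual E x}
    (hξ : ∀ i, ξ i ∈ U x) {η : CTDual E x} (hη : η ∈ U x) :
    evalβ U β x (∑ i ∈ s, c i • ξ i) η = ∑ i ∈ s, c i * evalβ U β x (ξ i) η := by
  classical
  induction s using Finset.induction_on with
  | empty => simpa using evalβ_zero_left η
  | insert a s ha ih =>
    rw [Finset.sum_insert ha, Finset.sum_insert ha, evalβ_add_left ((U x).smul_mem _ (hξ a))
      ((U x).sum_mem fun i _ => (U x).smul_mem _ (hξ i)) hη, ih, evalβ_smul_left _ (hξ a) hη]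

lemma mem_diracL_iff {p : GenT E x} : p ∈ diracL U β x ↔
    p.2 ∈ U x ∧ ∀ η ∈ U x, η p.1 = evalβ U β x p.2 η := by
  constructor
  · rintro ⟨h, h'⟩
    exact ⟨h, fun η hη => (h' ⟨η, hη⟩).trans (evalβ_eq h hη).symm⟩
  · rintro ⟨h, h'⟩
    exact ⟨h, fun η => (h' η η.2).trans (evalβ_eq h η.2)⟩

lemma exists_mem_diracL [FiniteDimensional ℝ E] {ξ : CTDual E x} (hξ : ξ ∈ U x) :
    ∃ X : CT E x, (X, ξ) ∈ diracL U β x := by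
  obtain ⟨z, hz⟩ := exists_eq_eval (U x) (β x ⟨ξ, hξ⟩)
  exact ⟨z, hξ, fun η => (hz η).symm⟩

end Eval

/-! ### Linear systems with smooth coefficients -/

section SmoothMatrices

variable {E : Type*} [NormedAddCommGroup E] [NormedSpace ℝ E]
  {G : Type*} [TopologicalSpace G] [ChartedSpace E G] {V : Set G}

lemma SmoothFun.prod {ι : Type*} {s : Finset ι} {F : ι → G → ℂ}
    (hF : ∀ i ∈ s, SmoothFun E V (F i)) : SmoothFun E V (fun y => ∏ i ∈ s, F i y) := by
  classical
  induction s using Finset.induction_on with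
  | empty => simpa using smoothFun_const 1
  | insert a s ha ih =>
    simp only [Finset.mem_insert, forall_eq_or_imp] at hF
    simp only [Finset.prod_insert ha]
    exact hF.1.mul (ih hF.2)

lemma SmoothFun.det {r : ℕ} {Q : G → Matrix (Fin r) (Fin r) ℂ}
    (hQ : ∀ a b, SmoothFun E V (fun y => Q y a b)) : SmoothFun E V (fun y => (Q y).det) := by
  simp only [Matrix.det_apply]
  refine SmoothFun.sum fun σ _ => ?_
  have h := (SmoothFun.prod (s := Finset.univ) fun i _ => hQ (σ i) i).const_mul
    ((Equiv.Perm.sign σ : ℤ) : ℂ)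
  refine h.congr fun y _ => ?_
  rw [Units.smul_def, zsmul_eq_mul]

/-- Solutions of smooth regular linear systems are smooth. -/
lemma contMDiffAt_of_mulVec {r : ℕ} (hV : IsOpen V) {x₀ : G} (hx₀ : x₀ ∈ V)
    {Q : G → Matrix (Fin r) (Fin r) ℂ} {h b : G → Fin r → ℂ}
    (hQ : ∀ a c, SmoothFun E V (fun y => Q y a c)) (hh : ∀ a, SmoothFun E V (fun y => h y a))
    (hb : ∀ y ∈ V, h y = (Q y).mulVec (b y)) (hdet : (Q x₀).det ≠ 0) (a : Fin r) :
    ContMDiffAt 𝓘(ℝ, E) 𝓘(ℝ, ℂ) ∞ (fun y => b y a) x₀ := by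
  -- Cramer's rule: each entry of b is a quotient of determinants in Q and h near x₀, so b inherits
  -- smoothness that is not assumed of it.
  have hd : ContMDiffAt 𝓘(ℝ, E) 𝓘(ℝ, ℂ) ∞ (fun y => (Q y).det) x₀ :=
    (SmoothFun.det hQ).contMDiffAt hV hx₀
  have hi : ContMDiffAt 𝓘(ℝ, E) 𝓘(ℝ, ℂ) ∞ (fun y => ((Q y).det)⁻¹) x₀ :=
    ContMDiffAt.comp (I' := 𝓘(ℝ, ℂ)) x₀ (contDiffAt_inv ℝ hdet).contMDiffAt hd
  have hc : ContMDiffAt 𝓘(ℝ, E) 𝓘(ℝ, ℂ) ∞ (fun y => ((Q y).updateCol a (h y)).det) x₀ := by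
    refine SmoothFun.contMDiffAt (V := V) hV (SmoothFun.det fun c d => ?_) hx₀
    simp only [Matrix.updateCol_apply]
    split_ifs
    · exact hh c
    · exact hQ c d
  have hm : ContMDiffAt 𝓘(ℝ, E) 𝓘(ℝ, ℂ) ∞
      (fun y => ((Q y).det)⁻¹ * ((Q y).updateCol a (h y)).det) x₀ := by
    have h' : ContDiff ℝ ∞ (fun p : ℂ × ℂ => p.1 * p.2) := contDiff_fst.mul contDiff_snd
    exact h'.contMDiff.contMDiffAt.comp x₀ (hi.prodMk_space hc)
  refine hm.congr_of_eventuallyEq ?_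
  filter_upwards [hV.mem_nhds hx₀, hd.continuousAt.eventually_ne hdet] with y hy hy'
  have h1 : (Q y).cramer (h y) = (Q y).det • b y := by
    rw [hb y hy, Matrix.cramer_eq_adjugate_mulVec, Matrix.mulVec_mulVec, Matrix.adjugate_mul,
      Matrix.smul_mulVec, Matrix.one_mulVec]
  have h2 := congrFun h1 a
  rw [Matrix.cramer_apply] at h2
  rw [h2, Pi.smul_apply, smul_eq_mul, inv_mul_cancel_left₀ hy']

end SmoothMatrices

/-! ### Smooth forms and fields in the left trivialisation -/

section SmoothForms

variable {E : Type*} [NormedAddCommGroup E] [NormedSpace ℝ E]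
  {G : Type*} [TopologicalSpace G] [ChartedSpace E G] {V : Set G}

lemma SmoothForm.apply [IsManifold 𝓘(ℝ, E) ∞ G] (hV : IsOpen V) {ξ : Π x : G, CTDual E x}
    (hξ : SmoothForm V ξ)
    {X : Π x : G, CT E x} (hX : SmoothField V X) : SmoothFun E V (fun y => ξ y (X y)) := by
  have h := (hξ V subset_rfl hV _ hX.1).add
    ((hξ V subset_rfl hV _ hX.2).const_mul Complex.I)
  refine h.congr fun y _ => ?_
  conv_lhs => rw [← mkT_reT_imT (X y), apply_mkT]

variable [Group G] [LieGroup 𝓘(ℝ, E) ∞ G] [FiniteDimensional ℝ E]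

lemma SmoothField.comp_leftTInv {X : Π x : G, CT E x} (hX : SmoothField V X)
    (ζ : CTDual E (1 : G)) : SmoothFun E V (fun y => ζ (leftTInv y (X y))) := by
  simp only [apply_leftTInv]
  exact (hX.1.smoothFun_comp_dLeftInv _).add ((hX.2.smoothFun_comp_dLeftInv _).const_mul _)

end SmoothForms

/-! ### Smoothness of β -/

section SmoothBeta

variable {E : Type*} [NormedAddCommGroup E] [NormedSpace ℝ E]
  {G : Type*} [TopologicalSpace G] [ChartedSpace E G] [Group G] [LieGroup 𝓘(ℝ, E) ∞ G]
  (U : Π x : G, Submodule ℂ (CTDual E x)) (β : Π x : G, U x →ₗ[ℂ] U x →ₗ[ℂ] ℂ)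

/-- The form `β`, in the left trivialisation. -/
def leftβ (ξ η : CTDual E (1 : G)) (x : G) : ℂ := evalβ U β x (leftForm ξ x) (leftForm η x)

variable {U β} [FiniteDimensional ℝ E]

lemma leftForm_comp_leftT {x : G} (ξ : CTDual E x) : leftForm (ξ ∘ₗ leftT x) x = ξ := by
  ext z
  simp [leftForm]

lemma leftForm_sum {ι : Type*} (s : Finset ι) (ξ : ι → CTDual E (1 : G)) (c : ι → ℂ) (x : G) :
    leftForm (∑ i ∈ s, c i • ξ i) x = ∑ i ∈ s, c i • leftForm (ξ i) x := by
  refine LinearMap.ext fun z => ?_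
  simp [leftForm, LinearMap.sum_apply]

/-- The form `β` is smooth. -/
lemma smoothFun_leftβ (hD : IsAlmostDiracGroup (diracL U β)) {ξ η : CTDual E (1 : G)}
    (hξ : ξ ∈ U 1) (hη : η ∈ U 1) {V : Set G} : SmoothFun E V (leftβ U β ξ η) := by
  suffices h : ContMDiff 𝓘(ℝ, E) 𝓘(ℝ, ℂ) ∞ (leftβ U β ξ η) from h.contMDiffOn
  intro x₀
  obtain ⟨V, hV, hx₀, n, s, hs, hspan⟩ := hD.1.subbundle x₀
  obtain ⟨r, u, w, hu, hδ, hexp⟩ := exists_dual_family (U 1)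
  have hmem : ∀ y ∈ V, ∀ i, s i y ∈ diracL U β y := fun y hy i => by
    rw [← (hspan y hy).2]; exact Submodule.subset_span ⟨i, rfl⟩
  -- Membership of the frame sections in D gives n linear equations for the r unknowns β(u_a, η).
  -- Combining them with constant coefficients that express the covectors u_a through the frame at
  -- x₀ produces a square system whose matrix at x₀ is the identity.
  have hS : ∀ a, ∃ c : Fin n → ℂ, leftForm (u a) x₀ = ∑ i, c i • (s i x₀).2 := fun a => by
    obtain ⟨X, hX⟩ := exists_mem_diracL (β := β) ((leftForm_mem_iff hD (x := x₀)).2 (hu a))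
    rw [← (hspan x₀ hx₀).2, Submodule.mem_span_range_iff_exists_fun] at hX
    obtain ⟨c, hc⟩ := hX
    refine ⟨c, ?_⟩
    have := congrArg Prod.snd hc
    exact this.symm.trans (Prod.snd_sum)
  choose S hS using hS
  have hlin : ∀ y ∈ V, ∀ i, leftForm η y (s i y).1 = ∑ a, (s i y).2 (leftField (w a) y) * leftβ U β (u a) η y := by
    intro y hy i
    obtain ⟨h1, h2⟩ := mem_diracL_iff.1 (hmem y hy i)
    have h3 := hexp _ ((mem_iff_comp_leftT hD).1 h1)
    have h4 : (s i y).2 = ∑ a, (s i y).2 (leftField (w a) y) • leftForm (u a) y := by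
      conv_lhs => rw [← leftForm_comp_leftT (s i y).2, h3, leftForm_sum]
      rfl
    rw [h2 _ ((leftForm_mem_iff hD).2 hη), h4, evalβ_sum_left _ _
      (fun a => (leftForm_mem_iff hD).2 (hu a)) ((leftForm_mem_iff hD).2 hη), ← h4]
    rfl
  have hQs : ∀ i z, SmoothFun E V (fun y => (s i y).2 (leftField z y)) := fun i z =>
    (hs i).2.apply hV (smoothField_leftField z)
  have key : ∀ a, ContMDiffAt 𝓘(ℝ, E) 𝓘(ℝ, ℂ) ∞ (leftβ U β (u a) η) x₀ := by
    refine contMDiffAt_of_mulVec hV hx₀ (b := fun y a => leftβ U β (u a) η y)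
      (Q := fun y => Matrix.of fun a c => ∑ i, S a i * (s i y).2 (leftField (w c) y))
      (h := fun y a => ∑ i, S a i * leftForm η y (s i y).1) ?_ ?_ ?_ ?_
    · intro a c
      simp only [Matrix.of_apply]
      exact SmoothFun.sum fun i _ => (hQs i (w c)).const_mul _
    · intro a
      exact SmoothFun.sum fun i _ => ((hs i).1.comp_leftTInv η).const_mul _
    · intro y hy
      ext a
      simp only [Matrix.mulVec, dotProduct, Matrix.of_apply]
      simp only [hlin y hy, Finset.sum_mul, Finset.mul_sum]
      rw [Finset.sum_comm]
      simp only [mul_assoc]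
    · have : (Matrix.of fun a c => ∑ i, S a i * (s i x₀).2 (leftField (w c) x₀)) =
          (1 : Matrix (Fin r) (Fin r) ℂ) := by
        ext a c
        have h5 := LinearMap.congr_fun (hS a) (leftField (w c) x₀)
        simp only [LinearMap.sum_apply, LinearMap.smul_apply, smul_eq_mul, leftForm,
          LinearMap.comp_apply, leftField, leftTInv_leftT, hδ] at h5
        rw [Matrix.of_apply, Matrix.one_apply, h5]
        rfl
      rw [this]
      simp
  have hfin : leftβ U β ξ η = fun y => ∑ a, ξ (w a) * leftβ U β (u a) η y := by
    ext y
    have : leftForm ξ y = ∑ a, ξ (w a) • leftForm (u a) y := by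
      conv_lhs => rw [hexp ξ hξ, leftForm_sum]
    rw [leftβ, this, evalβ_sum_left _ _
      (fun a => (leftForm_mem_iff hD).2 (hu a)) ((leftForm_mem_iff hD).2 hη)]
    rfl
  rw [hfin]
  refine ContMDiffAt.sum fun a _ => ?_
  have h' : ContDiff ℝ ∞ (fun p : ℂ => ξ (w a) * p) := contDiff_const.mul contDiff_id
  exact h'.contMDiff.contMDiffAt.comp x₀ (key a)

end SmoothBeta

/-! ### Local sections of ℱ with prescribed differential -/

section LocalFunctions

open VectorField

variable {E : Type*} [NormedAddCommGroup E] [NormedSpace ℝ E] [FiniteDimensional ℝ E]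
  {G : Type*} [TopologicalSpace G] [ChartedSpace E G] [Group G] [LieGroup 𝓘(ℝ, E) ∞ G]

/-- The tangent space at `1`, as a normed space. -/
def tangentOne (G : Type*) [TopologicalSpace G] [ChartedSpace E G] [Group G] :
    TangentSpace 𝓘(ℝ, E) (1 : G) ≃ₗ[ℝ] E := LinearEquiv.refl ℝ E

/-- The left-invariant frame, read in the chart at `1`. -/
def leftFrame (G : Type*) [TopologicalSpace G] [ChartedSpace E G] [Group G] (p : E) : E →L[ℝ] E :=
  ContinuousLinearMap.comp (M₂ := E)
    (mfderiv 𝓘(ℝ, E) 𝓘(ℝ, E) (extChartAt 𝓘(ℝ, E) (1 : G)) ((extChartAt 𝓘(ℝ, E) (1 : G)).symm p))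
    (dLeft ((extChartAt 𝓘(ℝ, E) (1 : G)).symm p))

lemma leftFrame_chart {y : G} (hy : y ∈ (extChartAt 𝓘(ℝ, E) (1 : G)).source)
    (v : TangentSpace 𝓘(ℝ, E) (1 : G)) :
    leftFrame G (extChartAt 𝓘(ℝ, E) (1 : G) y) (tangentOne G v) = dChart 1 y (dLeft y v) := by
  have h := (extChartAt 𝓘(ℝ, E) (1 : G)).left_inv hy
  have : ∀ z : G, z = y → dChart 1 z (dLeft z v) = dChart 1 y (dLeft y v) := by
    rintro z rfl; rfl
  exact this _ h

/-- The tangent space at 1 is the model space read through the preferred chart at 1, so the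
derivative of that chart at 1 is the identity. -/
lemma dChart_self (v : TangentSpace 𝓘(ℝ, E) (1 : G)) : dChart 1 1 v = tangentOne G v := by
  have h := mfderiv_chartAt_eq_tangentCoordChange (I := 𝓘(ℝ, E)) (mem_chart_source E (1 : G))
  have h2 : tangentCoordChange 𝓘(ℝ, E) (1 : G) 1 1 (tangentOne G v) = tangentOne G v :=
    tangentCoordChange_self (mem_extChartAt_source (1 : G))
  exact (DFunLike.congr_fun h v).trans h2

lemma leftFrame_chart_one : leftFrame G (extChartAt 𝓘(ℝ, E) (1 : G) 1) =
    ContinuousLinearMap.id ℝ E := by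
  refine ContinuousLinearMap.ext fun v => ?_
  have h := leftFrame_chart (mem_extChartAt_source (1 : G)) ((tangentOne G).symm v)
  rw [dLeft_one, dChart_self, LinearEquiv.apply_symm_apply] at h
  exact h

/-- The structure equation is the relation between brackets of left-invariant fields and the bracket
of 𝔤, applied as derivations to the chart viewed as an E-valued function. -/
lemma isLieFrame_leftFrame :
    IsLieFrame (extChartAt 𝓘(ℝ, E) (1 : G)).target (leftFrame G)
      (fun v w => tangentOne G (lieBr ((tangentOne G).symm v) ((tangentOne G).symm w))) := by
  set φ := extChartAt 𝓘(ℝ, E) (1 : G) with hφ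
  have hS : IsOpen φ.source := isOpen_extChartAt_source (1 : G)
  have hφs : ContMDiffOn 𝓘(ℝ, E) 𝓘(ℝ, E) ∞ φ φ.source := by
    rw [hφ, extChartAt_source]
    exact contMDiffOn_extChartAt
  have hsm : ContDiffOn ℝ ∞ (leftFrame G) φ.target := by
    rw [contDiffOn_clm_apply]
    intro v
    have h1 := contMDiffOn_mvfderiv_apply hS hφs
      (contMDiff_dLeft (E := E) (G := G) v).contMDiffOn
    exact (h1.comp (contMDiffOn_extChartAt_symm (1 : G)) (fun q hq => φ.map_target hq)).contDiffOn
  refine ⟨isOpen_extChartAt_target (1 : G), hsm, ?_, ?_⟩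
  · intro p hp
    refine ContinuousLinearMap.IsInvertible.comp (M₂ := E)
      (isInvertible_mfderiv_extChartAt (φ.map_target hp)) ?_
    exact ContinuousLinearMap.IsInvertible.of_inverse (g := dLeftInv (φ.symm p))
      (ContinuousLinearMap.ext fun v => dLeft_dLeftInv _ v)
      (ContinuousLinearMap.ext fun v => dLeftInv_dLeft _ v)
  · intro p hp v w
    obtain ⟨y, hy, rfl⟩ : ∃ y ∈ φ.source, φ y = p := ⟨φ.symm p, φ.map_target hp, φ.right_inv hp⟩
    obtain ⟨v, rfl⟩ := (tangentOne G).surjective v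
    obtain ⟨w, rfl⟩ := (tangentOne G).surjective w
    have hLd : DifferentiableAt ℝ (leftFrame G) (φ y) :=
      (hsm.contDiffAt ((isOpen_extChartAt_target (1 : G)).mem_nhds hp)).differentiableAt (by simp)
    have key : ∀ v w : TangentSpace 𝓘(ℝ, E) (1 : G),
        mvfderiv 𝓘(ℝ, E) (fun y => mvfderiv 𝓘(ℝ, E) φ y (dLeft y w)) y (dLeft y v) =
          fderiv ℝ (leftFrame G) (φ y) (leftFrame G (φ y) (tangentOne G v)) (tangentOne G w) := by
      intro v w
      have h1 : (fun y => mvfderiv 𝓘(ℝ, E) φ y (dLeft y w)) =ᶠ[nhds y]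
          fun y => (fun p => leftFrame G p (tangentOne G w)) (φ y) := by
        filter_upwards [hS.mem_nhds hy] with y' hy'
        exact (leftFrame_chart hy' w).symm
      have h2 : mvfderiv 𝓘(ℝ, E) (fun y => mvfderiv 𝓘(ℝ, E) φ y (dLeft y w)) y =
        mvfderiv 𝓘(ℝ, E) (fun y => (fun p => leftFrame G p (tangentOne G w)) (φ y)) y :=
          h1.mfderiv_eq
      have h3 := hLd.hasFDerivAt.clm_apply (hasFDerivAt_const (tangentOne G w) (φ y))
      rw [h2, mvfderiv_comp_extChartAt hy h3.differentiableAt, h3.fderiv, ← leftFrame_chart hy]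
      simp [hφ]
    have h := mvfderiv_mlieBracket (hφs.contMDiffAt (hS.mem_nhds hy))
      (mdifferentiableAt_dLeft v y) (mdifferentiableAt_dLeft w y)
    rw [mlieBracket_dLeft, key, key] at h
    rw [LinearEquiv.symm_apply_apply, LinearEquiv.symm_apply_apply]
    exact h.symm.trans (leftFrame_chart hy _).symm

variable {U : Π x : G, Submodule ℂ (CTDual E x)} {β : Π x : G, U x →ₗ[ℂ] U x →ₗ[ℂ] ℂ}

/-- Complex tangent vectors at `1` as pairs of real ones. -/
def ofPair (G : Type*) [TopologicalSpace G] [ChartedSpace E G] [Group G] :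
    E × E →ₗ[ℝ] CT E (1 : G) :=
  TensorProduct.mk ℝ ℂ (TangentSpace 𝓘(ℝ, E) (1 : G)) 1 ∘ₗ
    (tangentOne G).symm.toLinearMap ∘ₗ LinearMap.fst ℝ E E +
  TensorProduct.mk ℝ ℂ (TangentSpace 𝓘(ℝ, E) (1 : G)) Complex.I ∘ₗ
    (tangentOne G).symm.toLinearMap ∘ₗ LinearMap.snd ℝ E E

lemma ofPair_apply (Y : E × E) :
    ofPair G Y = mkT ((tangentOne G).symm Y.1) ((tangentOne G).symm Y.2) := rfl

lemma ofPair_re_im (z : CT E (1 : G)) :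
    ofPair G (tangentOne G (reT z), tangentOne G (imT z)) = z := by
  rw [ofPair_apply, LinearEquiv.symm_apply_apply, LinearEquiv.symm_apply_apply, mkT_reT_imT]

/-- Sections of `ℱ` near `1` with prescribed differential at `1`. -/
lemma exists_inSheaf_one (hD : IsAlmostDiracGroup (diracL U β)) {ξ : CTDual E (1 : G)}
    (hξ : ξ ∈ U 1) : ∃ (V : Set G) (f : G → ℂ), IsOpen V ∧ (1 : G) ∈ V ∧ InSheaf U V f ∧
      cderiv E f 1 = ξ := by
  set φ := extChartAt 𝓘(ℝ, E) (1 : G) with hφ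
  set e := tangentOne (E := E) G with he
  -- 𝔨 need not be the complexification of a real subspace, so it is encoded as a real space of
  -- pairs (real part, imaginary part).
  set K : Submodule ℝ (E × E) := ((annK U).restrictScalars ℝ).comap (ofPair G) with hK
  have hKmem : ∀ Y : E × E, Y ∈ K ↔ ofPair G Y ∈ annK U := fun Y => Iff.rfl
  set ad : E → E →ₗ[ℝ] E := fun X =>
    e.toLinearMap ∘ₗ (lieBrₗ (G := G)).flip (e.symm X) ∘ₗ e.symm.toLinearMap with had
  obtain ⟨V, log, hV, h1V, hVΩ, hlog, hlog1, hlogK⟩ := (isLieFrame_leftFrame (E := E)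
    (G := G)).exists_log (mem_extChartAt_target (1 : G)) leftFrame_chart_one K
    (fun X => LinearMap.toContinuousLinearMap (LinearMap.prodMap (ad X) (ad X)))
    (fun X Y => rfl) (by
      -- Invariance of K under bracketing with real vectors is the ideal property of 𝔨, split into
      -- real and imaginary parts.
      intro X Y hY
      rw [hKmem, ofPair_apply] at hY ⊢
      have h1 := brC_mem_annK hD ((1 : ℂ) ⊗ₜ[ℝ] e.symm X) hY
      rw [brC_swap, mkT_eq, map_add, map_smul, LinearMap.add_apply, LinearMap.smul_apply,
        brC_tmul, brC_tmul, ← mkT_eq] at h1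
      rw [Submodule.neg_mem_iff] at h1
      exact h1)
  set ℓ : E →L[ℝ] ℂ := LinearMap.toContinuousLinearMap (restrictReal ξ ∘ₗ e.symm.toLinearMap)
    with hℓ
  have hℓa : ∀ q : E, ℓ q = ξ ((1 : ℂ) ⊗ₜ[ℝ] e.symm q) := fun q => rfl
  -- In the left frame the derivative of log maps 𝔨 into 𝔨, and ξ vanishes on 𝔨; hence f is
  -- annihilated by G × 𝔨. As log has derivative the identity at the base point, df there is ξ.
  set f : G → ℂ := fun x => ℓ (log (φ x)) with hf
  have hO : IsOpen (φ.source ∩ φ ⁻¹' V) := isOpen_extChartAt_preimage' (1 : G) hV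
  have hd : ∀ x ∈ φ.source ∩ φ ⁻¹' V, ∀ z : CT E (1 : G), cderiv E f x (leftField z x) =
      ξ (ofPair G (fderiv ℝ log (φ x) (leftFrame G (φ x) (e (reT z))),
        fderiv ℝ log (φ x) (leftFrame G (φ x) (e (imT z))))) := by
    rintro x ⟨hxs, hxV⟩ z
    have hl : DifferentiableAt ℝ log (φ x) :=
      (hlog.contDiffAt (hV.mem_nhds hxV)).differentiableAt (by simp)
    have hc : HasFDerivAt (fun p => ℓ (log p)) (ℓ.comp (fderiv ℝ log (φ x))) (φ x) :=
      ℓ.hasFDerivAt.comp (φ x) hl.hasFDerivAt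
    have h1 : ∀ v, mvfderiv 𝓘(ℝ, E) f x (dLeft x v) =
        ℓ (fderiv ℝ log (φ x) (leftFrame G (φ x) (e v))) := by
      intro v
      have := mvfderiv_comp_extChartAt (W := ℂ) hxs hc.differentiableAt (dLeft x v)
      rw [hc.fderiv, ← leftFrame_chart hxs] at this
      exact this
    conv_lhs => rw [← mkT_reT_imT z, leftField, leftT_mkT, cderiv_mkT, h1, h1]
    rw [ofPair_apply, apply_mkT, hℓa, hℓa]
  refine ⟨φ.source ∩ φ ⁻¹' V, f, hO, ⟨mem_extChartAt_source (1 : G), h1V⟩, ⟨?_, ?_⟩, ?_⟩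
  · have h1 : ContDiffOn ℝ ∞ (fun p => ℓ (log p)) V := ℓ.contDiff.comp_contDiffOn hlog
    have h2 : ContMDiffOn 𝓘(ℝ, E) 𝓘(ℝ, E) ∞ φ (φ.source ∩ φ ⁻¹' V) := by
      refine (contMDiffOn_extChartAt (x := (1 : G)) (n := ∞)).mono fun x hx => ?_
      rw [← extChartAt_source 𝓘(ℝ, E)]
      exact hx.1
    exact h1.contMDiffOn.comp h2 fun x hx => hx.2
  · intro x hx k hk
    rw [hd x hx]
    have : (e (reT k), e (imT k)) ∈ K := by
      rw [hKmem, ofPair_re_im]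
      exact hk
    have h2 := (hKmem _).1 (hlogK _ hx.2 _ this)
    exact (Submodule.mem_dualCoannihilator _).1 h2 ξ hξ
  · refine LinearMap.ext fun z => ?_
    have h1 := hd 1 ⟨mem_extChartAt_source (1 : G), h1V⟩ z
    rw [leftField_one, leftFrame_chart_one, hlog1] at h1
    refine h1.trans (congrArg ξ ?_)
    exact ofPair_re_im z

/-- Left translations carry left-invariant fields to themselves, so sections of ℱ near 1 can be
moved to any point. -/
lemma cderiv_comp_mul_left {f : G → ℂ} (g x : G)
    (hf : MDifferentiableAt 𝓘(ℝ, E) 𝓘(ℝ, ℂ) f (g * x)) (z : CT E (1 : G)) :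
    cderiv E (fun y => f (g * y)) x (leftField z x) =
      cderiv E f (g * x) (leftField z (g * x)) := by
  have h1 : ∀ v : TangentSpace 𝓘(ℝ, E) (1 : G),
      mvfderiv 𝓘(ℝ, E) (fun y => f (g * y)) x (dLeft x v) =
        mvfderiv 𝓘(ℝ, E) f (g * x) (dLeft (g * x) v) := by
    intro v
    have hg := (mdifferentiableAt_mul_left (E := E) g x).hasMFDerivAt
    have h2 := (HasMFDerivAt.comp x hf.hasMFDerivAt hg).mfderiv
    have hx : HasMFDerivAt 𝓘(ℝ, E) 𝓘(ℝ, E) (fun y : G => x * y) 1 (dLeft x) :=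
      (mdifferentiableAt_mul_left x 1).hasMFDerivAt
    have hg' : HasMFDerivAt 𝓘(ℝ, E) 𝓘(ℝ, E) (fun y : G => g * y) (x * 1)
        (mfderiv 𝓘(ℝ, E) 𝓘(ℝ, E) (fun y : G => g * y) x) := by
      rw [mul_one]; exact hg
    have h3 := (HasMFDerivAt.comp (1 : G) hg' hx).mfderiv
    have h4 : (fun y : G => g * y) ∘ (fun y : G => x * y) = fun y => g * x * y := by
      ext y; simp [mul_assoc]
    rw [h4] at h3
    have h5 : dLeft (g * x) v = mfderiv 𝓘(ℝ, E) 𝓘(ℝ, E) (fun y : G => g * y) x (dLeft x v) :=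
      DFunLike.congr_fun h3 v
    rw [h5]
    exact DFunLike.congr_fun h2 (dLeft x v)
  conv_lhs => rw [← mkT_reT_imT z, leftField, leftT_mkT, cderiv_mkT, h1, h1]
  conv_rhs => rw [← mkT_reT_imT z, leftField, leftT_mkT, cderiv_mkT]

/-- Sections of `ℱ` near a point with prescribed differential at that point. -/
lemma exists_inSheaf (hD : IsAlmostDiracGroup (diracL U β)) (x₀ : G) {ξ : CTDual E (1 : G)}
    (hξ : ξ ∈ U 1) : ∃ (V : Set G) (f : G → ℂ), IsOpen V ∧ x₀ ∈ V ∧ InSheaf U V f ∧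
      cderiv E f x₀ = leftForm ξ x₀ := by
  obtain ⟨V, f, hV, h1, hf, hξf⟩ := exists_inSheaf_one hD hξ
  have hm : ContMDiff 𝓘(ℝ, E) 𝓘(ℝ, E) ∞ (fun y : G => x₀⁻¹ * y) := contMDiff_mul_left
  have hd : ∀ x, x₀⁻¹ * x ∈ V → ∀ z, cderiv E (fun y => f (x₀⁻¹ * y)) x (leftField z x) =
      cderiv E f (x₀⁻¹ * x) (leftField z (x₀⁻¹ * x)) := fun x hx z =>
    cderiv_comp_mul_left _ _ (hf.1.mdifferentiableAt hV hx) z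
  refine ⟨(fun y => x₀⁻¹ * y) ⁻¹' V, fun y => f (x₀⁻¹ * y), hV.preimage hm.continuous, ?_,
    ⟨?_, ?_⟩, ?_⟩
  · simpa using h1
  · exact ContMDiffOn.comp hf.1 hm.contMDiffOn fun x hx => hx
  · intro x hx k hk
    rw [hd x hx]
    exact hf.2 _ hx k hk
  · have h2 := hd x₀ (by simpa using h1)
    rw [inv_mul_cancel, hξf] at h2
    refine LinearMap.ext fun z => ?_
    have h3 := h2 (leftTInv x₀ z)
    rw [leftField_one, leftField, leftT_leftTInv] at h3
    exact h3

end LocalFunctions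

/-! ### Calculus of β on varying covectors, and the jacobiator -/

section LeftBeta

variable {E : Type*} [NormedAddCommGroup E] [NormedSpace ℝ E] [FiniteDimensional ℝ E]
  {G : Type*} [TopologicalSpace G] [ChartedSpace E G] [Group G] [LieGroup 𝓘(ℝ, E) ∞ G]
  {U : Π x : G, Submodule ℂ (CTDual E x)} {β : Π x : G, U x →ₗ[ℂ] U x →ₗ[ℂ] ℂ}

lemma mem_iff_forall_annK {ξ : CTDual E (1 : G)} : ξ ∈ U 1 ↔ ∀ k ∈ annK U, ξ k = 0 := by
  have h : (U 1).dualCoannihilator.dualAnnihilator = U 1 :=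
    Subspace.dualCoannihilator_dualAnnihilator_eq
  conv_lhs => rw [← h]
  exact Submodule.mem_dualAnnihilator _

lemma mem_iff_forall_leftField (hD : IsAlmostDiracGroup (diracL U β)) {x : G} {ξ : CTDual E x} :
    ξ ∈ U x ↔ ∀ k ∈ annK U, ξ (leftField k x) = 0 := by
  rw [mem_iff_comp_leftT hD, mem_iff_forall_annK]
  rfl

lemma leftβ_swap (hβ : ∀ x, (β x).IsAlt) (ξ η : CTDual E (1 : G)) (x : G) :
    leftβ U β ξ η x = - leftβ U β η ξ x := evalβ_swap hβ _ _

lemma leftβ_zero_left (η : CTDual E (1 : G)) (x : G) : leftβ U β 0 η x = 0 := by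
  have : leftForm (0 : CTDual E (1 : G)) x = 0 := LinearMap.zero_comp _
  rw [leftβ, this, evalβ_zero_left]

lemma leftβ_sum_left (hD : IsAlmostDiracGroup (diracL U β)) {ι : Type*} (s : Finset ι) (c : ι → ℂ)
    {ξ : ι → CTDual E (1 : G)} (hξ : ∀ i, ξ i ∈ U 1) {η : CTDual E (1 : G)} (hη : η ∈ U 1) (x : G) :
    leftβ U β (∑ i ∈ s, c i • ξ i) η x = ∑ i ∈ s, c i * leftβ U β (ξ i) η x := by
  rw [leftβ, leftForm_sum, evalβ_sum_left _ _ (fun i => (leftForm_mem_iff hD).2 (hξ i))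
    ((leftForm_mem_iff hD).2 hη)]
  rfl

lemma leftβ_sum_right (hβ : ∀ x, (β x).IsAlt) (hD : IsAlmostDiracGroup (diracL U β)) {ι : Type*}
    (s : Finset ι) (c : ι → ℂ) {ξ : ι → CTDual E (1 : G)} (hξ : ∀ i, ξ i ∈ U 1)
    {η : CTDual E (1 : G)} (hη : η ∈ U 1) (x : G) :
    leftβ U β η (∑ i ∈ s, c i • ξ i) x = ∑ i ∈ s, c i * leftβ U β η (ξ i) x := by
  rw [leftβ_swap hβ, leftβ_sum_left hD _ _ hξ hη, ← Finset.sum_neg_distrib]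
  refine Finset.sum_congr rfl fun i _ => ?_
  rw [leftβ_swap hβ η, mul_neg]

/-- `z` represents `ι_ξ β` at `x`, in the left trivialisation. -/
def IsLift (U : Π x : G, Submodule ℂ (CTDual E x)) (β : Π x : G, U x →ₗ[ℂ] U x →ₗ[ℂ] ℂ) (x : G)
    (z : CT E (1 : G)) (ξ : CTDual E (1 : G)) : Prop :=
  ξ ∈ U 1 ∧ ∀ η ∈ U 1, η z = leftβ U β ξ η x

lemma isLift_iff (hD : IsAlmostDiracGroup (diracL U β)) {x : G} {p : GenT E x} :
    IsLift U β x (leftTInv x p.1) (p.2 ∘ₗ leftT x) ↔ p ∈ diracL U β x := by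
  rw [mem_diracL_iff, IsLift, ← mem_iff_comp_leftT hD]
  refine and_congr_right fun _ => ⟨fun h η hη => ?_, fun h η hη => ?_⟩
  · have := h _ ((mem_iff_comp_leftT hD).1 hη)
    rw [leftβ, leftForm_comp_leftT, leftForm_comp_leftT] at this
    simpa using this
  · rw [leftβ, leftForm_comp_leftT, ← h _ ((leftForm_mem_iff hD).2 hη)]
    rfl

lemma isLift_zero {x : G} {k : CT E (1 : G)} (hk : k ∈ annK U) : IsLift U β x k 0 :=
  ⟨(U 1).zero_mem, fun η hη => by rw [leftβ_zero_left, mem_iff_forall_annK.1 hη k hk]⟩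

lemma exists_isLift (hD : IsAlmostDiracGroup (diracL U β)) (x : G) {ξ : CTDual E (1 : G)}
    (hξ : ξ ∈ U 1) : ∃ z, IsLift U β x z ξ := by
  obtain ⟨X, hX⟩ := exists_mem_diracL (β := β) ((leftForm_mem_iff hD (x := x)).2 hξ)
  refine ⟨leftTInv x X, ?_⟩
  have := (isLift_iff hD).2 hX
  have h : leftForm ξ x ∘ₗ leftT x = ξ := by
    ext z; simp [leftForm]
  rwa [h] at this

/-- The derivative of a family of covectors. -/
def dForm (a : G → CTDual E (1 : G)) (x : G) (Z : CT E x) : CTDual E (1 : G) :=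
  (Module.finBasis ℂ (CT E (1 : G))).constr ℂ
    fun i => cderiv E (fun y => a y (Module.finBasis ℂ (CT E (1 : G)) i)) x Z

/-- A family of covectors is differentiable at `x`. -/
def FormDiffAt (a : G → CTDual E (1 : G)) (x : G) : Prop :=
  ∀ z, MDifferentiableAt 𝓘(ℝ, E) 𝓘(ℝ, ℂ) (fun y => a y z) x

lemma dForm_apply {a : G → CTDual E (1 : G)} {x : G} (ha : FormDiffAt a x) (Z : CT E x)
    (z : CT E (1 : G)) : dForm a x Z z = cderiv E (fun y => a y z) x Z := by
  set b := Module.finBasis ℂ (CT E (1 : G)) with hb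
  have h1 : (fun y => a y z) = fun y => ∑ i, b.repr z i * a y (b i) := by
    ext y
    conv_lhs => rw [← b.sum_repr z, map_sum]
    simp only [map_smul, smul_eq_mul]
  rw [h1, cderiv_sum fun i _ => mdifferentiableAt_mul mdifferentiableAt_const (ha (b i))]
  conv_lhs => rw [← b.sum_repr z, map_sum]
  rw [LinearMap.sum_apply]
  refine Finset.sum_congr rfl fun i _ => ?_
  rw [cderiv_const_mul _ (ha (b i)), map_smul, LinearMap.smul_apply, dForm, ← hb,
    Module.Basis.constr_basis]

/-- Belonging to U_1 means vanishing on the fixed space 𝔨, a condition that survives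
differentiation. -/
lemma dForm_mem {a : G → CTDual E (1 : G)} {x : G} (ha : FormDiffAt a x)
    (haU : ∀ᶠ y in nhds x, a y ∈ U 1) (Z : CT E x) : dForm a x Z ∈ U 1 := by
  rw [mem_iff_forall_annK]
  intro k hk
  have h : (fun y => a y k) =ᶠ[nhds x] fun _ => 0 := by
    filter_upwards [haU] with y hy using mem_iff_forall_annK.1 hy k hk
  rw [dForm_apply ha, cderiv_congr h, cderiv_const, LinearMap.zero_apply]

lemma mdifferentiableAt_leftβ (hD : IsAlmostDiracGroup (diracL U β)) {ξ η : CTDual E (1 : G)}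
    (hξ : ξ ∈ U 1) (hη : η ∈ U 1) (x : G) :
    MDifferentiableAt 𝓘(ℝ, E) 𝓘(ℝ, ℂ) (leftβ U β ξ η) x :=
  (smoothFun_leftβ hD hξ hη (V := Set.univ)).mdifferentiableAt isOpen_univ (Set.mem_univ x)

lemma cderiv_leftβ_sum_left (hD : IsAlmostDiracGroup (diracL U β)) {ι : Type*} (s : Finset ι)
    (c : ι → ℂ) {ξ : ι → CTDual E (1 : G)} (hξ : ∀ i, ξ i ∈ U 1) {η : CTDual E (1 : G)}
    (hη : η ∈ U 1) (x : G) :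
    cderiv E (leftβ U β (∑ i ∈ s, c i • ξ i) η) x =
      ∑ i ∈ s, c i • cderiv E (leftβ U β (ξ i) η) x := by
  have h : leftβ U β (∑ i ∈ s, c i • ξ i) η = fun y => ∑ i ∈ s, c i * leftβ U β (ξ i) η y :=
    funext fun y => leftβ_sum_left hD s c hξ hη y
  rw [h, cderiv_sum fun i _ => mdifferentiableAt_mul mdifferentiableAt_const
    (mdifferentiableAt_leftβ hD (hξ i) hη x)]
  exact Finset.sum_congr rfl fun i _ => cderiv_const_mul _ (mdifferentiableAt_leftβ hD (hξ i) hη x)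

lemma cderiv_leftβ_swap (hβ : ∀ x, (β x).IsAlt) (hD : IsAlmostDiracGroup (diracL U β))
    {ξ η : CTDual E (1 : G)} (hξ : ξ ∈ U 1) (hη : η ∈ U 1) (x : G) :
    cderiv E (leftβ U β ξ η) x = - cderiv E (leftβ U β η ξ) x := by
  rw [← cderiv_neg (mdifferentiableAt_leftβ hD hη hξ x)]
  exact congrArg (fun F => cderiv E F x) (funext fun y => leftβ_swap hβ ξ η y)

/-- Expansion of `β` in a dual family, for varying covectors. -/
lemma leftβ_expand (hD : IsAlmostDiracGroup (diracL U β)) {r : ℕ} {u : Fin r → CTDual E (1 : G)}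
    {w : Fin r → CT E (1 : G)} (hu : ∀ i, u i ∈ U 1)
    (hexp : ∀ ξ ∈ U 1, ξ = ∑ i, ξ (w i) • u i) {ξ η : CTDual E (1 : G)} (hξ : ξ ∈ U 1)
    (hη : η ∈ U 1) (y : G) : leftβ U β ξ η y = ∑ i, ξ (w i) * leftβ U β (u i) η y := by
  conv_lhs => rw [hexp ξ hξ, leftβ_sum_left hD _ _ hu hη]

/-- Expanding a(y) in a fixed basis of U_1 turns β(a(y), η) into a finite sum of products of scalar
functions. The rule with two varying covectors then applies this one to the coefficients. -/
lemma mdifferentiableAt_leftβ_left (hD : IsAlmostDiracGroup (diracL U β))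
    {a : G → CTDual E (1 : G)} {x : G} (ha : FormDiffAt a x) (haU : ∀ᶠ y in nhds x, a y ∈ U 1)
    {η : CTDual E (1 : G)} (hη : η ∈ U 1) :
    MDifferentiableAt 𝓘(ℝ, E) 𝓘(ℝ, ℂ) (fun y => leftβ U β (a y) η y) x ∧
    ∀ Z, cderiv E (fun y => leftβ U β (a y) η y) x Z =
      cderiv E (leftβ U β (a x) η) x Z + leftβ U β (dForm a x Z) η x := by
  obtain ⟨r, u, w, hu, -, hexp⟩ := exists_dual_family (U 1)
  have h1 : (fun y => leftβ U β (a y) η y) =ᶠ[nhds x]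
      fun y => ∑ i, a y (w i) * leftβ U β (u i) η y := by
    filter_upwards [haU] with y hy using leftβ_expand hD hu hexp hy hη y
  have h2 : ∀ i ∈ Finset.univ, MDifferentiableAt 𝓘(ℝ, E) 𝓘(ℝ, ℂ)
      (fun y => a y (w i) * leftβ U β (u i) η y) x := fun i _ =>
    mdifferentiableAt_mul (ha (w i)) (mdifferentiableAt_leftβ hD (hu i) hη x)
  refine ⟨(mdifferentiableAt_sum h2).congr_of_eventuallyEq h1, fun Z => ?_⟩
  have h3 : cderiv E (leftβ U β (a x) η) x = ∑ i, a x (w i) • cderiv E (leftβ U β (u i) η) x := by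
    conv_lhs => rw [hexp (a x) haU.self_of_nhds, cderiv_leftβ_sum_left hD _ _ hu hη]
  rw [cderiv_congr h1, cderiv_sum h2, h3, leftβ_expand hD hu hexp (dForm_mem ha haU Z) hη,
    LinearMap.sum_apply, LinearMap.sum_apply, ← Finset.sum_add_distrib]
  refine Finset.sum_congr rfl fun i _ => ?_
  rw [cderiv_mul (ha (w i)) (mdifferentiableAt_leftβ hD (hu i) hη x), dForm_apply ha]
  simp only [LinearMap.add_apply, LinearMap.smul_apply, smul_eq_mul]
  ring

/-- The product rule for `β` on varying covectors. -/
lemma cderiv_leftβ (hβ : ∀ x, (β x).IsAlt) (hD : IsAlmostDiracGroup (diracL U β))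
    {a b : G → CTDual E (1 : G)} {x : G} (ha : FormDiffAt a x) (haU : ∀ᶠ y in nhds x, a y ∈ U 1)
    (hb : FormDiffAt b x) (hbU : ∀ᶠ y in nhds x, b y ∈ U 1) (Z : CT E x) :
    cderiv E (fun y => leftβ U β (a y) (b y) y) x Z =
      cderiv E (leftβ U β (a x) (b x)) x Z + leftβ U β (dForm a x Z) (b x) x +
        leftβ U β (a x) (dForm b x Z) x := by
  obtain ⟨r, u, w, hu, -, hexp⟩ := exists_dual_family (U 1)
  have hax := haU.self_of_nhds
  have hbx := hbU.self_of_nhds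
  have h1 : (fun y => leftβ U β (a y) (b y) y) =ᶠ[nhds x]
      fun y => ∑ i, a y (w i) * -leftβ U β (b y) (u i) y := by
    filter_upwards [haU, hbU] with y hy hy'
    rw [leftβ_expand hD hu hexp hy hy' y]
    exact Finset.sum_congr rfl fun i _ => by rw [leftβ_swap hβ (u i)]
  have hd : ∀ i, MDifferentiableAt 𝓘(ℝ, E) 𝓘(ℝ, ℂ) (fun y => -leftβ U β (b y) (u i) y) x :=
    fun i => (mdifferentiableAt_leftβ_left hD hb hbU (hu i)).1.neg
  have h2 : ∀ i ∈ Finset.univ, MDifferentiableAt 𝓘(ℝ, E) 𝓘(ℝ, ℂ)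
      (fun y => a y (w i) * -leftβ U β (b y) (u i) y) x := fun i _ =>
    mdifferentiableAt_mul (ha (w i)) (hd i)
  have h3 : cderiv E (leftβ U β (a x) (b x)) x =
      ∑ i, a x (w i) • cderiv E (leftβ U β (u i) (b x)) x := by
    conv_lhs => rw [hexp (a x) hax, cderiv_leftβ_sum_left hD _ _ hu hbx]
  rw [cderiv_congr h1, cderiv_sum h2, h3, leftβ_expand hD hu hexp (dForm_mem ha haU Z) hbx,
    leftβ_expand hD hu hexp hax (dForm_mem hb hbU Z),
    LinearMap.sum_apply, LinearMap.sum_apply, ← Finset.sum_add_distrib, ← Finset.sum_add_distrib]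
  refine Finset.sum_congr rfl fun i _ => ?_
  have h4 := (mdifferentiableAt_leftβ_left hD hb hbU (hu i)).2 Z
  rw [cderiv_mul (ha (w i)) (hd i), dForm_apply ha,
    cderiv_neg (mdifferentiableAt_leftβ_left hD hb hbU (hu i)).1, leftβ_swap hβ (u i) (b x),
    leftβ_swap hβ (u i) (dForm b x Z), cderiv_leftβ_swap hβ hD (hu i) hbx]
  simp only [LinearMap.add_apply, LinearMap.smul_apply, LinearMap.neg_apply, smul_eq_mul, h4]
  ring

lemma smoothFun_leftβ_comp (hβ : ∀ x, (β x).IsAlt) (hD : IsAlmostDiracGroup (diracL U β))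
    {V : Set G} {a b : G → CTDual E (1 : G)} (ha : ∀ z, SmoothFun E V (fun y => a y z))
    (haU : ∀ y ∈ V, a y ∈ U 1) (hb : ∀ z, SmoothFun E V (fun y => b y z))
    (hbU : ∀ y ∈ V, b y ∈ U 1) : SmoothFun E V (fun y => leftβ U β (a y) (b y) y) := by
  obtain ⟨r, u, w, hu, -, hexp⟩ := exists_dual_family (U 1)
  have h : SmoothFun E V (fun y => ∑ i, a y (w i) * -∑ j, b y (w j) * leftβ U β (u j) (u i) y) :=
    SmoothFun.sum fun i _ => (ha (w i)).mul (SmoothFun.sum fun j _ =>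
      (hb (w j)).mul (smoothFun_leftβ hD (hu j) (hu i))).neg
  refine h.congr fun y hy => ?_
  rw [leftβ_expand hD hu hexp (haU y hy) (hbU y hy) y]
  refine Finset.sum_congr rfl fun i _ => ?_
  rw [leftβ_swap hβ (u i), leftβ_expand hD hu hexp (hbU y hy) (hu i) y]

/-- The trilinear obstruction to integrability, in the left trivialisation. -/
def jacobiator (U : Π x : G, Submodule ℂ (CTDual E x)) (β : Π x : G, U x →ₗ[ℂ] U x →ₗ[ℂ] ℂ) (x : G)
    (z₁ z₂ z₃ : CT E (1 : G)) (ξ₁ ξ₂ ξ₃ : CTDual E (1 : G)) : ℂ :=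
  cderiv E (leftβ U β ξ₂ ξ₃) x (leftField z₁ x) + cderiv E (leftβ U β ξ₃ ξ₁) x (leftField z₂ x) +
    cderiv E (leftβ U β ξ₁ ξ₂) x (leftField z₃ x) + ξ₃ (brC z₁ z₂) + ξ₂ (brC z₃ z₁) +
    ξ₁ (brC z₂ z₃)

/-- The jacobiator vanishes on all triples of elements of the Dirac structure. -/
def JacobiatorVanishes (U : Π x : G, Submodule ℂ (CTDual E x))
    (β : Π x : G, U x →ₗ[ℂ] U x →ₗ[ℂ] ℂ) : Prop :=
  ∀ x z₁ z₂ z₃ ξ₁ ξ₂ ξ₃, IsLift U β x z₁ ξ₁ → IsLift U β x z₂ ξ₂ → IsLift U β x z₃ ξ₃ →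
    jacobiator U β x z₁ z₂ z₃ ξ₁ ξ₂ ξ₃ = 0

lemma leftβ_zero_right (hβ : ∀ x, (β x).IsAlt) (η : CTDual E (1 : G)) :
    leftβ U β η 0 = fun _ => 0 := by
  ext y
  rw [leftβ_swap hβ, leftβ_zero_left, neg_zero]

lemma apply_brC_annK (hD : IsAlmostDiracGroup (diracL U β)) {ξ : CTDual E (1 : G)} (hξ : ξ ∈ U 1)
    (z : CT E (1 : G)) {k : CT E (1 : G)} (hk : k ∈ annK U) : ξ (brC z k) = 0 :=
  mem_iff_forall_annK.1 hξ _ (brC_mem_annK hD z hk)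

/-- The pair (k, 0) belongs to D. On the triple (k, 0), (z, ξ), (w, η) the bracket terms vanish
because 𝔨 is an ideal and the terms with β(0, ·) vanish, leaving the derivative of β(ξ, η) along k.
-/
lemma JacobiatorVanishes.derivVanishesOnK (hβ : ∀ x, (β x).IsAlt)
    (hD : IsAlmostDiracGroup (diracL U β)) (h : JacobiatorVanishes U β) :
    DerivVanishesOnK U β := by
  intro x ξ hξ η hη k hk
  obtain ⟨z, hz⟩ := exists_isLift hD x hξ
  obtain ⟨w, hw⟩ := exists_isLift hD x hη
  have := h x k z w 0 ξ η (isLift_zero hk) hz hw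
  rw [jacobiator, brC_swap k z, map_neg, apply_brC_annK hD hη z hk, apply_brC_annK hD hξ w hk,
    leftβ_zero_right hβ, cderiv_const, cderiv_leftβ_swap hβ hD (U 1).zero_mem hξ,
    leftβ_zero_right hβ, cderiv_const] at this
  simp only [neg_zero, add_zero, LinearMap.zero_apply] at this
  exact this

end LeftBeta

/-! ### Integrability and the jacobiator -/

section Courant

variable {E : Type*} [NormedAddCommGroup E] [NormedSpace ℝ E] [FiniteDimensional ℝ E]
  {G : Type*} [TopologicalSpace G] [ChartedSpace E G] [Group G] [LieGroup 𝓘(ℝ, E) ∞ G]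
  {U : Π x : G, Submodule ℂ (CTDual E x)} {β : Π x : G, U x →ₗ[ℂ] U x →ₗ[ℂ] ℂ} {V : Set G}

/-- A family of covectors, in the left trivialisation. -/
def trivForm (a : Π x : G, CTDual E x) (y : G) : CTDual E (1 : G) := a y ∘ₗ leftT y

lemma SmoothForm.smoothFun_trivForm (hV : IsOpen V) {a : Π x : G, CTDual E x} (ha : SmoothForm V a)
    (z : CT E (1 : G)) : SmoothFun E V (fun y => trivForm a y z) :=
  ha.apply hV (smoothField_leftField z)

lemma SmoothForm.formDiffAt_trivForm (hV : IsOpen V) {a : Π x : G, CTDual E x}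
    (ha : SmoothForm V a) {x : G} (hx : x ∈ V) : FormDiffAt (trivForm a) x := fun z =>
  (ha.smoothFun_trivForm hV z).mdifferentiableAt hV hx

lemma SmoothField.fieldDiffAt (hV : IsOpen V) {X : Π x : G, CT E x} (hX : SmoothField V X) {x : G}
    (hx : x ∈ V) : FieldDiffAt X x :=
  ⟨(ContMDiffOn.contMDiffAt hX.1 (hV.mem_nhds hx)).mdifferentiableAt (by simp),
    (ContMDiffOn.contMDiffAt hX.2 (hV.mem_nhds hx)).mdifferentiableAt (by simp)⟩

lemma extD_eq {a : Π x : G, CTDual E x} {x : G} (ha : FormDiffAt (trivForm a) x) (Z W : CT E x) :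
    extD a x Z W = dForm (trivForm a) x Z (leftTInv x W) - dForm (trivForm a) x W (leftTInv x Z) -
      trivForm a x (brC (leftTInv x Z) (leftTInv x W)) := by
  rw [dForm_apply ha, dForm_apply ha, extD, cbracket_leftField]
  rfl

/-- The pairing of the Courant bracket of two sections with a third element. -/
lemma pairing_courant (hβ : ∀ x, (β x).IsAlt) (hD : IsAlmostDiracGroup (diracL U β))
    (hV : IsOpen V) {s t : Π x : G, GenT E x} (hs : SmoothSection V s) (ht : SmoothSection V t)
    (hsD : ∀ x ∈ V, s x ∈ diracL U β x) (htD : ∀ x ∈ V, t x ∈ diracL U β x) {x : G} (hx : x ∈ V)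
    {q : GenT E x} (hq : q ∈ diracL U β x) :
    courantForm s t x q.1 + q.2 (cbracket (fun y => (s y).1) (fun y => (t y).1) x) =
      jacobiator U β x (leftTInv x (s x).1) (leftTInv x (t x).1) (leftTInv x q.1)
        ((s x).2 ∘ₗ leftT x) ((t x).2 ∘ₗ leftT x) (q.2 ∘ₗ leftT x) := by
  set a : G → CTDual E (1 : G) := trivForm fun y => (s y).2 with ha'
  set b : G → CTDual E (1 : G) := trivForm fun y => (t y).2 with hb'
  set c : CTDual E (1 : G) := q.2 ∘ₗ leftT x with hc'
  have hls : ∀ y ∈ V, IsLift U β y (leftTInv y (s y).1) (a y) := fun y hy =>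
    (isLift_iff hD).2 (hsD y hy)
  have hlt : ∀ y ∈ V, IsLift U β y (leftTInv y (t y).1) (b y) := fun y hy =>
    (isLift_iff hD).2 (htD y hy)
  have hlq : IsLift U β x (leftTInv x q.1) c := (isLift_iff hD).2 hq
  have ha : FormDiffAt a x := hs.2.formDiffAt_trivForm hV hx
  have hb : FormDiffAt b x := ht.2.formDiffAt_trivForm hV hx
  have haU : ∀ᶠ y in nhds x, a y ∈ U 1 := by
    filter_upwards [hV.mem_nhds hx] with y hy using (hls y hy).1
  have hbU : ∀ᶠ y in nhds x, b y ∈ U 1 := by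
    filter_upwards [hV.mem_nhds hx] with y hy using (hlt y hy).1
  -- Along D, pairings of form with vector components are values of β, so every function
  -- differentiated below is β on varying covectors. The two halves in the Courant bracket add up to
  -- d(β(a, b)) by antisymmetry.
  have hab : cderiv E (fun y => (t y).2 (s y).1) x =
      cderiv E (fun y => leftβ U β (a y) (b y) y) x := by
    refine cderiv_congr ?_
    filter_upwards [hV.mem_nhds hx] with y hy
    rw [← (hls y hy).2 _ (hlt y hy).1]
    simp [hb', trivForm]
  have hba : cderiv E (fun y => (s y).2 (t y).1) x =
      cderiv E (fun y => leftβ U β (b y) (a y) y) x := by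
    refine cderiv_congr ?_
    filter_upwards [hV.mem_nhds hx] with y hy
    rw [← (hlt y hy).2 _ (hls y hy).1]
    simp [ha', trivForm]
  have hac : cderiv E (fun y => c (leftTInv y (s y).1)) x =
      cderiv E (fun y => leftβ U β (a y) c y) x := by
    refine cderiv_congr ?_
    filter_upwards [hV.mem_nhds hx] with y hy using (hls y hy).2 _ hlq.1
  have hbc : cderiv E (fun y => c (leftTInv y (t y).1)) x =
      cderiv E (fun y => leftβ U β (b y) c y) x := by
    refine cderiv_congr ?_
    filter_upwards [hV.mem_nhds hx] with y hy using (hlt y hy).2 _ hlq.1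
  have hbr : q.2 (cbracket (fun y => (s y).1) (fun y => (t y).1) x) =
      c (leftTInv x (cbracket (fun y => (s y).1) (fun y => (t y).1) x)) := by
    simp [hc']
  rw [hbr, apply_leftTInv_cbracket c (hs.1.fieldDiffAt hV hx) (ht.1.fieldDiffAt hV hx), hac, hbc,
    (mdifferentiableAt_leftβ_left hD ha haU hlq.1).2, (mdifferentiableAt_leftβ_left hD hb hbU
      hlq.1).2, courantForm, extD_eq ha, extD_eq hb, hab, hba, cderiv_leftβ hβ hD ha haU hb hbU,
    cderiv_leftβ hβ hD hb hbU ha haU, jacobiator]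
  -- The derivatives of a and b lie in U_1, so their pairings with the vector components are again
  -- values of β. These terms cancel by antisymmetry, leaving the derivatives of β at fixed
  -- covectors and the three bracket terms.
  rw [hlq.2 _ (dForm_mem hb hbU _), hlq.2 _ (dForm_mem ha haU _),
    (hls x hx).2 _ (dForm_mem hb hbU _), (hlt x hx).2 _ (dForm_mem ha haU _)]
  have e1 : ∀ z : CT E x, leftField (leftTInv x z) x = z := fun z => leftT_leftTInv x z
  rw [e1, e1, e1]
  have e2 : ((s x).2 ∘ₗ leftT x : CTDual E (1 : G)) = a x := rfl
  have e3 : ((t x).2 ∘ₗ leftT x : CTDual E (1 : G)) = b x := rfl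
  rw [e2, e3, brC_swap (leftTInv x q.1) (leftTInv x (s x).1), map_neg,
    leftβ_swap hβ (b x) (dForm a x q.1), leftβ_swap hβ (dForm b x q.1) (a x),
    leftβ_swap hβ c (dForm a x _), leftβ_swap hβ c (dForm b x _),
    cderiv_leftβ_swap hβ hD (hlt x hx).1 (hls x hx).1,
    cderiv_leftβ_swap hβ hD hlq.1 (hls x hx).1]
  simp only [LinearMap.neg_apply]
  ring

/-- Every η in U_1 is recovered from its values on the w_i, and it does not see k; so the sum pairs
with η to β(ξ, η). -/
lemma IsLift.of_sum {x : G} {r : ℕ} {u : Fin r → CTDual E (1 : G)} {w : Fin r → CT E (1 : G)}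
    (hβ : ∀ x, (β x).IsAlt) (hD : IsAlmostDiracGroup (diracL U β)) (hu : ∀ i, u i ∈ U 1)
    (hexp : ∀ ξ ∈ U 1, ξ = ∑ i, ξ (w i) • u i) {ξ : CTDual E (1 : G)} (hξ : ξ ∈ U 1)
    {k : CT E (1 : G)} (hk : k ∈ annK U) :
    IsLift U β x (∑ i, leftβ U β ξ (u i) x • w i + k) ξ := by
  refine ⟨hξ, fun η hη => ?_⟩
  rw [map_add, mem_iff_forall_annK.1 hη k hk, add_zero, map_sum]
  conv_rhs => rw [hexp η hη, leftβ_sum_right hβ hD _ _ hu hξ]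
  refine Finset.sum_congr rfl fun i _ => ?_
  rw [map_smul, smul_eq_mul, mul_comm]

lemma smoothRealField_zero : SmoothRealField V (fun x : G => (0 : TangentSpace 𝓘(ℝ, E) x)) :=
  (Bundle.contMDiff_zeroSection ℝ (TangentSpace 𝓘(ℝ, E) : G → Type _)).contMDiffOn

lemma SmoothField.add {X Y : Π x : G, CT E x} (hX : SmoothField V X) (hY : SmoothField V Y) :
    SmoothField V (fun x => X x + Y x) := by
  refine ⟨?_, ?_⟩
  · simp only [map_add]
    exact ContMDiffOn.add_section hX.1 hY.1
  · simp only [map_add]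
    exact ContMDiffOn.add_section hX.2 hY.2

lemma SmoothFun.re {F : G → ℂ} (hF : SmoothFun E V F) :
    ContMDiffOn 𝓘(ℝ, E) 𝓘(ℝ, ℝ) ∞ (fun x => (F x).re) V :=
  Complex.reCLM.contDiff.contMDiff.comp_contMDiffOn hF

lemma SmoothFun.im {F : G → ℂ} (hF : SmoothFun E V F) :
    ContMDiffOn 𝓘(ℝ, E) 𝓘(ℝ, ℝ) ∞ (fun x => (F x).im) V :=
  Complex.imCLM.contDiff.contMDiff.comp_contMDiffOn hF

lemma reT_smul {x : G} (c : ℂ) (z : CT E x) : reT (c • z) = c.re • reT z - c.im • imT z := by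
  induction z using TensorProduct.induction_on with
  | zero => simp
  | tmul a v => simp [reT, imT, TensorProduct.smul_tmul', sub_smul, mul_smul]
  | add a b ha hb => simp only [smul_add, map_add, ha, hb]; abel

lemma imT_smul {x : G} (c : ℂ) (z : CT E x) : imT (c • z) = c.re • imT z + c.im • reT z := by
  induction z using TensorProduct.induction_on with
  | zero => simp
  | tmul a v => simp [reT, imT, TensorProduct.smul_tmul', add_smul, mul_smul]
  | add a b ha hb => simp only [smul_add, map_add, ha, hb]; abel

lemma SmoothField.smul {F : G → ℂ} {X : Π x : G, CT E x} (hF : SmoothFun E V F)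
    (hX : SmoothField V X) : SmoothField V (fun x => F x • X x) := by
  refine ⟨?_, ?_⟩
  · simp only [reT_smul]
    exact ContMDiffOn.sub_section (ContMDiffOn.smul_section hF.re hX.1)
      (ContMDiffOn.smul_section hF.im hX.2)
  · simp only [imT_smul]
    exact ContMDiffOn.add_section (ContMDiffOn.smul_section hF.re hX.2)
      (ContMDiffOn.smul_section hF.im hX.1)

lemma smoothField_zero : SmoothField V (fun x : G => (0 : CT E x)) := by
  refine ⟨?_, ?_⟩ <;> simp only [map_zero] <;> exact smoothRealField_zero

lemma SmoothField.sum {ι : Type*} {s : Finset ι} {X : ι → Π x : G, CT E x}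
    (hX : ∀ i ∈ s, SmoothField V (X i)) : SmoothField V (fun x => ∑ i ∈ s, X i x) := by
  classical
  induction s using Finset.induction_on with
  | empty => simpa using smoothField_zero
  | insert a s ha ih =>
    simp only [Finset.mem_insert, forall_eq_or_imp] at hX
    simp only [Finset.sum_insert ha]
    exact hX.1.add (ih hX.2)

lemma smoothForm_leftForm (ξ : CTDual E (1 : G)) : SmoothForm V (leftForm ξ) := by
  intro W _ _ A hA
  have := hA.smoothFun_comp_dLeftInv (restrictReal ξ)
  refine this.congr fun y _ => ?_
  rw [leftForm, LinearMap.comp_apply, leftTInv_tmul, restrictReal_apply]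

/-- Every element of the Dirac structure extends to a smooth section with left-invariant form
component. -/
lemma exists_section (hβ : ∀ x, (β x).IsAlt) (hD : IsAlmostDiracGroup (diracL U β)) {x : G}
    {z : CT E (1 : G)} {ξ : CTDual E (1 : G)} (h : IsLift U β x z ξ) :
    ∃ s : Π x : G, GenT E x, SmoothSection Set.univ s ∧ (∀ y, s y ∈ diracL U β y) ∧
      leftTInv x (s x).1 = z ∧ (s x).2 ∘ₗ leftT x = ξ := by
  obtain ⟨r, u, w, hu, -, hexp⟩ := exists_dual_family (U 1)
  -- The given z differs from the lift built from the dual family by some k in 𝔨; adding the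
  -- left-invariant field of k makes the section pass through z at x.
  have hk : z - ∑ i, leftβ U β ξ (u i) x • w i ∈ annK U := by
    rw [annK, Submodule.mem_dualCoannihilator]
    intro η hη
    have h1 := (IsLift.of_sum (x := x) hβ hD hu hexp h.1 (annK U).zero_mem).2 η hη
    rw [add_zero] at h1
    rw [map_sub, h.2 η hη, h1, sub_self]
  set k := z - ∑ i, leftβ U β ξ (u i) x • w i with hk'
  have hform : ∀ y : G, leftForm ξ y ∘ₗ leftT y = ξ := fun y => by
    ext z; simp [leftForm]
  have hfield : ∀ y : G, (∑ i, leftβ U β ξ (u i) y • leftField (w i) y + leftField k y) =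
      leftT y (∑ i, leftβ U β ξ (u i) y • w i + k) := fun y => by
    simp [leftField]
  refine ⟨fun y => (∑ i, leftβ U β ξ (u i) y • leftField (w i) y + leftField k y, leftForm ξ y),
    ⟨?_, smoothForm_leftForm ξ⟩, ?_, ?_, hform x⟩
  · exact (SmoothField.sum fun i _ => (smoothField_leftField (w i)).smul
      (smoothFun_leftβ hD h.1 (hu i))).add (smoothField_leftField k)
  · intro y
    rw [← isLift_iff hD]
    simp only [hfield, hform, leftTInv_leftT]
    exact IsLift.of_sum hβ hD hu hexp h.1 hk
  · simp only [hfield, leftTInv_leftT]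
    exact add_sub_cancel _ _

/-- D_x contains its orthogonal complement: orthogonality to kernel vectors puts the form component
in U_x, and orthogonality to a pair over each η in U_x gives the defining equation. -/
lemma mem_diracL_of_pairing (hβ : ∀ x, (β x).IsAlt) (hD : IsAlmostDiracGroup (diracL U β)) {x : G}
    {p : GenT E x} (hp : ∀ q ∈ diracL U β x, p.2 q.1 + q.2 p.1 = 0) : p ∈ diracL U β x := by
  have h1 : p.2 ∈ U x := by
    rw [mem_iff_forall_leftField hD]
    intro k hk
    have := hp (leftField k x, 0) (vector_mem_graphL.2 (leftT_mem hD x hk))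
    simpa using this
  refine mem_diracL_iff.2 ⟨h1, fun η hη => ?_⟩
  obtain ⟨X, hX⟩ := exists_mem_diracL (β := β) hη
  have h2 := hp _ hX
  have h3 := (mem_diracL_iff.1 hX).2 _ h1
  simp only at h2 h3
  rw [evalβ_swap hβ, ← h3]
  linear_combination h2

/-- The one-form component of the Courant bracket as a covector. -/
lemma exists_courantForm_eq (hV : IsOpen V) {s t : Π x : G, GenT E x} (hs : SmoothSection V s)
    (ht : SmoothSection V t) {x : G} (hx : x ∈ V) :
    ∃ φ : CTDual E x, ∀ W, φ W = courantForm s t x W := by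
  have key : ∀ {a : Π x : G, CTDual E x}, SmoothForm V a → ∀ Z : CT E x,
      ∃ φ : CTDual E x, ∀ W, φ W = extD a x Z W := by
    intro a ha Z
    refine ⟨dForm (trivForm a) x Z ∘ₗ leftTInv x -
      cderiv E (fun y => trivForm a y (leftTInv x Z)) x -
      trivForm a x ∘ₗ brC (leftTInv x Z) ∘ₗ leftTInv x, fun W => ?_⟩
    rw [extD_eq (ha.formDiffAt_trivForm hV hx), dForm_apply (ha.formDiffAt_trivForm hV hx) W]
    rfl
  obtain ⟨φ, hφ⟩ := key ht.2 (s x).1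
  obtain ⟨ψ, hψ⟩ := key hs.2 (t x).1
  refine ⟨φ + (1 / 2 : ℂ) • cderiv E (fun x => (t x).2 (s x).1) x - ψ -
    (1 / 2 : ℂ) • cderiv E (fun x => (s x).2 (t x).1) x, fun W => ?_⟩
  rw [courantForm, ← hφ, ← hψ]
  rfl

/-- Isotropy makes the pairing of a bracket in D with D vanish, and extending elements at x to
sections reaches every triple. Conversely D contains whatever is orthogonal to it. -/
theorem isIntegrable_iff (hβ : ∀ x, (β x).IsAlt) (hD : IsAlmostDiracGroup (diracL U β)) :
    IsIntegrable (diracL U β) ↔ JacobiatorVanishes U β := by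
  constructor
  · intro h x z₁ z₂ z₃ ξ₁ ξ₂ ξ₃ h₁ h₂ h₃
    obtain ⟨s, hs, hsD, hs1, hs2⟩ := exists_section hβ hD h₁
    obtain ⟨t, ht, htD, ht1, ht2⟩ := exists_section hβ hD h₂
    obtain ⟨q, -, hqD, hq1, hq2⟩ := exists_section hβ hD h₃
    obtain ⟨p, hp, hp1, hp2⟩ := h Set.univ isOpen_univ s t hs ht (fun y _ => hsD y)
      (fun y _ => htD y) x (Set.mem_univ x)
    have h4 := pairing_courant hβ hD isOpen_univ hs ht (fun y _ => hsD y) (fun y _ => htD y)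
      (Set.mem_univ x) (hqD x)
    rw [hs1, hs2, ht1, ht2, hq1, hq2, ← hp2, ← hp1] at h4
    rw [← h4]
    have h5 := (hD.1.maximal_isotropic x).prop p hp (q x) (hqD x)
    rw [pairing, add_comm] at h5
    exact h5
  · intro h V hV s t hs ht hsD htD x hx
    obtain ⟨φ, hφ⟩ := exists_courantForm_eq hV hs ht hx
    refine ⟨(cbracket (fun y => (s y).1) (fun y => (t y).1) x, φ), ?_, rfl, hφ⟩
    refine mem_diracL_of_pairing hβ hD fun q hq => ?_
    rw [hφ, pairing_courant hβ hD hV hs ht hsD htD hx hq]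
    exact h _ _ _ _ _ _ _ ((isLift_iff hD).2 (hsD x hx)) ((isLift_iff hD).2 (htD x hx))
      ((isLift_iff hD).2 hq)

end Courant

/-! ### The bracket on ℱ and the jacobiator -/

section Poisson

variable {E : Type*} [NormedAddCommGroup E] [NormedSpace ℝ E] [FiniteDimensional ℝ E]
  {G : Type*} [TopologicalSpace G] [ChartedSpace E G] [Group G] [LieGroup 𝓘(ℝ, E) ∞ G]
  {U : Π x : G, Submodule ℂ (CTDual E x)} {β : Π x : G, U x →ₗ[ℂ] U x →ₗ[ℂ] ℂ} {V : Set G}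
  {f g h : G → ℂ}

/-- The differential of a function, in the left trivialisation. -/
def trivDiff (f : G → ℂ) : G → CTDual E (1 : G) := trivForm (cderiv E f)

lemma trivDiff_apply (f : G → ℂ) (y : G) (z : CT E (1 : G)) :
    trivDiff f y z = cderiv E f y (leftField z y) := rfl

lemma InSheaf.mono {V' : Set G} (hf : InSheaf U V f) (h : V' ⊆ V) : InSheaf U V' f :=
  ⟨hf.1.mono h, fun x hx => hf.2 x (h hx)⟩

lemma InSheaf.trivDiff_mem (hf : InSheaf U V f) {y : G} (hy : y ∈ V) : trivDiff f y ∈ U 1 :=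
  mem_iff_forall_annK.2 fun k hk => hf.2 y hy k hk

lemma InSheaf.cderiv_mem (hD : IsAlmostDiracGroup (diracL U β)) (hf : InSheaf U V f) {y : G}
    (hy : y ∈ V) : cderiv E f y ∈ U y := (mem_iff_comp_leftT hD).2 (hf.trivDiff_mem hy)

lemma InSheaf.smoothFun_trivDiff (hV : IsOpen V) (hf : InSheaf U V f) (z : CT E (1 : G)) :
    SmoothFun E V (fun y => trivDiff f y z) := hf.1.cderiv_apply hV (smoothField_leftField z)

lemma InSheaf.formDiffAt_trivDiff (hV : IsOpen V) (hf : InSheaf U V f) {y : G} (hy : y ∈ V) :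
    FormDiffAt (trivDiff (E := E) f) y := fun z => (hf.smoothFun_trivDiff hV z).mdifferentiableAt hV hy

lemma InSheaf.eventually_mem (hV : IsOpen V) (hf : InSheaf U V f) {x : G} (hx : x ∈ V) :
    ∀ᶠ y in nhds x, trivDiff f y ∈ U 1 := by
  filter_upwards [hV.mem_nhds hx] with y hy using hf.trivDiff_mem hy

lemma fbracket_eq (f g : G → ℂ) (y : G) :
    fbracket U β f g y = leftβ U β (trivDiff f y) (trivDiff g y) y := by
  rw [leftβ, trivDiff, trivDiff, trivForm, trivForm, leftForm_comp_leftT, leftForm_comp_leftT,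
    fbracket]

lemma fbracket_eq_of_isLift {x : G} {z : CT E (1 : G)} (hz : IsLift U β x z (trivDiff f x))
    (hg : trivDiff g x ∈ U 1) : fbracket U β f g x = cderiv E g x (leftField z x) := by
  rw [fbracket_eq, ← hz.2 _ hg, trivDiff_apply]

/-- Symmetry of second derivatives. -/
lemma InSheaf.dForm_trivDiff_sub (hV : IsOpen V) (hf : InSheaf U V f) {x : G} (hx : x ∈ V)
    (z w : CT E (1 : G)) :
    dForm (trivDiff f) x (leftField z x) w - dForm (trivDiff f) x (leftField w x) z =
      trivDiff f x (brC z w) := by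
  rw [dForm_apply (hf.formDiffAt_trivDiff hV hx), dForm_apply (hf.formDiffAt_trivDiff hV hx)]
  exact cderiv_cderiv_leftField_sub hV hf.1 hx z w

/-- Exchanging the two derivatives costs df([z, k]), which is zero since 𝔨 is an ideal, and then
differentiates df(k) = 0. -/
lemma InSheaf.dForm_annK (hD : IsAlmostDiracGroup (diracL U β)) (hV : IsOpen V)
    (hf : InSheaf U V f) {x : G} (hx : x ∈ V) {k : CT E (1 : G)} (hk : k ∈ annK U) :
    dForm (trivDiff f) x (leftField k x) = 0 := by
  refine LinearMap.ext fun z => ?_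
  have h1 := hf.dForm_trivDiff_sub hV hx z k
  rw [apply_brC_annK hD (hf.trivDiff_mem hx) z hk, mem_iff_forall_annK.1
    (dForm_mem (hf.formDiffAt_trivDiff hV hx) (hf.eventually_mem hV hx) _) k hk] at h1
  rw [LinearMap.zero_apply]
  linear_combination -h1

lemma cderiv_fbracket (hβ : ∀ x, (β x).IsAlt) (hD : IsAlmostDiracGroup (diracL U β))
    (hV : IsOpen V) (hf : InSheaf U V f) (hg : InSheaf U V g) {x : G} (hx : x ∈ V) (Z : CT E x) :
    cderiv E (fbracket U β f g) x Z =
      cderiv E (leftβ U β (trivDiff f x) (trivDiff g x)) x Z +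
        leftβ U β (dForm (trivDiff f) x Z) (trivDiff g x) x +
        leftβ U β (trivDiff f x) (dForm (trivDiff g) x Z) x := by
  rw [← cderiv_leftβ hβ hD (hf.formDiffAt_trivDiff hV hx) (hf.eventually_mem hV hx)
    (hg.formDiffAt_trivDiff hV hx) (hg.eventually_mem hV hx)]
  exact congrArg (fun F => cderiv E F x Z) (funext fun y => fbracket_eq f g y)

/-- Along k the differentials df and dg are constant in the left trivialisation, so only the
derivative of β itself contributes to that of {f, g}. -/
lemma DerivVanishesOnK.inSheaf_fbracket (hK : DerivVanishesOnK U β) (hβ : ∀ x, (β x).IsAlt)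
    (hD : IsAlmostDiracGroup (diracL U β)) (hV : IsOpen V) (hf : InSheaf U V f)
    (hg : InSheaf U V g) : InSheaf U V (fbracket U β f g) := by
  refine ⟨?_, fun x hx k hk => ?_⟩
  · exact (smoothFun_leftβ_comp hβ hD (hf.smoothFun_trivDiff hV) (fun y hy => hf.trivDiff_mem hy)
      (hg.smoothFun_trivDiff hV) (fun y hy => hg.trivDiff_mem hy)).congr fun y _ => fbracket_eq f g y
  · rw [cderiv_fbracket hβ hD hV hf hg hx, hf.dForm_annK hD hV hx hk, hg.dForm_annK hD hV hx hk,
      leftβ_zero_left, leftβ_zero_right hβ, add_zero, add_zero]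
    exact hK x _ (hf.trivDiff_mem hx) _ (hg.trivDiff_mem hx) k hk

/-- The cyclic sum of iterated brackets is the jacobiator. -/
lemma fbracket_cyclic_sum (hβ : ∀ x, (β x).IsAlt) (hD : IsAlmostDiracGroup (diracL U β))
    (hV : IsOpen V) (hf : InSheaf U V f) (hg : InSheaf U V g) (hh : InSheaf U V h)
    (hgh : InSheaf U V (fbracket U β g h)) (hhf : InSheaf U V (fbracket U β h f))
    (hfg : InSheaf U V (fbracket U β f g)) {x : G} (hx : x ∈ V) {z₁ z₂ z₃ : CT E (1 : G)}
    (h₁ : IsLift U β x z₁ (trivDiff f x)) (h₂ : IsLift U β x z₂ (trivDiff g x))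
    (h₃ : IsLift U β x z₃ (trivDiff h x)) :
    fbracket U β f (fbracket U β g h) x + fbracket U β g (fbracket U β h f) x +
      fbracket U β h (fbracket U β f g) x =
    jacobiator U β x z₁ z₂ z₃ (trivDiff f x) (trivDiff g x) (trivDiff h x) := by
  have key : ∀ {a b : G → ℂ} {z w₁ w₂ : CT E (1 : G)}, InSheaf U V a → InSheaf U V b →
      IsLift U β x w₁ (trivDiff a x) → IsLift U β x w₂ (trivDiff b x) →
      cderiv E (fbracket U β a b) x (leftField z x) =
        cderiv E (leftβ U β (trivDiff a x) (trivDiff b x)) x (leftField z x) -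
          dForm (trivDiff a) x (leftField z x) w₂ + dForm (trivDiff b) x (leftField z x) w₁ := by
    intro a b z w₁ w₂ ha hb hw₁ hw₂
    rw [cderiv_fbracket hβ hD hV ha hb hx, leftβ_swap hβ (dForm (trivDiff a) x _),
      ← hw₂.2 _ (dForm_mem (ha.formDiffAt_trivDiff hV hx) (ha.eventually_mem hV hx) _),
      ← hw₁.2 _ (dForm_mem (hb.formDiffAt_trivDiff hV hx) (hb.eventually_mem hV hx) _)]
    ring
  -- An outer bracket is the derivative of the inner one along a lift. The six second-derivative
  -- terms pair off into three differences, and each difference is a differential evaluated on a Lie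
  -- bracket.
  rw [fbracket_eq_of_isLift h₁ (hgh.trivDiff_mem hx), fbracket_eq_of_isLift h₂ (hhf.trivDiff_mem hx),
    fbracket_eq_of_isLift h₃ (hfg.trivDiff_mem hx), key hg hh h₂ h₃, key hh hf h₃ h₁,
    key hf hg h₁ h₂, jacobiator, ← hh.dForm_trivDiff_sub hV hx z₁ z₂,
    ← hg.dForm_trivDiff_sub hV hx z₃ z₁, ← hf.dForm_trivDiff_sub hV hx z₂ z₃]
  ring

/-- Local sections with arbitrary differentials in U_1 reach every triple of covectors. Conversely,
the vanishing jacobiator first gives constancy of β along 𝔨, which is what makes the iterated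
brackets defined. -/
theorem satisfiesJacobi_iff (hβ : ∀ x, (β x).IsAlt) (hD : IsAlmostDiracGroup (diracL U β)) :
    SatisfiesJacobi U β ↔ JacobiatorVanishes U β := by
  constructor
  · intro h x z₁ z₂ z₃ ξ₁ ξ₂ ξ₃ h₁ h₂ h₃
    obtain ⟨V₁, f₁, hV₁, hx₁, hf₁, hd₁⟩ := exists_inSheaf hD x h₁.1
    obtain ⟨V₂, f₂, hV₂, hx₂, hf₂, hd₂⟩ := exists_inSheaf hD x h₂.1
    obtain ⟨V₃, f₃, hV₃, hx₃, hf₃, hd₃⟩ := exists_inSheaf hD x h₃.1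
    have key : ∀ {f : G → ℂ} {ξ : CTDual E (1 : G)}, cderiv E f x = leftForm ξ x →
        trivDiff f x = ξ := by
      intro f ξ hd
      rw [trivDiff, trivForm, hd]
      ext z
      simp [leftForm]
    have hV : IsOpen (V₁ ∩ V₂ ∩ V₃) := (hV₁.inter hV₂).inter hV₃
    have hx : x ∈ V₁ ∩ V₂ ∩ V₃ := ⟨⟨hx₁, hx₂⟩, hx₃⟩
    have i₁ := hf₁.mono (V' := V₁ ∩ V₂ ∩ V₃) fun y hy => hy.1.1
    have i₂ := hf₂.mono (V' := V₁ ∩ V₂ ∩ V₃) fun y hy => hy.1.2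
    have i₃ := hf₃.mono (V' := V₁ ∩ V₂ ∩ V₃) fun y hy => hy.2
    obtain ⟨⟨h23, h31, h12⟩, hj⟩ := h _ hV _ _ _ i₁ i₂ i₃
    obtain rfl := key hd₁
    obtain rfl := key hd₂
    obtain rfl := key hd₃
    rw [← fbracket_cyclic_sum hβ hD hV i₁ i₂ i₃ h23 h31 h12 hx h₁ h₂ h₃]
    exact hj x hx
  · intro h V hV f g k hf hg hk
    have hK := h.derivVanishesOnK hβ hD
    have hgk := hK.inSheaf_fbracket hβ hD hV hg hk
    have hkf := hK.inSheaf_fbracket hβ hD hV hk hf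
    have hfg := hK.inSheaf_fbracket hβ hD hV hf hg
    refine ⟨⟨hgk, hkf, hfg⟩, fun x hx => ?_⟩
    obtain ⟨z₁, h₁⟩ := exists_isLift hD x (hf.trivDiff_mem hx)
    obtain ⟨z₂, h₂⟩ := exists_isLift hD x (hg.trivDiff_mem hx)
    obtain ⟨z₃, h₃⟩ := exists_isLift hD x (hk.trivDiff_mem hx)
    rw [fbracket_cyclic_sum hβ hD hV hf hg hk hgk hkf hfg hx h₁ h₂ h₃]
    exact h _ _ _ _ _ _ _ h₁ h₂ h₃

theorem SatisfiesJacobi.isLieBracketOnSheaf (hβ : ∀ x, (β x).IsAlt)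
    (hD : IsAlmostDiracGroup (diracL U β)) (h : SatisfiesJacobi U β) :
    IsLieBracketOnSheaf U β where
  congr := by
    intro V hV f f' g g' _ _ _ _ hff hgg x hx
    have h1 : cderiv E f x = cderiv E f' x := cderiv_congr (hff.eventuallyEq_of_mem (hV.mem_nhds hx))
    have h2 : cderiv E g x = cderiv E g' x := cderiv_congr (hgg.eventuallyEq_of_mem (hV.mem_nhds hx))
    rw [fbracket, fbracket, h1, h2]
  -- Closure for (f, g) is read off from the Jacobi condition for the triple (f, f, g).
  closed := fun V hV f g hf hg => (h V hV f f g hf hf hg).1.1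
  add_left := by
    intro V hV f f' g hf hf' hg x hx
    have h1 : cderiv E (f + f') x = cderiv E f x + cderiv E f' x :=
      cderiv_add (hf.1.mdifferentiableAt hV hx) (hf'.1.mdifferentiableAt hV hx)
    rw [Pi.add_apply, fbracket, h1, evalβ_add_left (hf.cderiv_mem hD hx) (hf'.cderiv_mem hD hx)
      (hg.cderiv_mem hD hx)]
    rfl
  smul_left := by
    intro V hV c f g hf hg x hx
    have h1 : cderiv E (c • f) x = c • cderiv E f x :=
      cderiv_const_mul c (hf.1.mdifferentiableAt hV hx)
    rw [Pi.smul_apply, fbracket, h1, evalβ_smul_left c (hf.cderiv_mem hD hx) (hg.cderiv_mem hD hx)]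
    rfl
  antisymm := fun V _ f g _ _ x _ => evalβ_swap hβ _ _
  jacobi := by
    intro V hV f g k hf hg hk x hx
    obtain ⟨⟨hgk, hkf, hfg⟩, hj⟩ := h V hV f g k hf hg hk
    have h1 := hj x hx
    have hfk : fbracket U β k f = fun y => - fbracket U β f k y := funext fun y => evalβ_swap hβ _ _
    have hfkS : InSheaf U V (fbracket U β f k) := (h V hV f f k hf hf hk).1.1
    have h2 : cderiv E (fbracket U β k f) x = (-1 : ℂ) • cderiv E (fbracket U β f k) x := by
      rw [hfk, cderiv_neg (hfkS.1.mdifferentiableAt hV hx), neg_one_smul]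
    have h3 : fbracket U β g (fbracket U β k f) x = - fbracket U β g (fbracket U β f k) x := by
      rw [fbracket, h2, evalβ_swap hβ, evalβ_smul_left _
        (hfkS.cderiv_mem hD hx) (hg.cderiv_mem hD hx), fbracket, evalβ_swap hβ (cderiv E g x)]
      ring
    have h4 : fbracket U β k (fbracket U β f g) x = - fbracket U β (fbracket U β f g) k x :=
      evalβ_swap hβ _ _
    rw [Pi.add_apply]
    rw [h3, h4] at h1
    linear_combination h1

end Poisson

/-! ### Index algebra of the Schouten bracket -/

section SchoutenAlgebra

variable {V ι : Type*} [AddCommGroup V] [Module ℂ V] [Fintype ι]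
  (P : ι → ι → ℂ) (L : ι → ι → Module.Dual ℂ V) (br : V →ₗ[ℂ] V →ₗ[ℂ] V) (e : ι → V)

/-- The contraction of a bivector with a covector. -/
def contract (β : Module.Dual ℂ V) : V := ∑ i, ∑ j, (P i j * β (e i)) • e j

/-- One of the six terms of the Schouten bracket of `∑ ½ P i j e i ∧ e j` with itself, for the
derivatives `L` of the coefficients `P`. -/
def schoutenTerm (α β γ : Module.Dual ℂ V) (i j k l : ι) : ℂ :=
  (1 / 2 * P i j * (1 / 2 * L k l (e i)) * α (e k) - 1 / 2 * P k l * (1 / 2 * L i j (e k)) * α (e i) +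
      1 / 2 * P i j * (1 / 2 * P k l) * α (br (e i) (e k))) * β (e j) * γ (e l) -
    (-(1 / 2 * L i j (e l)) * α (e i) + 1 / 2 * P i j * α (br (e i) (e l))) * β (e j) *
      (1 / 2 * P k l * γ (e k)) -
    (1 / 2 * L k l (e j) * α (e k) + 1 / 2 * P k l * α (br (e j) (e k))) *
      (1 / 2 * P i j * β (e i)) * γ (e l) +
    α (br (e j) (e l)) * (1 / 2 * P i j * β (e i)) * (1 / 2 * P k l * γ (e k))

variable {P}

lemma contract_neg (hP : ∀ i j, P i j = - P j i) (β : Module.Dual ℂ V) :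
    ∑ i, ∑ j, (P i j * β (e j)) • e i = - contract P e β := by
  rw [contract, Finset.sum_comm, ← Finset.sum_neg_distrib]
  refine Finset.sum_congr rfl fun j _ => ?_
  rw [← Finset.sum_neg_distrib]
  refine Finset.sum_congr rfl fun i _ => ?_
  rw [hP i j, neg_mul, neg_smul]

/-- Every quadruple sum factors: P with a covector in one of its indices assembles to the
contraction, with a minus sign if the second index is used. Up to these signs the eight sums
coincide in groups of two, two and four, giving the coefficients 1/2, 1/2 and 1. -/
lemma sum_schoutenTerm (hP : ∀ i j, P i j = - P j i) (α β γ : Module.Dual ℂ V) :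
    ∑ i, ∑ j, ∑ k, ∑ l, schoutenTerm P L br e α β γ i j k l =
      -(1 / 2) * ∑ k, ∑ l, α (e k) * γ (e l) * L k l (contract P e β) +
      1 / 2 * ∑ i, ∑ j, α (e i) * β (e j) * L i j (contract P e γ) +
      α (br (contract P e β) (contract P e γ)) := by
  have bil : ∀ (b c : ι → ι → ℂ) (v w : ι → ι → V),
      ∑ i, ∑ j, ∑ k, ∑ l, b i j * c k l * α (br (v i j) (w k l)) =
        α (br (∑ i, ∑ j, b i j • v i j) (∑ k, ∑ l, c k l • w k l)) := by
    intro b c v w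
    have S : ∀ (ψ : Module.Dual ℂ V) (b : ι → ι → ℂ) (v : ι → ι → V),
        ψ (∑ i, ∑ j, b i j • v i j) = ∑ i, ∑ j, b i j * ψ (v i j) := by
      intro ψ b v
      simp only [map_sum, map_smul, smul_eq_mul]
    have h1 := S (α ∘ₗ br.flip (∑ k, ∑ l, c k l • w k l)) b v
    have h2 := fun z => S (α ∘ₗ br z) c w
    simp only [LinearMap.comp_apply, LinearMap.flip_apply] at h1 h2
    rw [h1]
    simp only [h2, Finset.mul_sum, mul_assoc]
  have lin1 : ∀ (b c : ι → ι → ℂ) (v : ι → ι → V),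
      ∑ i, ∑ j, ∑ k, ∑ l, b i j * c k l * L k l (v i j) =
        ∑ k, ∑ l, c k l * L k l (∑ i, ∑ j, b i j • v i j) := by
    intro b c v
    have : ∀ z : V, ∑ k, ∑ l, c k l * L k l z = (∑ k, ∑ l, c k l • L k l) z := fun z => by
      simp only [LinearMap.sum_apply, LinearMap.smul_apply, smul_eq_mul]
    rw [this, map_sum]
    refine Finset.sum_congr rfl fun i _ => ?_
    rw [map_sum]
    refine Finset.sum_congr rfl fun j _ => ?_
    rw [map_smul, ← this, smul_eq_mul, Finset.mul_sum]
    simp only [Finset.mul_sum, mul_assoc]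
  have lin2 : ∀ (b c : ι → ι → ℂ) (v : ι → ι → V),
      ∑ i, ∑ j, ∑ k, ∑ l, b i j * c k l * L i j (v k l) =
        ∑ i, ∑ j, b i j * L i j (∑ k, ∑ l, c k l • v k l) := by
    intro b c v
    simp only [map_sum, map_smul, smul_eq_mul, Finset.mul_sum, mul_assoc]
  have t1 := lin1 (fun i j => P i j * β (e j)) (fun k l => α (e k) * γ (e l)) (fun i _ => e i)
  have t2 := lin2 (fun i j => α (e i) * β (e j)) (fun k l => P k l * γ (e l)) (fun k _ => e k)
  have t3 := bil (fun i j => P i j * β (e j)) (fun k l => P k l * γ (e l)) (fun i _ => e i)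
    (fun k _ => e k)
  have t4 := lin2 (fun i j => α (e i) * β (e j)) (fun k l => P k l * γ (e k)) (fun _ l => e l)
  have t5 := bil (fun i j => P i j * β (e j)) (fun k l => P k l * γ (e k)) (fun i _ => e i)
    (fun _ l => e l)
  have t6 := lin1 (fun i j => P i j * β (e i)) (fun k l => α (e k) * γ (e l)) (fun _ j => e j)
  have t7 := bil (fun i j => P i j * β (e i)) (fun k l => P k l * γ (e l)) (fun _ j => e j)
    (fun k _ => e k)
  have t8 := bil (fun i j => P i j * β (e i)) (fun k l => P k l * γ (e k)) (fun _ j => e j)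
    (fun _ l => e l)
  rw [contract_neg e hP] at t1 t2 t3 t5 t7
  rw [contract_neg e hP] at t3
  have c1 : ∀ δ, ∑ i, ∑ j, (P i j * δ (e i)) • e j = contract P e δ := fun _ => rfl
  rw [c1] at t4 t5 t6 t7 t8
  rw [c1] at t8
  simp only [map_neg, LinearMap.neg_apply, mul_neg, Finset.sum_neg_distrib, neg_neg] at t1 t2 t3 t5 t7
  have split : ∑ i, ∑ j, ∑ k, ∑ l, schoutenTerm P L br e α β γ i j k l =
      1 / 4 * ∑ i, ∑ j, ∑ k, ∑ l, P i j * β (e j) * (α (e k) * γ (e l)) * L k l (e i) -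
      1 / 4 * ∑ i, ∑ j, ∑ k, ∑ l, α (e i) * β (e j) * (P k l * γ (e l)) * L i j (e k) +
      1 / 4 * ∑ i, ∑ j, ∑ k, ∑ l, P i j * β (e j) * (P k l * γ (e l)) * α (br (e i) (e k)) +
      1 / 4 * ∑ i, ∑ j, ∑ k, ∑ l, α (e i) * β (e j) * (P k l * γ (e k)) * L i j (e l) -
      1 / 4 * ∑ i, ∑ j, ∑ k, ∑ l, P i j * β (e j) * (P k l * γ (e k)) * α (br (e i) (e l)) -
      1 / 4 * ∑ i, ∑ j, ∑ k, ∑ l, P i j * β (e i) * (α (e k) * γ (e l)) * L k l (e j) -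
      1 / 4 * ∑ i, ∑ j, ∑ k, ∑ l, P i j * β (e i) * (P k l * γ (e l)) * α (br (e j) (e k)) +
      1 / 4 * ∑ i, ∑ j, ∑ k, ∑ l, P i j * β (e i) * (P k l * γ (e k)) * α (br (e j) (e l)) := by
    simp only [Finset.mul_sum, ← Finset.sum_add_distrib, ← Finset.sum_sub_distrib]
    refine Finset.sum_congr rfl fun i _ => Finset.sum_congr rfl fun j _ =>
      Finset.sum_congr rfl fun k _ => Finset.sum_congr rfl fun l _ => ?_
    rw [schoutenTerm]
    ring
  rw [split, t1, t2, t3, t4, t5, t6, t7, t8]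
  ring

end SchoutenAlgebra

/-! ### The Schouten bracket and the jacobiator -/

section Schouten

variable {E : Type*} [NormedAddCommGroup E] [NormedSpace ℝ E] [FiniteDimensional ℝ E]
  {G : Type*} [TopologicalSpace G] [ChartedSpace E G] [Group G] [LieGroup 𝓘(ℝ, E) ∞ G]
  {U : Π x : G, Submodule ℂ (CTDual E x)} {β : Π x : G, U x →ₗ[ℂ] U x →ₗ[ℂ] ℂ}

/-- In the left trivialisation the two fields are φ z and ψ w with constant z and w, so the bracket
formula differentiates the coefficients only. -/
lemma apply_cbracket_smul {φ ψ : G → ℂ} (hφ : SmoothFun E Set.univ φ) (hψ : SmoothFun E Set.univ ψ)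
    (z w : CT E (1 : G)) {x : G} (α : CTDual E x) :
    α (cbracket (fun y => φ y • leftField z y) (fun y => ψ y • leftField w y) x) =
      φ x * cderiv E ψ x (leftField z x) * α (leftField w x) -
        ψ x * cderiv E φ x (leftField w x) * α (leftField z x) +
        φ x * ψ x * α (leftField (brC z w) x) := by
  have hX := ((smoothField_leftField z).smul hφ).fieldDiffAt isOpen_univ (Set.mem_univ x)
  have hY := ((smoothField_leftField w).smul hψ).fieldDiffAt isOpen_univ (Set.mem_univ x)
  have h := apply_leftTInv_cbracket (α ∘ₗ leftT x) hX hY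
  have hφ' := hφ.mdifferentiableAt isOpen_univ (Set.mem_univ x)
  have hψ' := hψ.mdifferentiableAt isOpen_univ (Set.mem_univ x)
  have hc : ∀ {θ : G → ℂ} (c : ℂ), MDifferentiableAt 𝓘(ℝ, E) 𝓘(ℝ, ℂ) θ x →
      cderiv E (fun y => θ y * c) x = c • cderiv E θ x := by
    intro θ c hθ
    rw [← cderiv_const_mul c hθ]
    exact congrArg (fun F => cderiv E F x) (funext fun y => mul_comm _ _)
  simp only [map_smul, leftField, leftTInv_leftT, LinearMap.comp_apply, leftT_leftTInv,
    smul_eq_mul, LinearMap.smul_apply] at h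
  rw [hc _ hφ', hc _ hψ'] at h
  simp only [leftField]
  rw [h]
  simp only [LinearMap.smul_apply, smul_eq_mul]
  ring

lemma wedge3_eq {V : Type*} [AddCommGroup V] [Module ℂ V] (u v w : V) (α β γ : Module.Dual ℂ V) :
    wedge3 u v w α β γ = α u * β v * γ w - α u * γ v * β w - β u * α v * γ w + γ u * α v * β w +
      β u * γ v * α w - γ u * β v * α w := by
  rw [wedge3, Matrix.det_fin_three]
  simp only [Matrix.of_apply, Matrix.cons_val_zero, Matrix.cons_val_one, Matrix.cons_val]
  ring

/-- The 3 × 3 determinants are expanded over permutations and the four decomposable terms are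
regrouped by the order of the covectors. Left-invariant fields without a coefficient are treated as
multiples by 1. -/
lemma schoutenDecomposable_eq {n : ℕ} (b : Fin n → CT E (1 : G)) {P : Fin n → Fin n → G → ℂ}
    (hP : ∀ i j, SmoothFun E Set.univ (P i j)) (x : G) (α₁ α₂ α₃ : CTDual E x) (i j k l : Fin n) :
    schoutenDecomposable
      (fun y => ((1 / 2 : ℂ) * P i j y) • leftField (b i) y) (leftField (b j))
      (fun y => ((1 / 2 : ℂ) * P k l y) • leftField (b k) y) (leftField (b l)) x α₁ α₂ α₃ =
    let S := fun α β γ : CTDual E x => schoutenTerm (fun i j => P i j x)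
      (fun i j => cderiv E (P i j) x ∘ₗ leftT x) brC b (α ∘ₗ leftT x) (β ∘ₗ leftT x)
      (γ ∘ₗ leftT x) i j k l
    S α₁ α₂ α₃ - S α₁ α₃ α₂ - S α₂ α₁ α₃ + S α₃ α₁ α₂ + S α₂ α₃ α₁ - S α₃ α₂ α₁ := by
  have hh : ∀ i j, SmoothFun E Set.univ (fun y => (1 / 2 : ℂ) * P i j y) := fun i j =>
    (hP i j).const_mul _
  have hd : ∀ i j, cderiv E (fun y => (1 / 2 : ℂ) * P i j y) x = (1 / 2 : ℂ) • cderiv E (P i j) x :=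
    fun i j => cderiv_const_mul _ ((hP i j).mdifferentiableAt isOpen_univ (Set.mem_univ x))
  have h1 : SmoothFun E Set.univ (fun _ : G => (1 : ℂ)) := smoothFun_const 1
  have hl : ∀ z : CT E (1 : G), leftField z = fun y => (1 : ℂ) • leftField z y := fun z => by
    ext y; simp
  have hAC := fun α : CTDual E x => apply_cbracket_smul (hh i j) (hh k l) (b i) (b k) α
  have hAD := fun α : CTDual E x => apply_cbracket_smul (hh i j) h1 (b i) (b l) α
  have hBC := fun α : CTDual E x => apply_cbracket_smul h1 (hh k l) (b j) (b k) α
  have hBD := fun α : CTDual E x => apply_cbracket_smul h1 h1 (b j) (b l) α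
  rw [← hl] at hAD hBC hBD
  rw [← hl] at hBD
  simp only [cderiv_const, hd, LinearMap.zero_apply, LinearMap.smul_apply, smul_eq_mul, mul_zero,
    zero_mul, sub_zero, zero_sub, one_mul, mul_one, zero_add] at hAC hAD hBC hBD
  simp only [schoutenDecomposable, wedge3_eq, hAC, hAD, hBC, hBD, schoutenTerm, map_smul,
    smul_eq_mul, LinearMap.comp_apply]
  simp only [leftField]
  ring

variable {σ : (CT E (1 : G) ⧸ annK U) →ₗ[ℂ] CT E (1 : G)} {n : ℕ}

/-- The image of a covector under the projection determined by a splitting. -/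
def splitForm (σ : (CT E (1 : G) ⧸ annK U) →ₗ[ℂ] CT E (1 : G)) (ξ : CTDual E (1 : G)) :
    CTDual E (1 : G) := ξ ∘ₗ σ ∘ₗ (annK U).mkQ

lemma splitForm_mem (ξ : CTDual E (1 : G)) : splitForm σ ξ ∈ U 1 := by
  rw [mem_iff_forall_annK]
  intro k hk
  have : (annK U).mkQ k = 0 := by simpa using hk
  rw [splitForm, LinearMap.comp_apply, LinearMap.comp_apply, this, map_zero, map_zero]

/-- A covector in U_1 kills 𝔨, hence factors through 𝔤_ℂ / 𝔨, and σ is a section of the quotient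
map. With `splitForm_mem`, this makes `splitForm σ` a projection onto U_1. -/
lemma splitForm_eq (hσ : (annK U).mkQ ∘ₗ σ = LinearMap.id) {ξ : CTDual E (1 : G)} (hξ : ξ ∈ U 1) :
    splitForm σ ξ = ξ := by
  refine LinearMap.ext fun z => ?_
  have h1 : σ ((annK U).mkQ z) - z ∈ annK U := by
    rw [← Submodule.Quotient.mk_eq_zero, ← Submodule.mkQ_apply, map_sub,
      ← LinearMap.comp_apply (annK U).mkQ σ, hσ, LinearMap.id_apply, sub_self]
  have h2 := mem_iff_forall_annK.1 hξ _ h1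
  rw [map_sub, sub_eq_zero] at h2
  exact h2

lemma eq_sum_splitForm (hσ : (annK U).mkQ ∘ₗ σ = LinearMap.id)
    (b : Module.Basis (Fin n) ℂ (CT E (1 : G))) {ξ : CTDual E (1 : G)} (hξ : ξ ∈ U 1) :
    ξ = ∑ i, ξ (b i) • splitForm σ (b.coord i) := by
  conv_lhs => rw [← splitForm_eq hσ hξ]
  refine LinearMap.ext fun z => ?_
  rw [LinearMap.sum_apply, splitForm, LinearMap.comp_apply]
  conv_lhs => rw [← b.sum_repr ((σ ∘ₗ (annK U).mkQ) z), map_sum]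
  refine Finset.sum_congr rfl fun i _ => ?_
  rw [map_smul, smul_eq_mul, mul_comm]
  rfl

lemma leftβ_eq_sum (hβ : ∀ x, (β x).IsAlt) (hD : IsAlmostDiracGroup (diracL U β))
    (hσ : (annK U).mkQ ∘ₗ σ = LinearMap.id)
    (b : Module.Basis (Fin n) ℂ (CT E (1 : G))) {ξ η : CTDual E (1 : G)} (hξ : ξ ∈ U 1)
    (hη : η ∈ U 1) (x : G) :
    leftβ U β ξ η x = ∑ i, ∑ j, ξ (b i) * η (b j) *
      leftβ U β (splitForm σ (b.coord i)) (splitForm σ (b.coord j)) x := by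
  conv_lhs => rw [eq_sum_splitForm hσ b hξ, leftβ_sum_left hD _ _ (fun i => splitForm_mem _) hη]
  refine Finset.sum_congr rfl fun i _ => ?_
  conv_lhs => rw [eq_sum_splitForm hσ b hη, leftβ_sum_right hβ hD _ _ (fun i => splitForm_mem _)
    (splitForm_mem _), Finset.mul_sum]
  simp only [mul_assoc]

lemma cderiv_leftβ_eq_sum (hβ : ∀ x, (β x).IsAlt) (hD : IsAlmostDiracGroup (diracL U β))
    (hσ : (annK U).mkQ ∘ₗ σ = LinearMap.id)
    (b : Module.Basis (Fin n) ℂ (CT E (1 : G))) {ξ η : CTDual E (1 : G)} (hξ : ξ ∈ U 1)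
    (hη : η ∈ U 1) (x : G) (Z : CT E x) :
    cderiv E (leftβ U β ξ η) x Z = ∑ i, ∑ j, ξ (b i) * η (b j) *
      cderiv E (leftβ U β (splitForm σ (b.coord i)) (splitForm σ (b.coord j))) x Z := by
  have hd : ∀ i j, MDifferentiableAt 𝓘(ℝ, E) 𝓘(ℝ, ℂ) (fun y => ξ (b i) * η (b j) *
      leftβ U β (splitForm σ (b.coord i)) (splitForm σ (b.coord j)) y) x := fun i j =>
    mdifferentiableAt_mul mdifferentiableAt_const
      (mdifferentiableAt_leftβ hD (splitForm_mem _) (splitForm_mem _) x)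
  rw [funext (leftβ_eq_sum hβ hD hσ b hξ hη),
    cderiv_sum fun i _ => mdifferentiableAt_sum fun j _ => hd i j, LinearMap.sum_apply]
  refine Finset.sum_congr rfl fun i _ => ?_
  rw [cderiv_sum fun j _ => hd i j, LinearMap.sum_apply]
  refine Finset.sum_congr rfl fun j _ => ?_
  rw [cderiv_const_mul _ (mdifferentiableAt_leftβ hD (splitForm_mem _) (splitForm_mem _) x)]
  rfl

/-- A splitting selects one lift of each ξ, namely the contraction of the lifted bivector with ξ. -/
lemma isLift_contract (hβ : ∀ x, (β x).IsAlt) (hD : IsAlmostDiracGroup (diracL U β))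
    (hσ : (annK U).mkQ ∘ₗ σ = LinearMap.id)
    (b : Module.Basis (Fin n) ℂ (CT E (1 : G))) {ξ : CTDual E (1 : G)} (hξ : ξ ∈ U 1) (x : G) :
    IsLift U β x (contract (fun i j => leftβ U β (splitForm σ (b.coord i))
      (splitForm σ (b.coord j)) x) b ξ) ξ := by
  refine ⟨hξ, fun η hη => ?_⟩
  rw [leftβ_eq_sum hβ hD hσ b hξ hη, contract]
  simp only [map_sum, map_smul, smul_eq_mul]
  refine Finset.sum_congr rfl fun i _ => Finset.sum_congr rfl fun j _ => ?_
  ring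

/-- The Schouten bracket is twice the jacobiator. -/
lemma schouten_eq (hβ : ∀ x, (β x).IsAlt) (hD : IsAlmostDiracGroup (diracL U β))
    (hσ : (annK U).mkQ ∘ₗ σ = LinearMap.id)
    (b : Module.Basis (Fin n) ℂ (CT E (1 : G))) (x : G) {ξ₁ ξ₂ ξ₃ : CTDual E (1 : G)}
    (h₁ : ξ₁ ∈ U 1) (h₂ : ξ₂ ∈ U 1) (h₃ : ξ₃ ∈ U 1) :
    let X := contract (fun i j => leftβ U β (splitForm σ (b.coord i))
      (splitForm σ (b.coord j)) x) b
    schouten b (liftβ U β σ) (liftβ U β σ) x (leftForm ξ₁ x) (leftForm ξ₂ x) (leftForm ξ₃ x) =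
      2 * jacobiator U β x (X ξ₁) (X ξ₂) (X ξ₃) ξ₁ ξ₂ ξ₃ := by
  intro X
  set P : Fin n → Fin n → G → ℂ := fun i j =>
    leftβ U β (splitForm σ (b.coord i)) (splitForm σ (b.coord j)) with hP
  have hPs : ∀ i j, SmoothFun E Set.univ (P i j) := fun i j =>
    smoothFun_leftβ hD (splitForm_mem _) (splitForm_mem _)
  have hPa : ∀ i j, P i j x = - P j i x := fun i j => leftβ_swap hβ _ _ x
  have hform : ∀ ξ : CTDual E (1 : G), leftForm ξ x ∘ₗ leftT x = ξ := fun ξ => by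
    ext z; simp [leftForm]
  have hS := sum_schoutenTerm (fun i j => cderiv E (P i j) x ∘ₗ leftT x) (brC (G := G)) b hPa
  have hs : schouten b (liftβ U β σ) (liftβ U β σ) x (leftForm ξ₁ x) (leftForm ξ₂ x)
      (leftForm ξ₃ x) = ∑ i, ∑ j, ∑ k, ∑ l, schoutenDecomposable
      (fun y => ((1 / 2 : ℂ) * P i j y) • leftField (b i) y) (leftField (b j))
      (fun y => ((1 / 2 : ℂ) * P k l y) • leftField (b k) y) (leftField (b l)) x
      (leftForm ξ₁ x) (leftForm ξ₂ x) (leftForm ξ₃ x) := rfl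
  have hDd : ∀ {ξ η : CTDual E (1 : G)}, ξ ∈ U 1 → η ∈ U 1 → ∀ z : CT E (1 : G),
      ∑ i, ∑ j, ξ (b i) * η (b j) * (cderiv E (P i j) x ∘ₗ leftT x) z =
        cderiv E (leftβ U β ξ η) x (leftField z x) := fun hξ hη z =>
    (cderiv_leftβ_eq_sum hβ hD hσ b hξ hη x (leftField z x)).symm
  rw [hs]
  -- Over the six orders of the covectors each bracket term of the jacobiator appears twice, and
  -- each derivative term four times with coefficient 1/2; this is the factor 2.
  simp only [schoutenDecomposable_eq (fun i => b i) hPs, hform, Finset.sum_add_distrib,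
    Finset.sum_sub_distrib, hS, hDd h₁ h₂, hDd h₂ h₁, hDd h₁ h₃, hDd h₃ h₁, hDd h₂ h₃, hDd h₃ h₂]
  rw [jacobiator]
  have hX : ∀ ξ, contract (fun i j => P i j x) (fun i => b i) ξ = X ξ := fun _ => rfl
  simp only [hX]
  rw [cderiv_leftβ_swap hβ hD h₂ h₁, cderiv_leftβ_swap hβ hD h₁ h₃, cderiv_leftβ_swap hβ hD h₃ h₂,
    brC_swap (X ξ₂) (X ξ₁), brC_swap (X ξ₁) (X ξ₃), brC_swap (X ξ₃) (X ξ₂)]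
  simp only [map_neg, LinearMap.neg_apply]
  ring

/-- Two lifts of one covector differ by an element of 𝔨. The derivative terms ignore it by
hypothesis, the bracket terms because 𝔨 is an ideal. -/
lemma DerivVanishesOnK.jacobiator_congr (hK : DerivVanishesOnK U β)
    (hD : IsAlmostDiracGroup (diracL U β)) {x : G}
    {z₁ z₂ z₃ w₁ w₂ w₃ : CT E (1 : G)} {ξ₁ ξ₂ ξ₃ : CTDual E (1 : G)}
    (h₁ : IsLift U β x z₁ ξ₁) (h₂ : IsLift U β x z₂ ξ₂) (h₃ : IsLift U β x z₃ ξ₃)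
    (h₁' : IsLift U β x w₁ ξ₁) (h₂' : IsLift U β x w₂ ξ₂) (h₃' : IsLift U β x w₃ ξ₃) :
    jacobiator U β x z₁ z₂ z₃ ξ₁ ξ₂ ξ₃ = jacobiator U β x w₁ w₂ w₃ ξ₁ ξ₂ ξ₃ := by
  have hk : ∀ {z w : CT E (1 : G)} {ξ : CTDual E (1 : G)}, IsLift U β x z ξ → IsLift U β x w ξ →
      ∃ k ∈ annK U, z = w + k := by
    intro z w ξ hz hw
    refine ⟨z - w, ?_, (add_sub_cancel _ _).symm⟩
    rw [annK, Submodule.mem_dualCoannihilator]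
    intro η hη
    rw [map_sub, hz.2 η hη, hw.2 η hη, sub_self]
  have hd : ∀ {ξ η : CTDual E (1 : G)}, ξ ∈ U 1 → η ∈ U 1 → ∀ {k w : CT E (1 : G)}, k ∈ annK U →
      cderiv E (leftβ U β ξ η) x (leftField (w + k) x) =
        cderiv E (leftβ U β ξ η) x (leftField w x) := by
    intro ξ η hξ hη k w hk
    have : leftField (w + k) x = leftField w x + leftField k x := map_add _ _ _
    rw [this, map_add, show cderiv E (leftβ U β ξ η) x (leftField k x) = 0 from
      hK x ξ hξ η hη k hk, add_zero]
  have hb : ∀ {ξ : CTDual E (1 : G)}, ξ ∈ U 1 → ∀ {k l z w : CT E (1 : G)}, k ∈ annK U →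
      l ∈ annK U → ξ (brC (z + k) (w + l)) = ξ (brC z w) := by
    intro ξ hξ k l z w hk hl
    rw [map_add, map_add, apply_brC_annK hD hξ _ hl, add_zero, brC_swap, map_add, neg_add, map_add,
      map_neg ξ (brC w k), apply_brC_annK hD hξ _ hk, neg_zero, add_zero, ← brC_swap]
  obtain ⟨k₁, hk₁, rfl⟩ := hk h₁ h₁'
  obtain ⟨k₂, hk₂, rfl⟩ := hk h₂ h₂'
  obtain ⟨k₃, hk₃, rfl⟩ := hk h₃ h₃'
  simp only [jacobiator, hd h₂.1 h₃.1 hk₁, hd h₃.1 h₁.1 hk₂, hd h₁.1 h₂.1 hk₃, hb h₃.1 hk₁ hk₂,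
    hb h₂.1 hk₃ hk₁, hb h₁.1 hk₂ hk₃]

/-- The forward direction uses a single splitting and basis, then passes from the contraction lifts
to arbitrary ones. Backwards, the contractions are particular lifts, for any splitting and basis. -/
theorem schoutenVanishes_iff (hβ : ∀ x, (β x).IsAlt) (hD : IsAlmostDiracGroup (diracL U β)) :
    SchoutenVanishes U β ↔ JacobiatorVanishes U β := by
  constructor
  · rintro ⟨hK, h⟩ x z₁ z₂ z₃ ξ₁ ξ₂ ξ₃ h₁ h₂ h₃
    obtain ⟨σ, hσ⟩ := (annK U).mkQ.exists_rightInverse_of_surjective (Submodule.range_mkQ _)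
    have b := Module.finBasis ℂ (CT E (1 : G))
    have h4 := h σ hσ _ b x _ ((leftForm_mem_iff hD).2 h₁.1) _ ((leftForm_mem_iff hD).2 h₂.1) _
      ((leftForm_mem_iff hD).2 h₃.1)
    rw [schouten_eq hβ hD hσ b x h₁.1 h₂.1 h₃.1] at h4
    rw [hK.jacobiator_congr hD h₁ h₂ h₃ (isLift_contract hβ hD hσ b h₁.1 x)
      (isLift_contract hβ hD hσ b h₂.1 x) (isLift_contract hβ hD hσ b h₃.1 x)]
    simpa using h4
  · intro h
    refine ⟨h.derivVanishesOnK hβ hD, fun σ hσ n b x α₁ h₁ α₂ h₂ α₃ h₃ => ?_⟩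
    have h₁' := (mem_iff_comp_leftT hD).1 h₁
    have h₂' := (mem_iff_comp_leftT hD).1 h₂
    have h₃' := (mem_iff_comp_leftT hD).1 h₃
    have h4 := schouten_eq hβ hD hσ b x h₁' h₂' h₃'
    rw [leftForm_comp_leftT, leftForm_comp_leftT, leftForm_comp_leftT] at h4
    rw [h4, h _ _ _ _ _ _ _ (isLift_contract hβ hD hσ b h₁' x)
      (isLift_contract hβ hD hσ b h₂' x) (isLift_contract hβ hD hσ b h₃' x), mul_zero]

end Schouten

end DiracGroup

end

open DiracGroup in
theorem proposition6p13
    {E : Type*} [NormedAddCommGroup E] [NormedSpace ℝ E] [FiniteDimensional ℝ E]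
    {G : Type*} [TopologicalSpace G] [ChartedSpace E G] [Group G] [LieGroup 𝓘(ℝ, E) ∞ G]
    (U : Π x : G, Submodule ℂ (CTDual E x))
    (β : Π x : G, U x →ₗ[ℂ] U x →ₗ[ℂ] ℂ)
    (hβ : ∀ x, (β x).IsAlt)
    (hD : IsAlmostDiracGroup (diracL U β)) :
    List.TFAE [IsDiracGroup (diracL U β), SatisfiesJacobi U β, SchoutenVanishes U β] ∧
      (SatisfiesJacobi U β → IsLieBracketOnSheaf U β) := by
  refine ⟨?_, fun h => h.isLieBracketOnSheaf hβ hD⟩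
  have h1 : IsDiracGroup (diracL U β) ↔ JacobiatorVanishes U β :=
    (and_iff_right hD).trans (isIntegrable_iff hβ hD)
  tfae_have 1 ↔ 2 := h1.trans (satisfiesJacobi_iff hβ hD).symm
  tfae_have 2 ↔ 3 := (satisfiesJacobi_iff hβ hD).trans (schoutenVanishes_iff hβ hD).symm
  tfae_finish
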